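/- Let $n\ge 1$ and let $|\cdot|$ be a norm on $\mathbb R^n$ that is smooth outside the origin. For $\alpha\in\mathbb C$ let $\mathcal S^{\alpha,0}$ be the set of $f\in C^\infty(\mathbb R^n,\mathbb C)$ with an asymptotic expansion $f\sim\sum_{j\ge0}f_{\alpha-j}$ at infinity, $f_{\alpha-j}\in C^\infty(\mathbb R^n\setminus\{0\})$ positively homogeneous of degree $\alpha-j$ (i.e. $\partial^\gamma(f-\sum_{j\le J}f_{\alpha-j})=O(|\xi|^{\mathrm{Re}\,\alpha-J-1-|\gamma|})$ for all $J,\gamma$), and let $\mathcal S^{*,0}$, the space of classical symbols, be the linear span of all $\mathcal S^{\alpha,0}$. Let $W\subset\mathbb C$ be an open neighbourhood of $0$. A simple holomorphic family of order $\alpha:W\to\mathbb C$ ($\alpha$ holomorphic) is a holomorphic map $z\mapsto f(z)$ from $W$ to $C^\infty(\mathbb R^n)$ with $f(z)\in\mathcal S^{\alpha(z),0}$, $f(z)\sim\sum_j f(z)_{\alpha(z)-j}$, such that for every $M\in\mathbb N$ and every compact $L\subset W$ there is $K$ for which the remainder $f_{(M)}(z)=f(z)-\sum_{j\le K}f(z)_{\alpha(z)-j}$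 is holomorphic in $z\in W$ with values in $C^\infty(\mathbb R^n\setminus\{0\})$, is $o(|\xi|^{-M})$ for each $z\in L$, and satisfies $\partial_\xi^\beta\partial_z^kf_{(M)}(z)(\xi)=o(|\xi|^{-M-|\beta|+\epsilon})$ as $|\xi|\to\infty$, uniformly in $z\in L$, for all $\beta$, $k$ and $\epsilon>0$. A holomorphic regularisation on classical symbols is a linear map $\mathcal R:\sigma\mapsto\{\sigma(z)\}_{z\in W}$, $\sigma(z)\in\mathcal S^{*,0}$, such that $\sigma(0)=\sigma$ and $\sigma(z)$ is a finite sum of simple holomorphic families whose orders $\alpha_j$ satisfy $\mathrm{Re}\,\alpha_j'(z)<0$ on $W$. It is called simple if $\mathcal R(\sigma)$ is a simple holomorphic family for every $\alpha\in\mathbb C$ and every $\sigma\in\mathcal S^{\alpha,0}$. For $r\ge0$ and $\sigma_i\in\mathcal S^{*,0}$ the cut-off Chen integral is the finite part $$-\!\!\!\!\!\int_r^{\mathrm{Chen}}\sigma_1\otimes\cdots\otimes\sigma_k:=\mathrm{fp}_{R\to\infty}\int_{r\le|\xi_k|\le\cdots\le|\xi_1|\le R}\sigma_1(\xi_1)\cdots\sigma_k(\xi_k)\,d\xi_1\cdots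 d\xi_k,$$ i.e. the constant term in the asymptotic expansion in functions $R^\beta\log^lR$ ($\beta\in\mathbb C$, $l\in\mathbb N$). Let $\mathcal T(\mathcal S^{*,0})=\bigoplus_{k\ge0}(\mathcal S^{*,0})^{\otimes k}$, with the shuffle product $\sqcup\!\sqcup$, the deconcatenation coproduct and the associated convolution $\star$, and let $\mathcal M(W)$ be the algebra of meromorphic functions on $W$. **Theorem.** Let $\mathcal R$ be a holomorphic regularisation on classical symbols and let $r\ge0$. 1. The finite parts above exist and are unique, and $$\Phi_r^{\mathcal R}(\sigma_1\otimes\cdots\otimes\sigma_k):=\Big(z\mapsto -\!\!\!\!\!\int_r^{\mathrm{Chen}}\sigma_1(z)\otimes\cdots\otimes\sigma_k(z)\Big)$$ defines a character of $(\mathcal T(\mathcal S^{*,0}),\sqcup\!\sqcup)$ with values in $\mathcal M(W)$ (meromorphic functions being identified when they agree outside a discrete closed subset of $W$). 2. $\Phi_r^{\mathcal R}$ has a unique Birkhoff decomposition $\Phi_r^{\mathcal R}=(\Phi_{r,-}^{\mathcal R})^{\star-1}\star\Phi_{r,+}^{\mathcal R}$, with characters $\Phi_{r,\pm}^{\mathcal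 R}$ of $(\mathcal T(\mathcal S^{*,0}),\sqcup\!\sqcup)$ with values in $\mathcal M(W)$, such that $\Phi_{r,-}^{\mathcal R}$ maps tensors of positive degree into $z^{-1}\mathbb C[z^{-1}]$ and $\Phi_{r,+}^{\mathcal R}$ takes values in functions holomorphic at $0$. 3. $\phi_r^{\mathcal R}:=\Phi_{r,+}^{\mathcal R}(0)$ is a character $(\mathcal T(\mathcal S^{*,0}),\sqcup\!\sqcup)\to\mathbb C$. It extends the regularised integral: $\phi_r^{\mathcal R}(\sigma)=\mathrm{fp}_{z=0}\,-\!\!\!\!\!\int_{r\le|\xi|}\sigma(z)(\xi)\,d\xi$ for $\sigma\in\mathcal S^{*,0}$, where $-\!\!\!\!\!\int_{r\le|\xi|}f(\xi)\,d\xi:=\mathrm{fp}_{R\to\infty}\int_{r\le|\xi|\le R}f(\xi)\,d\xi$ is the cut-off integral and $\mathrm{fp}_{z=0}$ is the constant term of the Laurent expansion at $0$. 4. If $\mathcal R$ is moreover simple, then $$\phi_r^{\mathcal R}(\sigma_1\otimes\cdots\otimes\sigma_k)=-\!\!\!\!\!\int_r^{\mathrm{Chen}}\sigma_1\otimes\cdots\otimes\sigma_k$$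 for all $\sigma_i\in\mathcal S^{\alpha_i,0}$, $i=1,\dots,k$, such that none of the left partial sums $\alpha_1+\cdots+\alpha_m$, $m=1,\dots,k$, is an integer. -/

import Mathlib

open scoped TensorProduct DirectSum ContDiff Topology
open Filter MeasureTheory

noncomputable section

namespace ChenRenorm

/-! ### Classical symbols on `ℝⁿ` -/

/-- `ℝⁿ`, with Lebesgue measure `volume`. -/
abbrev Space (n : ℕ) : Type := EuclideanSpace ℝ (Fin n)

/-- A norm on `ℝⁿ` which is smooth outside the origin. -/
def IsSmoothNorm {n : ℕ} (N : Seminorm ℝ (Space n)) : Prop :=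
  (∀ ξ, N ξ = 0 → ξ = 0) ∧ ContDiffOn ℝ ∞ N {0}ᶜ

/-- A smooth function on `ℝⁿ ∖ {0}`, positively homogeneous of complex degree `β`. -/
def IsPosHomogeneous {n : ℕ} (β : ℂ) (a : Space n → ℂ) : Prop :=
  ContDiffOn ℝ ∞ a {0}ᶜ ∧ ∀ t : ℝ, 0 < t → ∀ ξ : Space n, ξ ≠ 0 → a (t • ξ) = (t : ℂ) ^ β * a ξ

/-- `f ∼ ∑ⱼ aⱼ` at infinity, where `aⱼ` is homogeneous of degree `α - j`: for all `J`, all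
derivatives of order `m` of `f - ∑_{j ≤ J} aⱼ` are `O((1 + |ξ|)^(Re α - J - 1 - m))`. -/
def HasSymbolExpansion {n : ℕ} (N : Seminorm ℝ (Space n)) (α : ℂ) (f : Space n → ℂ)
    (a : ℕ → Space n → ℂ) : Prop :=
  (∀ j : ℕ, IsPosHomogeneous (α - j) (a j)) ∧
  ∀ J m : ℕ, ∃ C : ℝ, ∀ ξ : Space n, 1 ≤ N ξ →
    ‖iteratedFDeriv ℝ m (fun η => f η - ∑ j ∈ Finset.range (J + 1), a j η) ξ‖
      ≤ C * (1 + N ξ) ^ (α.re - J - 1 - m)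

/-- The set `𝒮^{α,0}`: smooth functions with an asymptotic expansion into positively homogeneous
functions of degrees `α - j`. -/
def IsSymbolOfOrder {n : ℕ} (N : Seminorm ℝ (Space n)) (α : ℂ) (f : Space n → ℂ) : Prop :=
  ContDiff ℝ ∞ f ∧ ∃ a : ℕ → Space n → ℂ, HasSymbolExpansion N α f a

/-- The space `𝒮^{*,0}` of classical symbols: the linear span of all `𝒮^{α,0}`, `α ∈ ℂ`. -/
def Symbols {n : ℕ} (N : Seminorm ℝ (Space n)) : Submodule ℂ (Space n → ℂ) :=
  Submodule.span ℂ {f | ∃ α : ℂ, IsSymbolOfOrder N α f}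

/-! ### Holomorphic families and holomorphic regularisations -/

/-- A family `f(z)`, `z ∈ W`, of smooth functions on the open set `U ⊆ ℝⁿ` which is holomorphic as
a map into `C^∞(U)`: around each `z₀ ∈ W` it has a Taylor expansion with coefficients in `C^∞(U)`,
convergent together with all `ξ`-derivatives uniformly on compact sets. -/
def IsHolomorphicFamily {n : ℕ} (W : Set ℂ) (U : Set (Space n)) (f : ℂ → Space n → ℂ) : Prop :=
  (∀ z ∈ W, ContDiffOn ℝ ∞ (f z) U) ∧
  ∀ z₀ ∈ W, ∃ ρ : ℝ, 0 < ρ ∧ Metric.ball z₀ ρ ⊆ W ∧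
    ∃ c : ℕ → Space n → ℂ, (∀ k, ContDiffOn ℝ ∞ (c k) U) ∧
      ∀ L : Set ℂ, L ⊆ Metric.ball z₀ ρ → IsCompact L →
      ∀ K : Set (Space n), K ⊆ U → IsCompact K →
      ∀ m : ℕ, TendstoUniformlyOn
        (fun (M : ℕ) (p : ℂ × Space n) =>
          iteratedFDeriv ℝ m (fun ξ => ∑ k ∈ Finset.range M, (p.1 - z₀) ^ k * c k ξ) p.2)
        (fun p => iteratedFDeriv ℝ m (f p.1) p.2) atTop (L ×ˢ K)

/-- A simple holomorphic family of classical symbols on `W`, of holomorphic order `α`.  The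
estimates on the remainders are required uniformly for `z` in compact subsets of `W`. -/
def IsSimpleHolomorphicFamily {n : ℕ} (N : Seminorm ℝ (Space n)) (W : Set ℂ) (α : ℂ → ℂ)
    (f : ℂ → Space n → ℂ) : Prop :=
  DifferentiableOn ℂ α W ∧ IsHolomorphicFamily W Set.univ f ∧
  ∃ a : ℕ → ℂ → Space n → ℂ,
    (∀ z ∈ W, HasSymbolExpansion N (α z) (f z) (fun j => a j z)) ∧
    ∀ (M : ℕ) (L : Set ℂ), L ⊆ W → IsCompact L → ∃ (K : ℕ) (rem : ℂ → Space n → ℂ),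
      (∀ z ξ, rem z ξ = f z ξ - ∑ j ∈ Finset.range (K + 1), a j z ξ) ∧
      IsHolomorphicFamily W {0}ᶜ rem ∧
      (∀ z ∈ L, rem z =o[Bornology.cobounded (Space n)] fun ξ => N ξ ^ (-(M : ℝ))) ∧
      ∀ (m k : ℕ) (ε : ℝ), 0 < ε → ∀ δ : ℝ, 0 < δ → ∃ B : ℝ, ∀ z ∈ L, ∀ ξ : Space n, B ≤ N ξ →
        ‖iteratedFDeriv ℝ m (fun η => iteratedDeriv k (fun w => rem w η) z) ξ‖
          ≤ δ * N ξ ^ (-(M : ℝ) - m + ε)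

/-- A (linear) holomorphic regularisation `f ↦ (R z f)_{z ∈ W}` on classical symbols: `R 0 f = f`
and `R z f` is a finite sum of simple holomorphic families with orders `α` such that
`Re α' < 0` on `W`. -/
def IsHolomorphicRegularisation {n : ℕ} (N : Seminorm ℝ (Space n)) (W : Set ℂ)
    (R : ℂ → Symbols N →ₗ[ℂ] Symbols N) : Prop :=
  (∀ f, R 0 f = f) ∧
  ∀ f : Symbols N, ∃ (s : ℕ) (α : Fin s → ℂ → ℂ) (g : Fin s → ℂ → Space n → ℂ),
    (∀ i, IsSimpleHolomorphicFamily N W (α i) (g i) ∧ ∀ z ∈ W, (deriv (α i) z).re < 0) ∧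
    ∀ z ∈ W, (R z f : Space n → ℂ) = ∑ i, g i z

/-- The regularisation is simple: it maps each symbol in some `𝒮^{α,0}` to a simple family. -/
def IsSimpleRegularisation {n : ℕ} (N : Seminorm ℝ (Space n)) (W : Set ℂ)
    (R : ℂ → Symbols N →ₗ[ℂ] Symbols N) : Prop :=
  ∀ (α : ℂ) (f : Symbols N), IsSymbolOfOrder N α f →
    ∃ β : ℂ → ℂ, IsSimpleHolomorphicFamily N W β (fun z => (R z f : Space n → ℂ))

/-! ### Nested integrals and finite parts -/

/-- The Chen integral
`∫_{r ≤ |ξ_k| ≤ ⋯ ≤ |ξ_1| ≤ R} σ_1(ξ_1) ⋯ σ_k(ξ_k) dξ_1 ⋯ dξ_k`. -/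
def chenIntegral {n : ℕ} (N : Seminorm ℝ (Space n)) (r R : ℝ) {k : ℕ}
    (σ : Fin k → Space n → ℂ) : ℂ :=
  ∫ ξ in {ξ : Fin k → Space n |
      (∀ i, r ≤ N (ξ i) ∧ N (ξ i) ≤ R) ∧ Antitone (fun i => N (ξ i))}, ∏ i, σ i (ξ i)

/-- `c` is the constant term of an asymptotic expansion of `F(R)`, as `R → ∞`, in the functions
`R^β (log R)^l` with `β ∈ ℂ`, `l ∈ ℕ`, up to `o(1)`. -/
def HasFinitePart (F : ℝ → ℂ) (c : ℂ) : Prop :=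
  ∃ (s : Finset (ℂ × ℕ)) (a : ℂ × ℕ → ℂ), (0, 0) ∉ s ∧
    Tendsto (fun R : ℝ => F R - ∑ p ∈ s, a p * (R : ℂ) ^ p.1 * (Real.log R : ℂ) ^ p.2) atTop (𝓝 c)

open Classical in
/-- The finite part `fp_{R → ∞} F(R)`. -/
def finitePart (F : ℝ → ℂ) : ℂ := if h : ∃ c, HasFinitePart F c then h.choose else 0

/-- The cut-off integral of `f` over `{r ≤ |ξ|}`. -/
def cutoffIntegral {n : ℕ} (N : Seminorm ℝ (Space n)) (r : ℝ) (f : Space n → ℂ) : ℂ :=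
  finitePart fun R => ∫ ξ in {ξ : Space n | r ≤ N ξ ∧ N ξ ≤ R}, f ξ

/-- The cut-off Chen integral of `σ_1 ⊗ ⋯ ⊗ σ_k`. -/
def cutoffChen {n : ℕ} (N : Seminorm ℝ (Space n)) (r : ℝ) {k : ℕ}
    (σ : Fin k → Space n → ℂ) : ℂ :=
  finitePart fun R => chenIntegral N r R σ

/-- `c` is the constant term of the Laurent expansion of `f` at `0`. -/
def IsFinitePartAtZero (f : ℂ → ℂ) (c : ℂ) : Prop :=
  ∃ p : Polynomial ℂ, p.coeff 0 = 0 ∧ Tendsto (fun z => f z - p.eval z⁻¹) (𝓝[≠] 0) (𝓝 c)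

/-! ### The algebra of meromorphic functions on `W` -/

/-- Functions which are meromorphic at each point of `W`. -/
def meromorphicSubalgebra (W : Set ℂ) : Subalgebra ℂ (ℂ → ℂ) where
  carrier := {f | MeromorphicOn f W}
  mul_mem' hf hg := hf.mul hg
  add_mem' hf hg := hf.add hg
  algebraMap_mem' c := MeromorphicOn.const c

/-- Functions vanishing on `W` outside a discrete relatively closed subset of `W`. -/
def negligible (W : Set ℂ) : Ideal (meromorphicSubalgebra W) where
  carrier := {f | (f : ℂ → ℂ) =ᶠ[codiscreteWithin W] 0}
  add_mem' {f g} hf hg := by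
    have h : (f : ℂ → ℂ) + (g : ℂ → ℂ) =ᶠ[codiscreteWithin W] 0 + 0 := EventuallyEq.add hf hg
    simpa using h
  zero_mem' := EventuallyEq.refl (codiscreteWithin W) (0 : ℂ → ℂ)
  smul_mem' c f hf := by
    have h : (c : ℂ → ℂ) * (f : ℂ → ℂ) =ᶠ[codiscreteWithin W] (c : ℂ → ℂ) * 0 :=
      EventuallyEq.mul EventuallyEq.rfl hf
    simpa using h

/-- The algebra of meromorphic functions on `W` (the values at a discrete set do not count). -/
def Mero (W : Set ℂ) : Type := meromorphicSubalgebra W ⧸ negligible W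

instance (W : Set ℂ) : CommRing (Mero W) :=
  inferInstanceAs (CommRing (meromorphicSubalgebra W ⧸ negligible W))

instance (W : Set ℂ) : Algebra ℂ (Mero W) :=
  inferInstanceAs (Algebra ℂ (meromorphicSubalgebra W ⧸ negligible W))

/-- The class of a function which is meromorphic on `W`. -/
def Mero.mk {W : Set ℂ} (f : ℂ → ℂ) (hf : MeromorphicOn f W) : Mero W :=
  Ideal.Quotient.mk (negligible W) ⟨f, hf⟩

/-- The function `f` is meromorphic on `W`, and `g` is the element of `Mero W` that it defines. -/
def Mero.Represents {W : Set ℂ} (g : Mero W) (f : ℂ → ℂ) : Prop :=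
  ∃ hf : MeromorphicOn f W, Mero.mk f hf = g

/-- `g` is holomorphic at `0` with value `c` there. -/
def Mero.HasValueAtZero {W : Set ℂ} (g : Mero W) (c : ℂ) : Prop :=
  ∃ f : ℂ → ℂ, g.Represents f ∧ AnalyticAt ℂ f 0 ∧ f 0 = c

/-- `g` belongs to `z⁻¹ ℂ[z⁻¹]`. -/
def Mero.IsPolar {W : Set ℂ} (g : Mero W) : Prop :=
  ∃ p : Polynomial ℂ, p.coeff 0 = 0 ∧ g.Represents (fun z => p.eval z⁻¹)

/-! ### The shuffle algebra and the deconcatenation coproduct -/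

section Tensor

variable (V : Type) [AddCommGroup V] [Module ℂ V]

/-- `𝒯(V) = ⨁_k V^{⊗ k}`. -/
abbrev Tensors : Type := ⨁ k : ℕ, ⨂[ℂ]^k V

variable {V}

/-- Inclusion of the summand `V^{⊗ k}`. -/
def ofDeg (k : ℕ) : ⨂[ℂ]^k V →ₗ[ℂ] Tensors V :=
  DirectSum.lof ℂ ℕ (fun k => ⨂[ℂ]^k V) k

/-- The element `v_1 ⊗ ⋯ ⊗ v_k` of `𝒯(V)`. -/
def pureTensor {k : ℕ} (v : Fin k → V) : Tensors V := ofDeg k (PiTensorProduct.tprod ℂ v)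

/-- `(k,l)`-shuffles: `τ(1) < ⋯ < τ(k)` and `τ(k+1) < ⋯ < τ(k+l)`. -/
def IsShuffle (k l : ℕ) (τ : Equiv.Perm (Fin (k + l))) : Prop :=
  StrictMono (fun i : Fin k => τ (Fin.castAdd l i)) ∧
    StrictMono (fun i : Fin l => τ (Fin.natAdd k i))

open Classical in
/-- The shuffle product `V^{⊗ k} × V^{⊗ l} → V^{⊗ (k+l)}`,
`(v_1 ⊗ ⋯ ⊗ v_k, v_{k+1} ⊗ ⋯ ⊗ v_{k+l}) ↦ ∑_τ v_{τ⁻¹(1)} ⊗ ⋯ ⊗ v_{τ⁻¹(k+l)}`. -/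
def shuffleDeg (k l : ℕ) : ⨂[ℂ]^k V →ₗ[ℂ] ⨂[ℂ]^l V →ₗ[ℂ] ⨂[ℂ]^(k + l) V :=
  (TensorProduct.mk ℂ (⨂[ℂ]^k V) (⨂[ℂ]^l V)).compr₂
    ((∑ τ : Equiv.Perm (Fin (k + l)) with IsShuffle k l τ,
      (PiTensorProduct.reindex ℂ (fun _ => V) τ).toLinearMap) ∘ₗ
        (TensorPower.mulEquiv (R := ℂ) (M := V) (n := k) (m := l)).toLinearMap)

/-- The shuffle product on `𝒯(V)`. -/
def shuffle : Tensors V →ₗ[ℂ] Tensors V →ₗ[ℂ] Tensors V :=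
  DirectSum.toModule ℂ ℕ _ fun k => LinearMap.flip <|
    DirectSum.toModule ℂ ℕ _ fun l => ((shuffleDeg k l).compr₂ (ofDeg (k + l))).flip

/-- The deconcatenation coproduct
`Δ(v_1 ⊗ ⋯ ⊗ v_k) = ∑_{j=0}^k (v_1 ⊗ ⋯ ⊗ v_j) ⨂ (v_{j+1} ⊗ ⋯ ⊗ v_k)`. -/
def deconcatenation : Tensors V →ₗ[ℂ] Tensors V ⊗[ℂ] Tensors V :=
  DirectSum.toModule ℂ ℕ _ fun k => ∑ j : Fin (k + 1),
    TensorProduct.map (ofDeg (V := V) j) (ofDeg (V := V) (k - j)) ∘ₗ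
      (TensorPower.mulEquiv (R := ℂ) (M := V) (n := j) (m := k - j)).symm.toLinearMap ∘ₗ
        (TensorPower.cast ℂ V (show k = j + (k - j) by omega)).toLinearMap

variable {A : Type} [CommRing A] [Algebra ℂ A]

/-- The convolution product of linear maps `𝒯(V) → A`. -/
def convolution (φ ψ : Tensors V →ₗ[ℂ] A) : Tensors V →ₗ[ℂ] A :=
  LinearMap.mul' ℂ A ∘ₗ TensorProduct.map φ ψ ∘ₗ deconcatenation

/-- The unit for convolution: projection onto `V^{⊗ 0} = ℂ`, followed by `ℂ → A`. -/
def convolutionUnit : Tensors V →ₗ[ℂ] A :=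
  Algebra.linearMap ℂ A ∘ₗ (PiTensorProduct.isEmptyEquiv (Fin 0)).toLinearMap ∘ₗ
    DirectSum.component ℂ ℕ (fun k => ⨂[ℂ]^k V) 0

/-- Characters of `(𝒯(V), ⧢)` with values in `A`. -/
def IsShuffleCharacter (φ : Tensors V →ₗ[ℂ] A) : Prop :=
  φ (pureTensor (Fin.elim0 : Fin 0 → V)) = 1 ∧ ∀ x y, φ (shuffle x y) = φ x * φ y

/-- `Φ = Φ₋^{⋆ -1} ⋆ Φ₊` is the Birkhoff decomposition (minimal subtraction at `z = 0`) of `Φ`: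
`Φ₋` and `Φ₊` are characters, `Φ₋` maps positive degree to `z⁻¹ ℂ[z⁻¹]`, and `Φ₊` takes values in
functions holomorphic at `0`. -/
structure IsBirkhoffDecomposition {W : Set ℂ} (Φ Φm Φp : Tensors V →ₗ[ℂ] Mero W) : Prop where
  character_minus : IsShuffleCharacter Φm
  character_plus : IsShuffleCharacter Φp
  polar_minus : ∀ k : ℕ, 0 < k → ∀ x : ⨂[ℂ]^k V, (Φm (ofDeg k x)).IsPolar
  holomorphic_plus : ∀ x, ∃ c : ℂ, (Φp x).HasValueAtZero c
  factorisation : ∃ Ψ : Tensors V →ₗ[ℂ] Mero W,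
    convolution Ψ Φm = convolutionUnit ∧ convolution Φm Ψ = convolutionUnit ∧
      Φ = convolution Ψ Φp

end Tensor

end ChenRenorm

end

open ChenRenorm

noncomputable section

namespace ChenRenorm

open Asymptotics
open scoped Pointwise

/-! ### Uniqueness of finite parts -/

/-! Polar coordinates adapted to the norm turn a Chen integral into a one-variable iterated integral
of the functions `radial N σ_i` (`IsSmoothNorm.chenIntegral_eq_iterInt`). The radial function of a
symbol of order α expands in the powers t^(α-j+n-1). Integrating term by term expands the iterated
integral in functions R^β log^l R; apart from the constant of integration, the exponents β are sums,
over the letters of a nonempty prefix of the word, of an exponent of the letter plus one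
(`exists_hasExpansion_iterInt`). The constant term is unique because, after R = e^x, translation
operators separate exponential polynomials (`HasFinitePart.unique`).

By the product rule, a product of two iterated integrals is the sum over the shuffles of the two
words (`sum_iterInt_shuffles`). Finite parts are not multiplicative in general, since R^β and R^(-β)
recombine into a constant. For regularised symbols all exponents lie in finitely many families β(z)
+ ℤ with Re β' < 0, so they avoid 0 off a discrete set, and so do their sums
(`IsMovingExponents.eventually_zero_notMem`). There the shuffle relation passes to finite parts.
Meromorphy comes from repeated integration by parts: once the denominators e(z) + 1 produced by
integrating t^e(z) are cleared, the finite part is locally a quotient c(z)/d(z) of holomorphic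
functions (`exists_finitePart_iterInt_eq_div`).

The Birkhoff decomposition is algebraic. `Mero W` is the direct sum of z⁻¹ℂ[z⁻¹] and the subalgebra
of elements holomorphic at 0 (`Mero.isCompl_polar`). The minus part is defined by recursion on word
length; it is multiplicative because its shuffle defect lies in both summands (`exists_birkhoff`),
and the same intersection gives uniqueness (`birkhoff_unique`). Evaluating the plus part at 0 gives
the character φ.

For the last claim, the minus part vanishes on a word all of whose nonempty prefixes have
holomorphic image, so that Φ₊ = Φ there (`birkhoff_eq_of_mem`). Nonintegral left partial sums of the
orders give this holomorphy, provided that the orders of the regularised families at z = 0 agree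
with the given α_i modulo ℤ. This can fail for symbols with zero expansion, such as Schwartz
functions, which have every order; it holds once some term of the expansion is nonzero
(`HasSymbolExpansion.exists_int_of_ne_zero`). A general symbol is a sum of two such
(`IsSymbolOfOrder.exists_add`), and multilinearity concludes. -/

/-- Translation by `h` on functions of a real variable. -/
def shift (h : ℝ) : Module.End ℂ (ℝ → ℂ) := LinearMap.funLeft ℂ ℂ (fun x => x + h)

lemma shift_apply (h : ℝ) (f : ℝ → ℂ) (x : ℝ) : shift h f x = f (x + h) := rfl

lemma tendsto_aeval_shift (h : ℝ) (q : Polynomial ℂ) {f : ℝ → ℂ}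
    (hf : Tendsto f atTop (𝓝 0)) : Tendsto (Polynomial.aeval (shift h) q f) atTop (𝓝 0) := by
  induction q using Polynomial.induction_on' with
  | add p q hp hq =>
    have := hp.add hq
    simp only [add_zero] at this
    rw [map_add]
    exact this
  | monomial n a =>
    have key : ∀ n : ℕ, Tendsto ((shift h ^ n) f) atTop (𝓝 0) := by
      intro n
      induction n with
      | zero => simpa using hf
      | succ n ih =>
        rw [pow_succ', Module.End.mul_apply]
        exact ih.comp (tendsto_atTop_add_const_right _ h tendsto_id)
    rw [Polynomial.aeval_monomial]
    have := (key n).const_mul a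
    rw [mul_zero] at this
    exact this

/-- On e^(wx) p(x) the operator shift − e^(wh) acts, up to the factor e^(wh), as p ↦ p(· + h) − p,
which lowers the degree. -/
lemma aeval_shift_exp_mul_polynomial (h : ℝ) (w : ℂ) (k : ℕ) (p : Polynomial ℂ)
    (hp : p.degree < k) :
    Polynomial.aeval (shift h) ((Polynomial.X - Polynomial.C (Complex.exp (w * h))) ^ k)
      (fun x : ℝ => Complex.exp (w * x) * p.eval (x : ℂ)) = 0 := by
  induction k generalizing p with
  | zero =>
    have : p = 0 := by
      rw [← Polynomial.degree_eq_bot]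
      simpa [Nat.WithBot.lt_zero_iff] using hp
    subst this
    funext x
    simp
  | succ k ih =>
    have h1 : Polynomial.aeval (shift h) (Polynomial.X - Polynomial.C (Complex.exp (w * h)))
        (fun x : ℝ => Complex.exp (w * x) * p.eval (x : ℂ)) =
        fun x : ℝ => Complex.exp (w * x) *
          (Polynomial.C (Complex.exp (w * h)) * (Polynomial.taylor (h : ℂ) p - p)).eval (x : ℂ) := by
      funext x
      simp only [map_sub, Polynomial.aeval_X, Polynomial.aeval_C, LinearMap.sub_apply, Pi.sub_apply,
        shift_apply, Module.algebraMap_end_apply, Pi.smul_apply, smul_eq_mul, Polynomial.eval_mul,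
        Polynomial.eval_C, Polynomial.eval_sub, Polynomial.taylor_eval]
      push_cast
      rw [mul_add, Complex.exp_add]
      ring_nf
    rw [pow_succ, map_mul, Module.End.mul_apply, h1]
    apply ih
    have h2 : (Polynomial.taylor (h : ℂ) p - p).degree < k := by
      by_cases h0 : p = 0
      · subst h0
        simp
      · have h3 : (Polynomial.taylor (h : ℂ) p - p).degree < p.degree := by
          rw [← Polynomial.degree_taylor p (h : ℂ)]
          exact Polynomial.degree_sub_lt_left (Polynomial.degree_taylor p _)
            (by simpa using h0) (by simp)
        have h4 : p.degree ≤ k := by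
          rw [Polynomial.degree_eq_natDegree h0] at hp ⊢
          norm_cast at hp ⊢
          omega
        exact lt_of_lt_of_le h3 h4
    rwa [Polynomial.degree_C_mul (Complex.exp_ne_zero _)]

/-- A nonconstant polynomial is unbounded along the real axis. -/
lemma polynomial_eq_zero_of_tendsto {p : Polynomial ℂ} {c : ℂ}
    (hp : Tendsto (fun x : ℝ => p.eval (x : ℂ)) atTop (𝓝 c)) : p = Polynomial.C c := by
  have h1 : p.degree ≤ 0 := by
    by_contra hd
    push Not at hd
    have h2 : Tendsto (fun x : ℝ => ‖p.eval (x : ℂ)‖) atTop atTop := by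
      refine Polynomial.tendsto_norm_atTop p hd ?_
      simpa using tendsto_abs_atTop_atTop
    exact not_tendsto_nhds_of_tendsto_atTop h2 _ hp.norm
  rw [Polynomial.eq_C_of_degree_le_zero h1] at hp ⊢
  simp only [Polynomial.eval_C] at hp
  rw [tendsto_nhds_unique tendsto_const_nhds hp]

/-- Shifts by h see an exponent w only through e^(wh). A step with |wh| < 1 < 2π keeps every nonzero
w of the finite set apart from 0. -/
lemma exists_step (s : Finset ℂ) :
    ∃ h : ℝ, 0 < h ∧ ∀ w ∈ s, w ≠ 0 → Complex.exp (w * h) ≠ 1 := by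
  have hs : 0 ≤ ∑ w ∈ s, ‖w‖ := Finset.sum_nonneg fun _ _ => norm_nonneg _
  refine ⟨1 / (1 + ∑ w ∈ s, ‖w‖), by positivity, fun w hw h0 he => ?_⟩
  obtain ⟨m, hm⟩ := Complex.exp_eq_one_iff.1 he
  have h1 : ‖w * ((1 / (1 + ∑ w ∈ s, ‖w‖) : ℝ) : ℂ)‖ < 1 := by
    rw [norm_mul, Complex.norm_real, Real.norm_of_nonneg (by positivity), mul_one_div,
      div_lt_one (by positivity)]
    have : ‖w‖ ≤ ∑ w ∈ s, ‖w‖ :=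
      Finset.single_le_sum (f := fun w : ℂ => ‖w‖) (fun _ _ => norm_nonneg _) hw
    linarith
  have hm0 : m ≠ 0 := by
    rintro rfl
    simp only [Int.cast_zero, zero_mul, mul_eq_zero, Complex.ofReal_eq_zero] at hm
    rcases hm with hm | hm
    · exact h0 hm
    · have : (0:ℝ) < 1 / (1 + ∑ w ∈ s, ‖w‖) := by positivity
      exact this.ne' hm
  rw [hm, norm_mul] at h1
  have h2 : ‖(2 * Real.pi * Complex.I : ℂ)‖ = 2 * Real.pi := by
    simp [abs_of_pos Real.pi_pos]
  rw [h2, Complex.norm_intCast] at h1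
  have h3 : (1 : ℝ) ≤ |(m : ℝ)| := by exact_mod_cast Int.one_le_abs hm0
  nlinarith [Real.pi_gt_three]

/-- The function `R^β (log R)^l`. -/
def logPower (p : ℂ × ℕ) : ℝ → ℂ := fun R => (R : ℂ) ^ p.1 * (Real.log R : ℂ) ^ p.2

lemma logPower_exp (p : ℂ × ℕ) (x : ℝ) :
    logPower p (Real.exp x) = Complex.exp (p.1 * x) * (x : ℂ) ^ p.2 := by
  rw [logPower, Real.log_exp, Complex.ofReal_exp, Complex.cpow_def_of_ne_zero (Complex.exp_ne_zero _),
    ← Complex.ofReal_exp, ← Complex.ofReal_log (Real.exp_pos x).le, Real.log_exp, mul_comm (x : ℂ)]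

/-- Growth rates cannot separate the terms, since imaginary exponents oscillate. With R = e^x, the
sum minus c is P(x) + g(x), where the polynomial P collects the exponent 0. A polynomial q in the
shift kills g, a power of shift − 1 kills P, and the two are coprime; by Bézout some multiple of q
kills g and fixes P. Such operators preserve convergence to 0, so P → 0 and P = 0. As (0, 0) is
excluded, the constant coefficient of P is −c. -/
lemma eq_zero_of_tendsto_sum_logPower {s : Finset (ℂ × ℕ)} (hs : (0, 0) ∉ s) {a : ℂ × ℕ → ℂ} {c : ℂ}
    (hc : Tendsto (fun R : ℝ => ∑ p ∈ s, a p * logPower p R) atTop (𝓝 c)) : c = 0 := by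
  classical
  obtain ⟨h, -, hh⟩ := exists_step (s.image Prod.fst)
  set P : Polynomial ℂ := (∑ p ∈ s with p.1 = 0, Polynomial.C (a p) * Polynomial.X ^ p.2)
    - Polynomial.C c with hP
  set g : ℝ → ℂ := fun x => ∑ p ∈ s with p.1 ≠ 0, a p * (Complex.exp (p.1 * x) * (x : ℂ) ^ p.2)
    with hg
  have hf : Tendsto (fun x : ℝ => P.eval (x : ℂ) + g x) atTop (𝓝 0) := by
    have h1 := (hc.comp Real.tendsto_exp_atTop).sub_const c
    rw [sub_self] at h1
    refine h1.congr fun x => ?_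
    simp only [Function.comp, logPower_exp, hP, hg]
    rw [← Finset.sum_filter_add_sum_filter_not s (fun p => p.1 = 0)]
    simp only [Polynomial.eval_sub, Polynomial.eval_C, Polynomial.eval_finsetSum,
      Polynomial.eval_mul, Polynomial.eval_pow, Polynomial.eval_X]
    have : ∑ p ∈ s with p.1 = 0, a p * (Complex.exp (p.1 * x) * (x : ℂ) ^ p.2) =
        ∑ p ∈ s with p.1 = 0, a p * (x : ℂ) ^ p.2 := by
      refine Finset.sum_congr rfl fun p hp => ?_
      rw [(Finset.mem_filter.1 hp).2]
      simp
    rw [this]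
    ring
  set q : Polynomial ℂ := ∏ p ∈ s with p.1 ≠ 0,
    (Polynomial.X - Polynomial.C (Complex.exp (p.1 * h))) ^ (p.2 + 1) with hq
  have hqg : Polynomial.aeval (shift h) q g = 0 := by
    have : g = ∑ p ∈ s with p.1 ≠ 0, a p • fun x : ℝ => Complex.exp (p.1 * x) * (x : ℂ) ^ p.2 := by
      funext x
      simp [hg]
    rw [this, map_sum]
    refine Finset.sum_eq_zero fun p hp => ?_
    rw [map_smul, hq, ← Finset.prod_erase_mul _ _ hp, map_mul, Module.End.mul_apply]
    have h2 := aeval_shift_exp_mul_polynomial h p.1 (p.2 + 1) ((Polynomial.X : Polynomial ℂ) ^ p.2) (by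
      rw [Polynomial.degree_X_pow]; exact_mod_cast Nat.lt_succ_self _)
    simp only [Polynomial.eval_pow, Polynomial.eval_X] at h2
    rw [h2, map_zero, smul_zero]
  have hcop : IsCoprime q ((Polynomial.X - Polynomial.C 1) ^ (P.natDegree + 1)) := by
    refine IsCoprime.pow_right (IsCoprime.prod_left fun p hp => IsCoprime.pow_left ?_)
    have hp' := Finset.mem_filter.1 hp
    exact Polynomial.isCoprime_X_sub_C_of_isUnit_sub (isUnit_iff_ne_zero.2
      (sub_ne_zero.2 (hh p.1 (Finset.mem_image_of_mem _ hp'.1) hp'.2)))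
  obtain ⟨u, v, huv⟩ := hcop
  have hPk : Polynomial.aeval (shift h) (((Polynomial.X : Polynomial ℂ) - Polynomial.C 1) ^ (P.natDegree + 1))
      (fun x : ℝ => P.eval (x : ℂ)) = 0 := by
    have := aeval_shift_exp_mul_polynomial h 0 (P.natDegree + 1) P
      (lt_of_le_of_lt Polynomial.degree_le_natDegree (by exact_mod_cast Nat.lt_succ_self _))
    simpa using this
  have hPu : Polynomial.aeval (shift h) (u * q) (fun x : ℝ => P.eval (x : ℂ) + g x) =
      fun x : ℝ => P.eval (x : ℂ) := by
    have h3 : (fun x : ℝ => P.eval (x : ℂ) + g x) = (fun x : ℝ => P.eval (x : ℂ)) + g := rfl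
    have h4 : Polynomial.aeval (shift h) (u * q) g = 0 := by
      rw [map_mul, Module.End.mul_apply, hqg, map_zero]
    have h5 : Polynomial.aeval (shift h)
        (v * (Polynomial.X - Polynomial.C 1) ^ (P.natDegree + 1))
        (fun x : ℝ => P.eval (x : ℂ)) = 0 := by
      rw [map_mul, Module.End.mul_apply, hPk, map_zero]
    have h6 := congrArg (fun r => Polynomial.aeval (shift h) r (fun x : ℝ => P.eval (x : ℂ))) huv
    beta_reduce at h6
    rw [map_add, LinearMap.add_apply, h5, add_zero, map_one, Module.End.one_apply] at h6
    rw [h3, map_add, h4, h6, add_zero]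
  have h7 := tendsto_aeval_shift h (u * q) hf
  rw [hPu] at h7
  have h8 := congrArg (Polynomial.eval 0) (polynomial_eq_zero_of_tendsto h7)
  simp only [hP, Polynomial.eval_sub, Polynomial.eval_C, Polynomial.eval_finsetSum,
      Polynomial.eval_mul, Polynomial.eval_pow, Polynomial.eval_X] at h8
  rw [Finset.sum_eq_zero] at h8
  · simpa using h8
  · intro p hp
    have hp' := Finset.mem_filter.1 hp
    have : p.2 ≠ 0 := fun h9 => hs (by
      have : p = (0, 0) := Prod.ext hp'.2 h9
      rw [← this]
      exact hp'.1)
    rw [zero_pow this, mul_zero]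

lemma HasFinitePart.unique {F : ℝ → ℂ} {c c' : ℂ} (h : HasFinitePart F c)
    (h' : HasFinitePart F c') : c = c' := by
  classical
  obtain ⟨s, a, hs, ha⟩ := h
  obtain ⟨s', a', hs', ha'⟩ := h'
  have h1 := ha.sub ha'
  have h2 : Tendsto (fun R : ℝ => ∑ p ∈ s ∪ s',
      ((if p ∈ s' then a' p else 0) - if p ∈ s then a p else 0) * logPower p R) atTop
      (𝓝 (c - c')) := by
    refine h1.congr fun R => ?_
    have e1 : ∑ p ∈ s, a p * (R : ℂ) ^ p.1 * (Real.log R : ℂ) ^ p.2 =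
        ∑ p ∈ s ∪ s', (if p ∈ s then a p else 0) * logPower p R := by
      simp only [ite_mul, zero_mul, Finset.sum_ite_mem]
      rw [Finset.inter_eq_right.2 Finset.subset_union_left]
      simp only [logPower, mul_assoc]
    have e2 : ∑ p ∈ s', a' p * (R : ℂ) ^ p.1 * (Real.log R : ℂ) ^ p.2 =
        ∑ p ∈ s ∪ s', (if p ∈ s' then a' p else 0) * logPower p R := by
      simp only [ite_mul, zero_mul, Finset.sum_ite_mem]
      rw [Finset.inter_eq_right.2 Finset.subset_union_right]
      simp only [logPower, mul_assoc]
    rw [e1, e2]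
    simp only [sub_mul, Finset.sum_sub_distrib]
    ring
  have := eq_zero_of_tendsto_sum_logPower (by simp [hs, hs']) h2
  exact sub_eq_zero.1 this

lemma HasFinitePart.finitePart_eq {F : ℝ → ℂ} {c : ℂ} (h : HasFinitePart F c) :
    finitePart F = c := by
  have h' : ∃ c, HasFinitePart F c := ⟨c, h⟩
  rw [finitePart, dif_pos h']
  exact h'.choose_spec.unique h

lemma HasFinitePart.congr {F G : ℝ → ℂ} {c : ℂ} (h : HasFinitePart F c) (hFG : F =ᶠ[atTop] G) :
    HasFinitePart G c := by
  obtain ⟨s, a, hs, ha⟩ := h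
  exact ⟨s, a, hs, ha.congr' (hFG.mono fun R hR => by rw [hR])⟩

/-! ### Asymptotic expansions at infinity -/

/-- The span of the functions `R^β (log R)^l`, `β ∈ E`, `l ∈ ℕ`. -/
def LogPowers (E : Set ℂ) : Submodule ℂ (ℝ → ℂ) :=
  Submodule.span ℂ (logPower '' {p | p.1 ∈ E})

/-- `F(R)` is a combination of functions `R^β (log R)^l` with `β ∈ E`, up to `O(R^{-M})`. -/
def HasExpansion (E : Set ℂ) (M : ℝ) (F : ℝ → ℂ) : Prop :=
  ∃ P ∈ LogPowers E, (fun R => F R - P R) =O[atTop] fun R : ℝ => R ^ (-M)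

lemma logPower_mem {E : Set ℂ} {p : ℂ × ℕ} (hp : p.1 ∈ E) : logPower p ∈ LogPowers E :=
  Submodule.subset_span ⟨p, hp, rfl⟩

lemma LogPowers.mono {E E' : Set ℂ} (h : E ⊆ E') : LogPowers E ≤ LogPowers E' :=
  Submodule.span_mono (Set.image_mono fun _ hp => h hp)

lemma exists_sum_of_mem_logPowers {E : Set ℂ} {P : ℝ → ℂ} (hP : P ∈ LogPowers E) :
    ∃ (s : Finset (ℂ × ℕ)) (a : ℂ × ℕ → ℂ), (∀ p ∈ s, p.1 ∈ E) ∧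
      P = fun R => ∑ p ∈ s, a p * logPower p R := by
  obtain ⟨c, hc, rfl⟩ := (Finsupp.mem_span_image_iff_linearCombination ℂ).1 hP
  refine ⟨c.support, c, fun p hp => hc hp, ?_⟩
  funext R
  simp [Finsupp.linearCombination_apply, Finsupp.sum]

lemma rpow_isBigO_rpow {a b : ℝ} (h : a ≤ b) :
    (fun R : ℝ => R ^ a) =O[atTop] fun R : ℝ => R ^ b := by
  refine IsBigO.of_bound 1 ((eventually_ge_atTop 1).mono fun R hR => ?_)
  rw [one_mul, Real.norm_of_nonneg (by positivity), Real.norm_of_nonneg (by positivity)]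
  exact Real.rpow_le_rpow_of_exponent_le hR h

lemma IsBigO.mul_rpow {F G : ℝ → ℂ} {a b : ℝ} (hF : F =O[atTop] fun R : ℝ => R ^ a)
    (hG : G =O[atTop] fun R : ℝ => R ^ b) :
    (fun R => F R * G R) =O[atTop] fun R : ℝ => R ^ (a + b) := by
  refine (hF.mul hG).congr' EventuallyEq.rfl ((eventually_gt_atTop 0).mono fun R hR => ?_)
  exact (Real.rpow_add hR a b).symm

lemma LogPowers.exists_isBigO {E : Set ℂ} {P : ℝ → ℂ} (hP : P ∈ LogPowers E) :
    ∃ B : ℝ, P =O[atTop] fun R : ℝ => R ^ B := by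
  induction hP using Submodule.span_induction with
  | mem P hP =>
    obtain ⟨p, -, rfl⟩ := hP
    refine ⟨p.1.re + 1, IsBigO.mul_rpow ?_ ?_⟩
    · refine IsBigO.of_bound 1 ((eventually_gt_atTop 0).mono fun R hR => ?_)
      rw [Complex.norm_cpow_eq_rpow_re_of_pos hR, one_mul, Real.norm_of_nonneg (by positivity)]
    · have h1 := (Real.isLittleO_pow_log_id_atTop (n := p.2)).isBigO
      have h2 : (fun R : ℝ => (Real.log R : ℂ) ^ p.2) =O[atTop] fun R : ℝ => Real.log R ^ p.2 :=
        IsBigO.of_bound 1 (Eventually.of_forall fun R => by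
          rw [norm_pow, Complex.norm_real, norm_pow, one_mul])
      refine (h2.trans h1).congr' EventuallyEq.rfl (Eventually.of_forall fun R => ?_)
      simp
  | zero => exact ⟨0, isBigO_zero _ _⟩
  | add P Q _ _ hP hQ =>
    obtain ⟨B, hB⟩ := hP
    obtain ⟨B', hB'⟩ := hQ
    exact ⟨max B B', (hB.trans (rpow_isBigO_rpow (le_max_left _ _))).add
      (hB'.trans (rpow_isBigO_rpow (le_max_right _ _)))⟩
  | smul a P _ hP =>
    obtain ⟨B, hB⟩ := hP
    exact ⟨B, hB.const_smul_left a⟩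

lemma LogPowers.mul {E E' : Set ℂ} {P Q : ℝ → ℂ} (hP : P ∈ LogPowers E) (hQ : Q ∈ LogPowers E') :
    ∃ T ∈ LogPowers (E + E'), ∀ R : ℝ, 0 < R → P R * Q R = T R := by
  induction hP using Submodule.span_induction with
  | mem P hP =>
    obtain ⟨p, hp, rfl⟩ := hP
    induction hQ using Submodule.span_induction with
    | mem Q hQ =>
      obtain ⟨q, hq, rfl⟩ := hQ
      refine ⟨logPower (p + q), logPower_mem (Set.add_mem_add hp hq), fun R hR => ?_⟩
      simp only [logPower, Prod.fst_add, Prod.snd_add]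
      rw [Complex.cpow_add _ _ (by exact_mod_cast hR.ne'), pow_add]
      ring
    | zero => exact ⟨0, zero_mem _, by simp⟩
    | add P Q _ _ hP hQ =>
      obtain ⟨T, hT, h⟩ := hP
      obtain ⟨T', hT', h'⟩ := hQ
      refine ⟨T + T', add_mem hT hT', fun R hR => ?_⟩
      simp only [Pi.add_apply, ← h R hR, ← h' R hR]
      ring
    | smul a P _ hP =>
      obtain ⟨T, hT, h⟩ := hP
      refine ⟨a • T, Submodule.smul_mem _ _ hT, fun R hR => ?_⟩
      simp only [Pi.smul_apply, ← h R hR, smul_eq_mul]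
      ring
  | zero => exact ⟨0, zero_mem _, by simp⟩
  | add P Q _ _ hP hQ =>
    obtain ⟨T, hT, h⟩ := hP
    obtain ⟨T', hT', h'⟩ := hQ
    refine ⟨T + T', add_mem hT hT', fun R hR => ?_⟩
    simp only [Pi.add_apply, ← h R hR, ← h' R hR]
    ring
  | smul a P _ hP =>
    obtain ⟨T, hT, h⟩ := hP
    refine ⟨a • T, Submodule.smul_mem _ _ hT, fun R hR => ?_⟩
    simp only [Pi.smul_apply, ← h R hR, smul_eq_mul]
    ring

lemma LogPowers.continuousOn {E : Set ℂ} {P : ℝ → ℂ} (hP : P ∈ LogPowers E) :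
    ContinuousOn P (Set.Ioi 0) := by
  induction hP using Submodule.span_induction with
  | mem P hP =>
    obtain ⟨p, hp, rfl⟩ := hP
    intro R hR
    have hR' : 0 < R := hR
    refine ContinuousAt.continuousWithinAt (ContinuousAt.mul ?_ ?_)
    · exact Complex.continuousAt_ofReal_cpow_const _ _ (Or.inr hR'.ne')
    · exact (Complex.continuous_ofReal.continuousAt.comp
        (Real.continuousAt_log hR'.ne')).pow _
  | zero => exact continuousOn_const
  | add P Q _ _ hP hQ => exact hP.add hQ
  | smul a P _ hP => exact hP.const_smul a

/-- Integration by parts, by induction on l. Only e = −1 raises the power of the logarithm. -/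
lemma exists_primitive_logPower (e : ℂ) (l : ℕ) :
    ∃ Q ∈ LogPowers {e + 1}, ∀ R : ℝ, 0 < R → HasDerivAt Q (logPower (e, l) R) R := by
  by_cases he : e + 1 = 0
  · refine ⟨((l : ℂ) + 1)⁻¹ • logPower (e + 1, l + 1),
      Submodule.smul_mem _ _ (logPower_mem rfl), fun R hR => ?_⟩
    have h1 : HasDerivAt (fun R : ℝ => (Real.log R : ℂ)) ((R⁻¹ : ℝ) : ℂ) R :=
      (Real.hasDerivAt_log hR.ne').ofReal_comp
    have h2 := (h1.pow (l + 1)).const_mul ((l : ℂ) + 1)⁻¹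
    have h3 : (((l : ℂ) + 1)⁻¹ • logPower (e + 1, l + 1)) =
        fun R : ℝ => ((l : ℂ) + 1)⁻¹ * (Real.log R : ℂ) ^ (l + 1) := by
      funext R
      simp [logPower, he]
    rw [h3]
    refine h2.congr_deriv ?_
    have he' : e = -1 := eq_neg_of_add_eq_zero_left he
    have hl : (l : ℂ) + 1 ≠ 0 := by exact_mod_cast Nat.succ_ne_zero l
    simp only [logPower, he', Complex.cpow_neg_one, Nat.add_sub_cancel]
    push_cast
    field_simp
  · induction l with
    | zero =>
      refine ⟨(e + 1)⁻¹ • logPower (e + 1, 0), Submodule.smul_mem _ _ (logPower_mem rfl),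
        fun R hR => ?_⟩
      have h2 := (hasDerivAt_ofReal_cpow_const hR.ne' he).const_mul (e + 1)⁻¹
      have h3 : ((e + 1)⁻¹ • logPower (e + 1, 0)) = fun R : ℝ => (e + 1)⁻¹ * (R : ℂ) ^ (e + 1) := by
        funext R
        simp [logPower]
      rw [h3]
      refine h2.congr_deriv ?_
      simp [logPower, he]
    | succ l ih =>
      obtain ⟨Q, hQ, hd⟩ := ih
      refine ⟨(e + 1)⁻¹ • logPower (e + 1, l + 1) - ((l + 1) * (e + 1)⁻¹) • Q,
        sub_mem (Submodule.smul_mem _ _ (logPower_mem rfl)) (Submodule.smul_mem _ _ hQ),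
        fun R hR => ?_⟩
      have h1 : HasDerivAt (fun R : ℝ => (Real.log R : ℂ)) ((R⁻¹ : ℝ) : ℂ) R :=
        (Real.hasDerivAt_log hR.ne').ofReal_comp
      have h2 := (hasDerivAt_ofReal_cpow_const hR.ne' he).mul (h1.pow (l + 1))
      have h4 := (h2.const_smul (e + 1)⁻¹).sub ((hd R hR).const_smul (((l : ℂ) + 1) * (e + 1)⁻¹))
      refine h4.congr_deriv ?_
      have hR' : (R : ℂ) ≠ 0 := by exact_mod_cast hR.ne'
      simp only [logPower, add_sub_cancel_right, Nat.add_sub_cancel, smul_eq_mul]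
      rw [Complex.cpow_add _ _ hR', Complex.cpow_one]
      simp only [Pi.pow_apply]
      push_cast
      field_simp
      ring

lemma LogPowers.exists_primitive {E : Set ℂ} {P : ℝ → ℂ} (hP : P ∈ LogPowers E) :
    ∃ Q ∈ LogPowers (E + {1}), ∀ R : ℝ, 0 < R → HasDerivAt Q (P R) R := by
  induction hP using Submodule.span_induction with
  | mem P hP =>
    obtain ⟨⟨e, l⟩, hp, rfl⟩ := hP
    obtain ⟨Q, hQ, h⟩ := exists_primitive_logPower e l
    exact ⟨Q, LogPowers.mono (by
      rintro _ rfl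
      exact Set.add_mem_add hp rfl) hQ, h⟩
  | zero => exact ⟨0, zero_mem _, fun R _ => hasDerivAt_const _ _⟩
  | add P Q _ _ hP hQ =>
    obtain ⟨T, hT, h⟩ := hP
    obtain ⟨T', hT', h'⟩ := hQ
    exact ⟨T + T', add_mem hT hT', fun R hR => (h R hR).add (h' R hR)⟩
  | smul a P _ hP =>
    obtain ⟨T, hT, h⟩ := hP
    exact ⟨a • T, Submodule.smul_mem _ _ hT, fun R hR => (h R hR).const_smul a⟩

namespace HasExpansion

variable {E E' : Set ℂ} {M M' B : ℝ} {F G : ℝ → ℂ}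

lemma mono (h : HasExpansion E M F) (hE : E ⊆ E') (hM : M' ≤ M) : HasExpansion E' M' F := by
  obtain ⟨P, hP, hO⟩ := h
  exact ⟨P, LogPowers.mono hE hP, hO.trans (rpow_isBigO_rpow (neg_le_neg hM))⟩

lemma congr (h : HasExpansion E M F) (hFG : F =ᶠ[atTop] G) : HasExpansion E M G := by
  obtain ⟨P, hP, hO⟩ := h
  exact ⟨P, hP, hO.congr' (hFG.mono fun R hR => by simp only [hR]) EventuallyEq.rfl⟩

lemma of_mem (h : F ∈ LogPowers E) : HasExpansion E M F :=
  ⟨F, h, by simpa using isBigO_zero _ _⟩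

lemma zero : HasExpansion E M (fun _ => 0) := of_mem (zero_mem _)

lemma const (h : (0 : ℂ) ∈ E) (c : ℂ) : HasExpansion E M (fun _ => c) := by
  have h1 : c • logPower (0, 0) ∈ LogPowers E := Submodule.smul_mem _ _ (logPower_mem h)
  have h2 : c • logPower (0, 0) = fun _ => c := by
    funext R
    simp [logPower]
  rw [h2] at h1
  exact of_mem h1

lemma of_isBigO (h : F =O[atTop] fun R : ℝ => R ^ (-M)) : HasExpansion E M F :=
  ⟨0, zero_mem _, by simpa using h⟩

lemma add (hF : HasExpansion E M F) (hG : HasExpansion E M G) :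
    HasExpansion E M (fun R => F R + G R) := by
  obtain ⟨P, hP, hO⟩ := hF
  obtain ⟨Q, hQ, hO'⟩ := hG
  refine ⟨P + Q, add_mem hP hQ, (hO.add hO').congr_left fun R => ?_⟩
  simp only [Pi.add_apply]
  ring

lemma const_mul (hF : HasExpansion E M F) (c : ℂ) : HasExpansion E M (fun R => c * F R) := by
  obtain ⟨P, hP, hO⟩ := hF
  refine ⟨c • P, Submodule.smul_mem _ _ hP, (hO.const_mul_left c).congr_left fun R => ?_⟩
  simp only [Pi.smul_apply, smul_eq_mul]
  ring

lemma sub (hF : HasExpansion E M F) (hG : HasExpansion E M G) :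
    HasExpansion E M (fun R => F R - G R) :=
  (hF.add (hG.const_mul (-1))).congr (Eventually.of_forall fun R => by simp [sub_eq_add_neg])

lemma sum {ι : Type*} {s : Finset ι} {F : ι → ℝ → ℂ} (h : ∀ i ∈ s, HasExpansion E M (F i)) :
    HasExpansion E M (fun R => ∑ i ∈ s, F i R) := by
  classical
  induction s using Finset.induction_on with
  | empty => simpa using zero
  | insert i s hi ih =>
    simp only [Finset.sum_insert hi]
    exact (h i (Finset.mem_insert_self _ _)).add
      (ih fun j hj => h j (Finset.mem_insert_of_mem hj))

lemma exists_isBigO (hF : HasExpansion E M F) : ∃ B : ℝ, F =O[atTop] fun R : ℝ => R ^ B := by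
  obtain ⟨P, hP, hO⟩ := hF
  obtain ⟨B, hB⟩ := LogPowers.exists_isBigO hP
  refine ⟨max (-M) B, ((hO.trans (rpow_isBigO_rpow (le_max_left _ _))).add
    (hB.trans (rpow_isBigO_rpow (le_max_right _ _)))).congr_left fun R => ?_⟩
  ring

lemma mul_of_isBigO (hF : HasExpansion E M F) (hG : ∀ M, HasExpansion E' M G)
    (hB : G =O[atTop] fun R : ℝ => R ^ B) :
    HasExpansion (E + E') (M - B) (fun R => F R * G R) := by
  obtain ⟨P, hP, hO⟩ := hF
  obtain ⟨A, hA⟩ := LogPowers.exists_isBigO hP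
  -- In FG − PQ = (F − P)G + P(G − Q) the factor P may grow like R^A; the extra precision A
  -- compensates for it.
  obtain ⟨Q, hQ, hO'⟩ := hG (M - B + A)
  obtain ⟨T, hT, hPQ⟩ := LogPowers.mul hP hQ
  refine ⟨T, hT, ?_⟩
  have h1 := IsBigO.mul_rpow hO hB
  have h2 := IsBigO.mul_rpow hA hO'
  rw [show -M + B = -(M - B) by ring] at h1
  rw [show A + -(M - B + A) = -(M - B) by ring] at h2
  refine (h1.add h2).congr' ((eventually_gt_atTop 0).mono fun R hR => ?_) EventuallyEq.rfl
  simp only [← hPQ R hR]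
  ring

lemma mul (hF : ∀ M, HasExpansion E M F) (hG : ∀ M, HasExpansion E' M G) (M : ℝ) :
    HasExpansion (E + E') M (fun R => F R * G R) := by
  obtain ⟨B, hB⟩ := (hG 0).exists_isBigO
  simpa using (hF (M + B)).mul_of_isBigO hG hB

end HasExpansion

lemma integrableOn_Ioi_of_le_rpow {ρ : ℝ → ℂ} {T C M : ℝ} (hT : 0 < T) (hM : 1 < M)
    (hc : ContinuousOn ρ (Set.Ioi T)) (hb : ∀ t, T < t → ‖ρ t‖ ≤ C * t ^ (-M)) :
    IntegrableOn ρ (Set.Ioi T) := by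
  refine Integrable.mono' ((integrableOn_Ioi_rpow_of_lt (a := -M) (by linarith) hT).const_mul C)
    (hc.aestronglyMeasurable measurableSet_Ioi) ?_
  exact (ae_restrict_iff' measurableSet_Ioi).2 (Eventually.of_forall fun t ht => hb t ht)

lemma norm_integral_Ioi_le {ρ : ℝ → ℂ} {T C M : ℝ} (hT : 0 < T) (hM : 1 < M)
    (hb : ∀ t, T < t → ‖ρ t‖ ≤ C * t ^ (-M)) :
    ‖∫ t in Set.Ioi T, ρ t‖ ≤ C / (M - 1) * T ^ (-(M - 1)) := by
  have h1 := norm_integral_le_of_norm_le (μ := volume.restrict (Set.Ioi T))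
    ((integrableOn_Ioi_rpow_of_lt (a := -M) (by linarith) hT).const_mul C)
    ((ae_restrict_iff' measurableSet_Ioi).2 (Eventually.of_forall fun t ht => hb t ht))
  refine h1.trans_eq ?_
  rw [integral_const_mul, integral_Ioi_rpow_of_lt (by linarith) hT,
    show -M + 1 = -(M - 1) by ring]
  have : M - 1 ≠ 0 := by linarith
  field_simp

/-- As M > 1, the remainder F − P is integrable at infinity. Its total integral goes into the
constant, and its tail beyond R is O(R^(1−M)). -/
lemma HasExpansion.exists_integral {E : Set ℂ} {M : ℝ} {F : ℝ → ℂ} (hF : HasExpansion E M F)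
    (hc : Continuous F) (hM : 1 < M) (r : ℝ) :
    ∃ c : ℂ, HasExpansion (E + {1}) (M - 1) (fun R => (∫ t in r..R, F t) - c) := by
  obtain ⟨P, hP, hO⟩ := hF
  obtain ⟨Q, hQ, hd⟩ := LogPowers.exists_primitive hP
  obtain ⟨C, hC⟩ := hO.bound
  obtain ⟨T, hT1, hT⟩ : ∃ T : ℝ, 1 ≤ T ∧ ∀ t, T ≤ t → ‖F t - P t‖ ≤ C * t ^ (-M) := by
    obtain ⟨T, hT⟩ := eventually_atTop.1 hC
    refine ⟨max T 1, le_max_right _ _, fun t ht => (hT t ((le_max_left _ _).trans ht)).trans_eq ?_⟩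
    rw [Real.norm_of_nonneg]
    have : 0 ≤ t := by linarith [le_max_right T 1]
    positivity
  have hT0 : 0 < T := by linarith
  have hPc := LogPowers.continuousOn hP
  have hint : IntegrableOn (fun t => F t - P t) (Set.Ioi T) :=
    integrableOn_Ioi_of_le_rpow hT0 hM
      (hc.continuousOn.sub (hPc.mono (Set.Ioi_subset_Ioi hT0.le))) fun t ht => hT t ht.le
  refine ⟨(∫ t in r..T, F t) - Q T + ∫ t in Set.Ioi T, (F t - P t), Q, hQ, ?_⟩
  refine IsBigO.of_bound (C / (M - 1)) ((eventually_ge_atTop T).mono fun R hR => ?_)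
  have hR0 : 0 < R := hT0.trans_le hR
  have h1 := norm_integral_Ioi_le hR0 hM fun t ht => hT t (hR.trans ht.le)
  rw [Real.norm_of_nonneg (by positivity)]
  refine le_trans (le_of_eq ?_) h1
  have hPint : IntervalIntegrable P volume T R :=
    (hPc.mono fun t ht => by
      rw [Set.uIcc_of_le hR] at ht
      exact hT0.trans_le ht.1).intervalIntegrable
  have h2 : ∫ t in T..R, P t = Q R - Q T :=
    intervalIntegral.integral_eq_sub_of_hasDerivAt (fun t ht => hd t (by
      rw [Set.uIcc_of_le hR] at ht
      exact hT0.trans_le ht.1)) hPint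
  have h3 : ∫ t in T..R, (F t - P t) = (∫ t in T..R, F t) - ∫ t in T..R, P t :=
    intervalIntegral.integral_sub (hc.intervalIntegrable _ _) hPint
  have h4 := intervalIntegral.integral_Ioi_sub_Ioi hint hR
  have h5 := intervalIntegral.integral_add_adjacent_intervals
    (hc.intervalIntegrable (μ := volume) r T) (hc.intervalIntegrable T R)
  rw [← norm_neg]
  congr 1
  rw [h3, h2] at h4
  beta_reduce
  rw [← h5]
  linear_combination h4

lemma HasExpansion.hasFinitePart {E : Set ℂ} {M : ℝ} {F : ℝ → ℂ} {c : ℂ} (hE : (0 : ℂ) ∉ E)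
    (hM : 0 < M) (h : HasExpansion E M (fun R => F R - c)) : HasFinitePart F c := by
  obtain ⟨P, hP, hO⟩ := h
  obtain ⟨s, a, hs, rfl⟩ := exists_sum_of_mem_logPowers hP
  refine ⟨s, a, fun h0 => hE (hs _ h0), ?_⟩
  have h1 := (hO.trans_tendsto (tendsto_rpow_neg_atTop hM)).add_const c
  rw [zero_add] at h1
  refine h1.congr fun R => ?_
  simp only [logPower, mul_assoc]
  ring

lemma HasExpansion.exists_hasFinitePart {E : Set ℂ} {M : ℝ} {F : ℝ → ℂ}
    (hM : 0 < M) (h : HasExpansion E M F) : ∃ c, HasFinitePart F c := by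
  classical
  obtain ⟨P, hP, hO⟩ := h
  obtain ⟨s, a, hs, rfl⟩ := exists_sum_of_mem_logPowers hP
  refine ⟨if (0, 0) ∈ s then a (0, 0) else 0, s.erase (0, 0), a, Finset.notMem_erase _ _, ?_⟩
  have h1 := (hO.trans_tendsto (tendsto_rpow_neg_atTop hM)).add_const
    (if (0, 0) ∈ s then a (0, 0) else 0)
  rw [zero_add] at h1
  refine h1.congr fun R => ?_
  beta_reduce
  split_ifs with h0
  · rw [← Finset.add_sum_erase _ _ h0]
    simp only [logPower, mul_assoc, Complex.cpow_zero, pow_zero]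
    ring
  · rw [Finset.erase_eq_of_notMem h0]
    simp only [logPower, mul_assoc]
    ring

/-! ### Iterated integrals -/

/-- The iterated integral `∫_{r ≤ t_k ≤ ⋯ ≤ t_1 ≤ R} a_1(t_1) ⋯ a_k(t_k)`. -/
def iterInt (r : ℝ) : List (ℝ → ℂ) → ℝ → ℂ
  | [] => fun _ => 1
  | a :: l => fun R => ∫ t in r..R, a t * iterInt r l t

lemma continuous_iterInt {r : ℝ} {l : List (ℝ → ℂ)} (h : ∀ a ∈ l, Continuous a) :
    Continuous (iterInt r l) := by
  induction l with
  | nil => exact continuous_const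
  | cons a l ih =>
    simp only [List.mem_cons, forall_eq_or_imp] at h
    exact intervalIntegral.continuous_primitive
      (fun _ _ => (h.1.mul (ih h.2)).intervalIntegrable _ _) r

lemma hasDerivAt_iterInt {r : ℝ} {a : ℝ → ℂ} {l : List (ℝ → ℂ)} (h : ∀ b ∈ a :: l, Continuous b)
    (R : ℝ) : HasDerivAt (iterInt r (a :: l)) (a R * iterInt r l R) R := by
  simp only [List.mem_cons, forall_eq_or_imp] at h
  have hc := h.1.mul (continuous_iterInt (r := r) h.2)
  exact intervalIntegral.integral_hasDerivAt_right (hc.intervalIntegrable _ _)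
    (hc.stronglyMeasurableAtFilter _ _) hc.continuousAt

lemma iterInt_cons_self (r : ℝ) (a : ℝ → ℂ) (l : List (ℝ → ℂ)) : iterInt r (a :: l) r = 0 :=
  intervalIntegral.integral_same

/-- The shuffles of two words. -/
def shuffles {α : Type*} : List α → List α → List (List α)
  | [], v => [v]
  | a :: u, [] => [a :: u]
  | a :: u, b :: v => (shuffles u (b :: v)).map (a :: ·) ++ (shuffles (a :: u) v).map (b :: ·)
termination_by u v => u.length + v.length

lemma shuffles_nil_left {α : Type*} (v : List α) : shuffles [] v = [v] := by
  rw [shuffles]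

lemma shuffles_nil_right {α : Type*} (u : List α) : shuffles u [] = [u] := by
  cases u <;> rw [shuffles]

lemma shuffles_cons_cons {α : Type*} (a b : α) (u v : List α) :
    shuffles (a :: u) (b :: v) =
      (shuffles u (b :: v)).map (a :: ·) ++ (shuffles (a :: u) v).map (b :: ·) := by
  rw [shuffles]

lemma shuffles_induction {α : Type*} {motive : List α → List α → Prop}
    (nil_left : ∀ v, motive [] v) (nil_right : ∀ u, motive u [])
    (cons_cons : ∀ a u b v, motive u (b :: v) → motive (a :: u) v → motive (a :: u) (b :: v))
    (u v : List α) : motive u v := by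
  induction u generalizing v with
  | nil => exact nil_left v
  | cons a u ihu =>
    induction v with
    | nil => exact nil_right _
    | cons b v ihv => exact cons_cons a u b v (ihu _) ihv

lemma shuffles_map {α β : Type*} (f : α → β) (u v : List α) :
    shuffles (u.map f) (v.map f) = (shuffles u v).map (List.map f) := by
  induction u, v using shuffles_induction with
  | nil_left v => simp [shuffles_nil_left]
  | nil_right u => simp [shuffles_nil_right]
  | cons_cons a u b v h1 h2 =>
    simp only [List.map_cons] at h1 h2 ⊢
    simp [shuffles_cons_cons, h1, h2, Function.comp_def]

lemma perm_of_mem_shuffles {α : Type*} {u v w : List α} (h : w ∈ shuffles u v) :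
    w.Perm (u ++ v) := by
  induction u, v using shuffles_induction generalizing w with
  | nil_left v =>
    rw [shuffles_nil_left, List.mem_singleton] at h
    simp [h]
  | nil_right u =>
    rw [shuffles_nil_right, List.mem_singleton] at h
    simp [h]
  | cons_cons a u b v h1 h2 =>
    rw [shuffles_cons_cons, List.mem_append, List.mem_map, List.mem_map] at h
    rcases h with ⟨w, hw, rfl⟩ | ⟨w, hw, rfl⟩
    · exact (h1 hw).cons a
    · exact ((h2 hw).cons b).trans List.perm_middle.symm

lemma continuous_sum_iterInt {r : ℝ} {L : List (List (ℝ → ℂ))}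
    (h : ∀ l ∈ L, ∀ b ∈ l, Continuous b) :
    Continuous (fun t => (L.map fun l => iterInt r l t).sum) := by
  induction L with
  | nil => simpa using continuous_const
  | cons l L ih =>
    simp only [List.mem_cons, forall_eq_or_imp] at h
    simp only [List.map_cons, List.sum_cons]
    exact (continuous_iterInt h.1).add (ih h.2)

lemma sum_iterInt_cons {r R : ℝ} {a : ℝ → ℂ} {L : List (List (ℝ → ℂ))} (ha : Continuous a)
    (h : ∀ l ∈ L, ∀ b ∈ l, Continuous b) :
    ((L.map (a :: ·)).map fun l => iterInt r l R).sum =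
      ∫ t in r..R, a t * (L.map fun l => iterInt r l t).sum := by
  induction L with
  | nil => simp
  | cons l L ih =>
    simp only [List.mem_cons, forall_eq_or_imp] at h
    simp only [List.map_cons, List.sum_cons, ih h.2, mul_add]
    rw [intervalIntegral.integral_add]
    · rfl
    · exact (ha.mul (continuous_iterInt h.1)).intervalIntegrable _ _
    · exact (ha.mul (continuous_sum_iterInt h.2)).intervalIntegrable _ _

/-- The product rule differentiates the outermost letter of one word or of the other, which is
exactly the recursion defining shuffles. When both words are nonempty, both sides vanish at r. -/
lemma sum_iterInt_shuffles {r : ℝ} {u v : List (ℝ → ℂ)} (hu : ∀ a ∈ u, Continuous a)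
    (hv : ∀ a ∈ v, Continuous a) (R : ℝ) :
    ((shuffles u v).map fun l => iterInt r l R).sum = iterInt r u R * iterInt r v R := by
  induction u, v using shuffles_induction generalizing R with
  | nil_left v => simp [shuffles_nil_left, iterInt]
  | nil_right u => simp [shuffles_nil_right, iterInt]
  | cons_cons a u b v h1 h2 =>
    have hu' := hu
    have hv' := hv
    simp only [List.mem_cons, forall_eq_or_imp] at hu' hv'
    have hcont : ∀ l ∈ shuffles u (b :: v), ∀ c ∈ l, Continuous c := fun l hl c hc => by
      rcases List.mem_append.1 ((perm_of_mem_shuffles hl).mem_iff.1 hc) with h | h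
      · exact hu'.2 c h
      · exact hv c h
    have hcont' : ∀ l ∈ shuffles (a :: u) v, ∀ c ∈ l, Continuous c := fun l hl c hc => by
      rcases List.mem_append.1 ((perm_of_mem_shuffles hl).mem_iff.1 hc) with h | h
      · exact hu c h
      · exact hv'.2 c h
    rw [shuffles_cons_cons, List.map_append, List.sum_append, sum_iterInt_cons hu'.1 hcont,
      sum_iterInt_cons hv'.1 hcont']
    simp only [h1 hu'.2 hv, h2 hu hv'.2]
    have c1 := continuous_iterInt (r := r) hu
    have c2 := continuous_iterInt (r := r) hv
    have c3 := continuous_iterInt (r := r) hu'.2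
    have c4 := continuous_iterInt (r := r) hv'.2
    have i1 : Continuous fun t => a t * (iterInt r u t * iterInt r (b :: v) t) :=
      hu'.1.mul (c3.mul c2)
    have i2 : Continuous fun t => b t * (iterInt r (a :: u) t * iterInt r v t) :=
      hv'.1.mul (c1.mul c4)
    rw [← intervalIntegral.integral_add (i1.intervalIntegrable _ _) (i2.intervalIntegrable _ _)]
    have i3 : Continuous fun t => a t * (iterInt r u t * iterInt r (b :: v) t) +
        b t * (iterInt r (a :: u) t * iterInt r v t) := i1.add i2
    have key := intervalIntegral.integral_eq_sub_of_hasDerivAt (a := r) (b := R)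
      (f := fun t => iterInt r (a :: u) t * iterInt r (b :: v) t)
      (f' := fun t => a t * (iterInt r u t * iterInt r (b :: v) t) +
        b t * (iterInt r (a :: u) t * iterInt r v t))
      (fun t _ => ((hasDerivAt_iterInt hu t).mul (hasDerivAt_iterInt hv t)).congr_deriv (by ring))
      (i3.intervalIntegrable _ _)
    rw [key]
    simp [iterInt_cons_self]

/-- Sums of the exponents (shifted by one) over the nonempty prefixes of a word. -/
def leftSums : List (Set ℂ) → Set ℂ
  | [] => ∅
  | E :: l => (E + {1}) + ({0} ∪ leftSums l)

/-- The constant of integration of the inner integral accounts for the {0} in `leftSums`; the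
outermost constant is split off as c. It may depend on M when 0 is itself among the exponents. -/
lemma exists_hasExpansion_iterInt {X : Type*} {a : X → ℝ → ℂ} {E : X → Set ℂ} {l : List X}
    (hc : ∀ x ∈ l, Continuous (a x)) (hE : ∀ x ∈ l, ∀ M, HasExpansion (E x) M (a x)) (r M : ℝ) :
    ∃ c, HasExpansion (leftSums (l.map E)) M (fun R => iterInt r (l.map a) R - c) := by
  induction l generalizing M with
  | nil =>
    refine ⟨1, HasExpansion.zero.congr (Eventually.of_forall fun R => ?_)⟩
    simp [iterInt]
  | cons x l ih =>
    simp only [List.mem_cons, forall_eq_or_imp] at hc hE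
    have h1 : ∀ M, HasExpansion ({0} ∪ leftSums (l.map E)) M (iterInt r (l.map a)) := fun M => by
      obtain ⟨c, h⟩ := ih hc.2 hE.2 M
      refine ((h.mono Set.subset_union_right le_rfl).add
        (HasExpansion.const (Set.mem_union_left _ (Set.mem_singleton _)) c)).congr (Eventually.of_forall fun R => ?_)
      ring
    -- Integration costs one power of R, and the remainder must decay faster than 1/R.
    have h2 := HasExpansion.mul hE.1 h1 (max (M + 1) 2)
    have h3 : Continuous (iterInt r (l.map a)) := continuous_iterInt (by
      simpa using hc.2)
    obtain ⟨c, h⟩ := h2.exists_integral (hc.1.mul h3)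
      (lt_of_lt_of_le (by norm_num) (le_max_right _ _)) r
    refine ⟨c, h.mono ?_ ?_⟩
    · rw [List.map_cons, leftSums, add_right_comm]
    · linarith [le_max_left (M + 1) 2]

lemma hasExpansion_iterInt {X : Type*} {a : X → ℝ → ℂ} {E : X → Set ℂ} {l : List X}
    (hc : ∀ x ∈ l, Continuous (a x)) (hE : ∀ x ∈ l, ∀ M, HasExpansion (E x) M (a x)) (r M : ℝ) :
    HasExpansion ({0} ∪ leftSums (l.map E)) M (iterInt r (l.map a)) := by
  obtain ⟨c, h⟩ := exists_hasExpansion_iterInt hc hE r M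
  refine ((h.mono Set.subset_union_right le_rfl).add
    (HasExpansion.const (Set.mem_union_left _ (Set.mem_singleton _)) c)).congr (Eventually.of_forall fun R => ?_)
  ring

/-- When 0 is not an exponent the constant is the finite part, hence the same for all M. -/
lemma HasExpansion.exists_forall {E : Set ℂ} (hE : (0 : ℂ) ∉ E) {F : ℝ → ℂ}
    (h : ∀ M, ∃ c, HasExpansion E M (fun R => F R - c)) :
    ∃ c, ∀ M, HasExpansion E M (fun R => F R - c) := by
  obtain ⟨c, hc⟩ := h 1
  refine ⟨c, fun M => ?_⟩
  obtain ⟨c', hc'⟩ := h (max M 1)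
  have : c = c' := (hc.hasFinitePart hE one_pos).unique
    (hc'.hasFinitePart hE (lt_of_lt_of_le one_pos (le_max_right _ _)))
  rw [this]
  exact hc'.mono subset_rfl (le_max_left _ _)

/-- Writing F = c + f and G = c' + g gives FG − cc' = fg + c'f + cg, with exponents in E + E', E and
E'. The condition on E + E' rules out recombinations such as R · R⁻¹. -/
lemma HasFinitePart.mul_of_hasExpansion {E E' : Set ℂ} (hE : (0 : ℂ) ∉ E) (hE' : (0 : ℂ) ∉ E')
    (hEE' : (0 : ℂ) ∉ E + E') {F G : ℝ → ℂ}
    (hF : ∀ M, ∃ c, HasExpansion E M (fun R => F R - c))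
    (hG : ∀ M, ∃ c, HasExpansion E' M (fun R => G R - c)) :
    HasFinitePart (fun R => F R * G R) (finitePart F * finitePart G) := by
  obtain ⟨c, hc⟩ := HasExpansion.exists_forall hE hF
  obtain ⟨c', hc'⟩ := HasExpansion.exists_forall hE' hG
  rw [((hc 1).hasFinitePart hE one_pos).finitePart_eq,
    ((hc' 1).hasFinitePart hE' one_pos).finitePart_eq]
  have h0 : (0 : ℂ) ∉ (E ∪ E') ∪ (E + E') := by
    simp only [Set.mem_union, not_or]
    exact ⟨⟨hE, hE'⟩, hEE'⟩
  refine HasExpansion.hasFinitePart h0 one_pos (M := 1) ?_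
  have h1 := (HasExpansion.mul hc hc' 1).mono
    (Set.subset_union_right (s := E ∪ E')) le_rfl
  have h2 := ((hc 1).const_mul c').mono
    ((Set.subset_union_left (t := E')).trans (Set.subset_union_left (t := E + E'))) le_rfl
  have h3 := ((hc' 1).const_mul c).mono
    ((Set.subset_union_right (s := E)).trans (Set.subset_union_left (t := E + E'))) le_rfl
  refine ((h1.add h2).add h3).congr (Eventually.of_forall fun R => ?_)
  ring

/-! ### Holomorphic families of functions with expansions at infinity -/

/-- Dominating F itself is enough: the Cauchy estimate on discs of radius δ/2 bounds the
z-derivative by g/(δ/2). -/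
lemma differentiableOn_integral_of_dominated {Ω : Type*} [MeasurableSpace Ω] {μ : Measure Ω}
    {V : Set ℂ} (hV : IsOpen V) {F : ℂ → Ω → ℂ} {g : Ω → ℝ}
    (hm : ∀ z ∈ V, AEStronglyMeasurable (F z) μ)
    (hd : ∀ᵐ x ∂μ, DifferentiableOn ℂ (fun z => F z x) V)
    (hb : ∀ᵐ x ∂μ, ∀ z ∈ V, ‖F z x‖ ≤ g x) (hg : Integrable g μ) :
    DifferentiableOn ℂ (fun z => ∫ x, F z x ∂μ) V := by
  intro z₀ hz₀
  obtain ⟨δ, hδ, hball⟩ := Metric.isOpen_iff.1 hV z₀ hz₀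
  have hsub : ∀ z ∈ Metric.ball z₀ (δ / 2), Metric.closedBall z (δ / 2) ⊆ V := by
    intro z hz w hw
    refine hball ?_
    rw [Metric.mem_ball] at hz ⊢
    rw [Metric.mem_closedBall] at hw
    linarith [dist_triangle w z z₀]
  have hint : ∀ z ∈ V, Integrable (F z) μ := fun z hz =>
    hg.mono' (hm z hz) (hb.mono fun x h => h z hz)
  refine (hasDerivAt_integral_of_dominated_loc_of_deriv_le
    (F' := fun z x => deriv (fun w => F w x) z) (bound := fun x => g x / (δ / 2))
    (Metric.ball_mem_nhds z₀ (half_pos hδ)) ?_ (hint z₀ hz₀) ?_ ?_ (hg.div_const _) ?_).2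
      |>.differentiableAt.differentiableWithinAt
  · exact (hV.eventually_mem hz₀).mono fun z hz => hm z hz
  -- The derivative at z₀ is measurable in x as a limit of difference quotients; the increments
  -- δ/(n+2) stay inside the disc.
  · have hu : Tendsto (fun n : ℕ => ((δ / (n + 2) : ℝ) : ℂ)) atTop (𝓝[≠] 0) := by
      refine tendsto_nhdsWithin_iff.2 ⟨?_, Eventually.of_forall fun n => ?_⟩
      · rw [← Complex.ofReal_zero]
        refine (Complex.continuous_ofReal.tendsto 0).comp ?_
        exact Tendsto.div_atTop tendsto_const_nhds
          (tendsto_atTop_add_const_right _ _ tendsto_natCast_atTop_atTop)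
      · have : δ / ((n : ℝ) + 2) ≠ 0 := by positivity
        exact Complex.ofReal_ne_zero.2 this
    have hmem : ∀ n : ℕ, z₀ + ((δ / (n + 2) : ℝ) : ℂ) ∈ V := fun n => by
      refine hball ?_
      rw [Metric.mem_ball, dist_eq_norm, add_sub_cancel_left, Complex.norm_real,
        Real.norm_of_nonneg (by positivity), div_lt_iff₀ (by positivity)]
      nlinarith [(Nat.cast_nonneg n : (0 : ℝ) ≤ n)]
    refine aestronglyMeasurable_of_tendsto_ae atTop
      (f := fun (n : ℕ) x => (((δ / (n + 2) : ℝ) : ℂ))⁻¹ •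
        (F (z₀ + ((δ / (n + 2) : ℝ) : ℂ)) x - F z₀ x)) (fun n => ?_) ?_
    · exact ((hm _ (hmem n)).sub (hm _ hz₀)).const_smul (((δ / (n + 2) : ℝ) : ℂ))⁻¹
    · refine hd.mono fun x h => ?_
      exact ((h.differentiableAt (hV.mem_nhds hz₀)).hasDerivAt.tendsto_slope_zero).comp hu
  · filter_upwards [hd, hb] with x h1 h2 z hz
    exact Complex.norm_deriv_le_of_forall_mem_sphere_norm_le (half_pos hδ)
      (h1.diffContOnCl_ball (hsub z hz))
      fun w hw => h2 w (hsub z hz (Metric.sphere_subset_closedBall hw))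
  · filter_upwards [hd] with x h1 z hz
    exact (h1.differentiableAt (hV.mem_nhds
      (hsub z hz (Metric.mem_closedBall_self (half_pos hδ).le)))).hasDerivAt

/-- Functions `F(z)` of `t ∈ ℝ`, holomorphic in `z ∈ V`, which are combinations of powers
`t ^ e(z)` with holomorphic `e` and holomorphic coefficients up to `O(t^{-M})`, with `e(z) ∈ E(z)`
and `Re e ≤ B`. -/
structure IsRadialFamily (V : Set ℂ) (E : ℂ → Set ℂ) (B M : ℝ) (F : ℂ → ℝ → ℂ) : Prop where
  continuous : ∀ z ∈ V, Continuous (F z)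
  differentiableOn : ∀ t, DifferentiableOn ℂ (fun z => F z t) V
  bounded : ∀ T : ℝ, ∃ C : ℝ, ∀ z ∈ V, ∀ t, |t| ≤ T → ‖F z t‖ ≤ C
  expansion : ∃ (ι : Type) (_ : Fintype ι) (e A : ι → ℂ → ℂ) (C T : ℝ), 0 ≤ C ∧ 1 ≤ T ∧
    (∀ i, DifferentiableOn ℂ (e i) V ∧ DifferentiableOn ℂ (A i) V) ∧
    (∀ z ∈ V, ∀ i, e i z ∈ E z ∧ (e i z).re ≤ B ∧ ‖e i z‖ ≤ C ∧ ‖A i z‖ ≤ C) ∧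
    ∀ z ∈ V, ∀ t, T ≤ t → ‖F z t - ∑ i, A i z * (t : ℂ) ^ e i z‖ ≤ C * t ^ (-M)

lemma norm_mul_cpow_le {a e : ℂ} {C B t : ℝ} (ha : ‖a‖ ≤ C) (he : e.re ≤ B) (ht : 1 ≤ t) :
    ‖a * (t : ℂ) ^ e‖ ≤ C * t ^ B := by
  rw [norm_mul, Complex.norm_cpow_eq_rpow_re_of_pos (by linarith)]
  exact mul_le_mul ha (Real.rpow_le_rpow_of_exponent_le ht he) (by positivity)
    ((norm_nonneg _).trans ha)

lemma norm_sum_mul_cpow_le {ι : Type*} [Fintype ι] {a e : ι → ℂ} {C B t : ℝ}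
    (ha : ∀ i, ‖a i‖ ≤ C) (he : ∀ i, (e i).re ≤ B) (ht : 1 ≤ t) :
    ‖∑ i, a i * (t : ℂ) ^ e i‖ ≤ Fintype.card ι * C * t ^ B := by
  refine (norm_sum_le_of_le _ fun i _ => norm_mul_cpow_le (ha i) (he i) ht).trans_eq ?_
  simp [mul_assoc]

namespace IsRadialFamily

variable {V V' : Set ℂ} {E E' : ℂ → Set ℂ} {B B' M M' : ℝ} {F G : ℂ → ℝ → ℂ}

lemma mono (h : IsRadialFamily V E B M F) (hV : V' ⊆ V) (hE : ∀ z ∈ V', E z ⊆ E' z) (hB : B ≤ B')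
    (hM : M' ≤ M) : IsRadialFamily V' E' B' M' F where
  continuous z hz := h.continuous z (hV hz)
  differentiableOn t := (h.differentiableOn t).mono hV
  bounded T := by
    obtain ⟨C, hC⟩ := h.bounded T
    exact ⟨C, fun z hz => hC z (hV hz)⟩
  expansion := by
    obtain ⟨ι, _, e, A, C, T, hC, hT, h1, h2, h3⟩ := h.expansion
    refine ⟨ι, inferInstance, e, A, C, T, hC, hT, fun i => ⟨(h1 i).1.mono hV, (h1 i).2.mono hV⟩,
      fun z hz i => ⟨hE z hz (h2 z (hV hz) i).1, (h2 z (hV hz) i).2.1.trans hB,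
        (h2 z (hV hz) i).2.2⟩,
      fun z hz t ht => (h3 z (hV hz) t ht).trans ?_⟩
    exact mul_le_mul_of_nonneg_left
      (Real.rpow_le_rpow_of_exponent_le (hT.trans ht) (neg_le_neg hM)) hC

lemma one (h : ∀ z ∈ V, (0 : ℂ) ∈ E z) (hB : 0 ≤ B) : IsRadialFamily V E B M (fun _ _ => 1) where
  continuous z hz := continuous_const
  differentiableOn t := differentiableOn_const _
  bounded T := ⟨1, fun z _ t _ => by simp⟩
  expansion := ⟨Unit, inferInstance, fun _ _ => 0, fun _ _ => 1, 1, 1, zero_le_one, le_rfl,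
    fun i => ⟨differentiableOn_const _, differentiableOn_const _⟩,
    fun z hz i => ⟨h z hz, by simpa using hB, by simp, by simp⟩, fun z _ t ht => by
      have : 0 ≤ t := by linarith
      simp only [Finset.univ_unique, Complex.cpow_zero, mul_one, Finset.sum_singleton, sub_self,
        norm_zero, one_mul]
      positivity⟩

lemma zero : IsRadialFamily V E B M (fun _ _ => 0) where
  continuous z hz := continuous_const
  differentiableOn t := differentiableOn_const _
  bounded T := ⟨0, fun z _ t _ => by simp⟩
  expansion := ⟨Empty, inferInstance, fun _ _ => 0, fun _ _ => 1, 1, 1, zero_le_one, le_rfl,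
    fun i => ⟨differentiableOn_const _, differentiableOn_const _⟩,
    fun z hz i => i.elim, fun z _ t ht => by
      have : 0 ≤ t := by linarith
      simp only [Finset.univ_eq_empty, Finset.sum_empty, sub_self, norm_zero, one_mul]
      positivity⟩

lemma congr (h : IsRadialFamily V E B M F) (hFG : ∀ z ∈ V, F z = G z) :
    IsRadialFamily V E B M G where
  continuous z hz := hFG z hz ▸ h.continuous z hz
  differentiableOn t := (h.differentiableOn t).congr fun z hz => by rw [hFG z hz]
  bounded T := by
    obtain ⟨C, hC⟩ := h.bounded T
    exact ⟨C, fun z hz => hFG z hz ▸ hC z hz⟩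
  expansion := by
    obtain ⟨ι, _, e, A, C, T, hC, hT, h1, h2, h3⟩ := h.expansion
    exact ⟨ι, inferInstance, e, A, C, T, hC, hT, h1, h2, fun z hz => hFG z hz ▸ h3 z hz⟩

lemma add (hF : IsRadialFamily V E B M F) (hG : IsRadialFamily V E B M G) :
    IsRadialFamily V E B M (fun z t => F z t + G z t) where
  continuous z hz := (hF.continuous z hz).add (hG.continuous z hz)
  differentiableOn t := (hF.differentiableOn t).add (hG.differentiableOn t)
  bounded T := by
    obtain ⟨C, hC⟩ := hF.bounded T
    obtain ⟨C', hC'⟩ := hG.bounded T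
    exact ⟨C + C', fun z hz t ht => (norm_add_le _ _).trans
      (add_le_add (hC z hz t ht) (hC' z hz t ht))⟩
  expansion := by
    obtain ⟨ι, _, e, A, C, T, hC, hT, h1, h2, h3⟩ := hF.expansion
    obtain ⟨ι', _, e', A', C', T', hC', hT', h1', h2', h3'⟩ := hG.expansion
    refine ⟨ι ⊕ ι', inferInstance, Sum.elim e e', Sum.elim A A', C + C', max T T',
      add_nonneg hC hC', hT.trans (le_max_left _ _), ?_, ?_, ?_⟩
    · rintro (i | i)
      · exact h1 i
      · exact h1' i
    · rintro z hz (i | i)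
      · obtain ⟨a1, a2, a3, a4⟩ := h2 z hz i
        exact ⟨a1, a2, by simp only [Sum.elim_inl]; linarith, by simp only [Sum.elim_inl]; linarith⟩
      · obtain ⟨a1, a2, a3, a4⟩ := h2' z hz i
        exact ⟨a1, a2, by simp only [Sum.elim_inr]; linarith, by simp only [Sum.elim_inr]; linarith⟩
    · intro z hz t ht
      rw [Fintype.sum_sum_type, add_mul]
      refine le_trans (le_of_eq ?_) ((norm_add_le _ _).trans (add_le_add
        (h3 z hz t ((le_max_left _ _).trans ht)) (h3' z hz t ((le_max_right _ _).trans ht))))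
      simp only [Sum.elim_inl, Sum.elim_inr]
      congr 1
      ring

lemma sum {κ : Type*} {s : Finset κ} {F : κ → ℂ → ℝ → ℂ}
    (h : ∀ i ∈ s, IsRadialFamily V E B M (F i)) :
    IsRadialFamily V E B M (fun z t => ∑ i ∈ s, F i z t) := by
  classical
  induction s using Finset.induction_on with
  | empty => simpa using zero
  | insert i s hi ih =>
    simp only [Finset.sum_insert hi]
    exact (h i (Finset.mem_insert_self _ _)).add
      (ih fun j hj => h j (Finset.mem_insert_of_mem hj))

lemma mul {B₁ B₂ M₁ M₂ : ℝ} (hF : IsRadialFamily V E B₁ M₁ F) (hG : IsRadialFamily V E' B₂ M₂ G)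
    (hM : M ≤ M₁ - B₂) (hM' : M ≤ M₂ - B₁) (h0 : -M₂ ≤ B₂) :
    IsRadialFamily V (E + E') (B₁ + B₂) M (fun z t => F z t * G z t) where
  continuous z hz := (hF.continuous z hz).mul (hG.continuous z hz)
  differentiableOn t := (hF.differentiableOn t).mul (hG.differentiableOn t)
  bounded T := by
    obtain ⟨C, hC⟩ := hF.bounded T
    obtain ⟨C', hC'⟩ := hG.bounded T
    exact ⟨C * C', fun z hz t ht => (norm_mul_le _ _).trans
      (mul_le_mul (hC z hz t ht) (hC' z hz t ht) (norm_nonneg _)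
        ((norm_nonneg _).trans (hC z hz t ht)))⟩
  expansion := by
    obtain ⟨ι, _, e, A, C, T, hC, hT, h1, h2, h3⟩ := hF.expansion
    obtain ⟨ι', _, e', A', C', T', hC', hT', h1', h2', h3'⟩ := hG.expansion
    set K : ℝ := C * ((Fintype.card ι' : ℝ) * C' + C') + Fintype.card ι * C * C' with hK
    have hK0 : 0 ≤ K := by positivity
    refine ⟨ι × ι', inferInstance, fun p z => e p.1 z + e' p.2 z, fun p z => A p.1 z * A' p.2 z,
      max K (max (C + C') (C * C')), max T T', hK0.trans (le_max_left _ _),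
      hT.trans (le_max_left _ _),
      fun p => ⟨(h1 p.1).1.add (h1' p.2).1, (h1 p.1).2.mul (h1' p.2).2⟩,
      fun z hz p => ⟨?_, ?_, ?_, ?_⟩, fun z hz t ht => ?_⟩
    · exact Set.add_mem_add (h2 z hz p.1).1 (h2' z hz p.2).1
    · rw [Complex.add_re]
      exact add_le_add (h2 z hz p.1).2.1 (h2' z hz p.2).2.1
    · exact ((norm_add_le _ _).trans (add_le_add (h2 z hz p.1).2.2.1 (h2' z hz p.2).2.2.1)).trans
        ((le_max_left _ _).trans (le_max_right _ _))
    · exact ((norm_mul_le _ _).trans (mul_le_mul (h2 z hz p.1).2.2.2 (h2' z hz p.2).2.2.2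
        (norm_nonneg _) hC)).trans ((le_max_right _ _).trans (le_max_right _ _))
    · have ht1 : 1 ≤ t := hT.trans ((le_max_left _ _).trans ht)
      have ht0 : 0 < t := by linarith
      have hsum : ∑ p : ι × ι', A p.1 z * A' p.2 z * (t : ℂ) ^ (e p.1 z + e' p.2 z) =
          (∑ i, A i z * (t : ℂ) ^ e i z) * ∑ j, A' j z * (t : ℂ) ^ e' j z := by
        rw [Finset.sum_mul_sum, Fintype.sum_prod_type]
        refine Finset.sum_congr rfl fun i _ => Finset.sum_congr rfl fun j _ => ?_
        rw [Complex.cpow_add _ _ (by exact_mod_cast ht0.ne')]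
        ring
      have hρ := h3 z hz t ((le_max_left _ _).trans ht)
      have hτ := h3' z hz t ((le_max_right _ _).trans ht)
      have hP := norm_sum_mul_cpow_le (a := fun i => A i z) (e := fun i => e i z)
        (fun i => (h2 z hz i).2.2.2) (fun i => (h2 z hz i).2.1) ht1
      have hQ := norm_sum_mul_cpow_le (a := fun i => A' i z) (e := fun i => e' i z)
        (fun i => (h2' z hz i).2.2.2) (fun i => (h2' z hz i).2.1) ht1
      rw [hsum]
      set P := ∑ i, A i z * (t : ℂ) ^ e i z
      set Q := ∑ j, A' j z * (t : ℂ) ^ e' j z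
      -- `h0` makes the remainder of G no larger than the bound t^B₂ of its principal part.
      have hGb : ‖G z t‖ ≤ (Fintype.card ι' * C' + C') * t ^ B₂ := by
        have : ‖G z t‖ ≤ ‖Q‖ + ‖G z t - Q‖ := by
          simpa using norm_add_le Q (G z t - Q)
        have h5 : t ^ (-M₂) ≤ t ^ B₂ := Real.rpow_le_rpow_of_exponent_le ht1 h0
        nlinarith
      have e1 : F z t * G z t - P * Q = (F z t - P) * G z t + P * (G z t - Q) := by ring
      have b1 : ‖(F z t - P) * G z t‖ ≤ C * (Fintype.card ι' * C' + C') * t ^ (-M) := by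
        rw [norm_mul]
        calc ‖F z t - P‖ * ‖G z t‖ ≤ (C * t ^ (-M₁)) * ((Fintype.card ι' * C' + C') * t ^ B₂) :=
              mul_le_mul hρ hGb (norm_nonneg _) (by positivity)
          _ = C * (Fintype.card ι' * C' + C') * t ^ (-M₁ + B₂) := by
              rw [Real.rpow_add ht0]
              ring
          _ ≤ _ := mul_le_mul_of_nonneg_left
              (Real.rpow_le_rpow_of_exponent_le ht1 (by linarith)) (by positivity)
      have b2 : ‖P * (G z t - Q)‖ ≤ Fintype.card ι * C * C' * t ^ (-M) := by
        rw [norm_mul]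
        calc ‖P‖ * ‖G z t - Q‖ ≤ (Fintype.card ι * C * t ^ B₁) * (C' * t ^ (-M₂)) :=
              mul_le_mul hP hτ (norm_nonneg _) (by positivity)
          _ = Fintype.card ι * C * C' * t ^ (B₁ + -M₂) := by
              rw [Real.rpow_add ht0]
              ring
          _ ≤ _ := mul_le_mul_of_nonneg_left
              (Real.rpow_le_rpow_of_exponent_le ht1 (by linarith)) (by positivity)
      rw [e1]
      refine (norm_add_le _ _).trans ((add_le_add b1 b2).trans ?_)
      rw [← add_mul]
      exact mul_le_mul_of_nonneg_right (le_max_left _ _) (by positivity)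

lemma hasExpansion (h : IsRadialFamily V E B M F) {z : ℂ} (hz : z ∈ V) :
    HasExpansion (E z) M (F z) := by
  obtain ⟨ι, _, e, A, C, T, hC, hT, h1, h2, h3⟩ := h.expansion
  refine ⟨fun t => ∑ i, A i z * (t : ℂ) ^ e i z, ?_, IsBigO.of_bound C
    ((eventually_ge_atTop T).mono fun t ht => ?_)⟩
  · have : (fun t : ℝ => ∑ i, A i z * (t : ℂ) ^ e i z) = ∑ i, A i z • logPower (e i z, 0) := by
      funext t
      simp [logPower]
    rw [this]
    exact sum_mem fun i _ => Submodule.smul_mem _ _ (logPower_mem (h2 z hz i).1)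
  · have : 0 ≤ t := by linarith
    rw [Real.norm_of_nonneg (by positivity)]
    exact h3 z hz t ht

lemma isBigO (h : IsRadialFamily V E B M F) (hM : -M ≤ B) {z : ℂ} (hz : z ∈ V) :
    F z =O[atTop] fun t : ℝ => t ^ B := by
  obtain ⟨ι, _, e, A, C, T, hC, hT, h1, h2, h3⟩ := h.expansion
  refine IsBigO.of_bound (Fintype.card ι * C + C) ((eventually_ge_atTop T).mono fun t ht => ?_)
  have ht1 : 1 ≤ t := hT.trans ht
  have hP := norm_sum_mul_cpow_le (a := fun i => A i z) (e := fun i => e i z)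
    (fun i => (h2 z hz i).2.2.2) (fun i => (h2 z hz i).2.1) ht1
  have hρ := h3 z hz t ht
  have h5 : t ^ (-M) ≤ t ^ B := Real.rpow_le_rpow_of_exponent_le ht1 hM
  rw [Real.norm_of_nonneg (by positivity)]
  have := norm_add_le (∑ i, A i z * (t : ℂ) ^ e i z) (F z t - ∑ i, A i z * (t : ℂ) ^ e i z)
  rw [add_sub_cancel] at this
  nlinarith

end IsRadialFamily

/-- Cleared of its denominator, the formula survives at w = −1, where both sides are zero. -/
lemma mul_integral_cpow {w : ℂ} {a b : ℝ} (ha : 0 < a) (hab : a ≤ b) :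
    (w + 1) * ∫ t in a..b, (t : ℂ) ^ w = (b : ℂ) ^ (w + 1) - (a : ℂ) ^ (w + 1) := by
  by_cases hw : w + 1 = 0
  · simp [hw]
  · have h0 : ∀ t ∈ Set.uIcc a b, 0 < t := fun t ht => by
      rw [Set.uIcc_of_le hab] at ht
      exact ha.trans_le ht.1
    rw [← intervalIntegral.integral_const_mul]
    refine intervalIntegral.integral_eq_sub_of_hasDerivAt (f := fun t : ℝ => (t : ℂ) ^ (w + 1))
      (fun t ht => ?_) ?_
    · simpa using hasDerivAt_ofReal_cpow_const (h0 t ht).ne' hw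
    · refine ContinuousOn.intervalIntegrable fun t ht => ContinuousAt.continuousWithinAt ?_
      exact continuousAt_const.mul
        (Complex.continuousAt_ofReal_cpow_const _ _ (Or.inr (h0 t ht).ne'))

lemma abs_le_of_mem_uIoc {a b t : ℝ} (h : t ∈ Set.uIoc a b) : |t| ≤ max |a| |b| := by
  rcases Set.mem_uIoc.1 h with h | h
  · exact abs_le_max_abs_abs h.1.le h.2
  · rw [max_comm]
    exact abs_le_max_abs_abs h.1.le h.2

namespace IsRadialFamily

variable {V : Set ℂ} {E : ℂ → Set ℂ} {B M : ℝ} {F : ℂ → ℝ → ℂ}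

lemma differentiableOn_integral (h : IsRadialFamily V E B M F) (hV : IsOpen V) (a b : ℝ) :
    DifferentiableOn ℂ (fun z => ∫ t in a..b, F z t) V := by
  obtain ⟨C, hC⟩ := h.bounded (max |a| |b|)
  simp only [intervalIntegral.intervalIntegral_eq_integral_uIoc]
  refine DifferentiableOn.const_smul ?_ _
  refine differentiableOn_integral_of_dominated hV (g := fun _ => C)
    (fun z hz => (h.continuous z hz).aestronglyMeasurable)
    (Eventually.of_forall fun t => h.differentiableOn t) ?_
    continuous_const.integrableOn_uIoc
  refine (ae_restrict_iff' measurableSet_uIoc).2 (Eventually.of_forall fun t ht z hz => ?_)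
  exact hC z hz t (abs_le_of_mem_uIoc ht)

/-- The primitive t^(e+1)/(e+1) of t^e has a pole where e(z) = −1. Multiplying F by the product d of
all e_i + 1 removes the poles, and logarithms never occur, so that primitives stay in the class of
radial families. -/
lemma exists_primitive (h : IsRadialFamily V E B M F) (hV : IsOpen V) (hM : 1 < M) :
    ∃ (d : ℂ → ℂ) (G : ℂ → ℝ → ℂ), DifferentiableOn ℂ d V ∧
      (∀ z ∈ V, d z = 0 → (0 : ℂ) ∈ E z + {1}) ∧
      IsRadialFamily V (E + fun _ => {1}) (B + 1) (M - 1) G ∧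
      ∀ z ∈ V, ∀ t, HasDerivAt (G z) (d z * F z t) t := by
  classical
  obtain ⟨ι, _, e, A, C, T, hC, hT, h1, h2, h3⟩ := h.expansion
  have hT0 : 0 < T := by linarith
  set d : ℂ → ℂ := fun z => ∏ i, (e i z + 1) with hd
  set D : ι → ℂ → ℂ := fun i z => ∏ j ∈ Finset.univ.erase i, (e j z + 1) with hD
  set ρ : ℂ → ℝ → ℂ := fun z t => F z t - ∑ i, A i z * (t : ℂ) ^ e i z with hρ
  have hdD : ∀ i z, D i z * (e i z + 1) = d z := fun i z =>
    Finset.prod_erase_mul _ _ (Finset.mem_univ i)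
  have hdd : DifferentiableOn ℂ d V :=
    DifferentiableOn.fun_finsetProd fun i _ => (h1 i).1.add_const 1
  have hDd : ∀ i, DifferentiableOn ℂ (D i) V := fun i =>
    DifferentiableOn.fun_finsetProd fun j _ => (h1 j).1.add_const 1
  set Cd : ℝ := (C + 1) ^ Fintype.card ι with hCd
  have hprod : ∀ (s : Finset ι), ∀ z ∈ V, ‖∏ i ∈ s, (e i z + 1)‖ ≤ Cd := fun s z hz => by
    rw [norm_prod]
    calc ∏ i ∈ s, ‖e i z + 1‖ ≤ ∏ i ∈ s, (C + 1) :=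
          Finset.prod_le_prod (fun _ _ => norm_nonneg _) fun i _ =>
            (norm_add_le _ _).trans (by simpa using (h2 z hz i).2.2.1)
      _ = (C + 1) ^ s.card := by rw [Finset.prod_const]
      _ ≤ Cd := pow_le_pow_right₀ (by linarith) (Finset.card_le_univ s)
  have hCd0 : 0 ≤ Cd := by positivity
  have hρc : ∀ z ∈ V, ContinuousOn (ρ z) (Set.Ioi 0) := fun z hz => by
    refine (h.continuous z hz).continuousOn.sub (continuousOn_finsetSum _ fun i _ => ?_)
    intro t ht
    exact (continuousAt_const.mul (Complex.continuousAt_ofReal_cpow_const _ _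
      (Or.inr (ne_of_gt ht)))).continuousWithinAt
  have hρi : ∀ z ∈ V, IntegrableOn (ρ z) (Set.Ioi T) := fun z hz =>
    integrableOn_Ioi_of_le_rpow hT0 hM ((hρc z hz).mono (Set.Ioi_subset_Ioi hT0.le))
      fun t ht => h3 z hz t ht.le
  have hcpow : ∀ i, ∀ t : ℝ, 0 < t → DifferentiableOn ℂ (fun z => (t : ℂ) ^ e i z) V :=
    fun i t ht => (h1 i).1.const_cpow (Or.inl (by exact_mod_cast ht.ne'))
  have hcpow' : ∀ i, ∀ t : ℝ, 0 < t → DifferentiableOn ℂ (fun z => (t : ℂ) ^ (e i z + 1)) V :=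
    fun i t ht => ((h1 i).1.add_const 1).const_cpow (Or.inl (by exact_mod_cast ht.ne'))
  have hρd : DifferentiableOn ℂ (fun z => ∫ t in Set.Ioi T, ρ z t) V := by
    refine differentiableOn_integral_of_dominated hV (g := fun t => C * t ^ (-M))
      (fun z hz => (hρi z hz).1) ?_ ?_
      ((integrableOn_Ioi_rpow_of_lt (by linarith) hT0).const_mul C)
    · refine (ae_restrict_iff' measurableSet_Ioi).2 (Eventually.of_forall fun t ht => ?_)
      exact (h.differentiableOn t).sub (DifferentiableOn.fun_sum fun i _ =>
        (h1 i).2.mul (hcpow i t (hT0.trans ht)))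
    · exact (ae_restrict_iff' measurableSet_Ioi).2 (Eventually.of_forall fun t ht z hz =>
        h3 z hz t (le_of_lt ht))
  have hρb : ∀ z ∈ V, ∀ t, T ≤ t → ‖∫ s in Set.Ioi t, ρ z s‖ ≤ C / (M - 1) * t ^ (-(M - 1)) :=
    fun z hz t ht => norm_integral_Ioi_le (hT0.trans_le ht) hM
      fun s hs => h3 z hz s (ht.trans hs.le)
  -- K is the value at T of the principal part of the primitive. With this constant of integration
  -- the primitive is Σ A_i D_i t^(e_i+1) − d ∫_t^∞ ρ, with no separate constant at infinity.
  set K : ℂ → ℂ := fun z => ∑ i, A i z * D i z * (T : ℂ) ^ (e i z + 1) with hK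
  have hKd : DifferentiableOn ℂ K V := DifferentiableOn.fun_sum fun i _ =>
    ((h1 i).2.mul (hDd i)).mul (hcpow' i T hT0)
  have hAD : ∀ z ∈ V, ∀ i, ‖A i z * D i z‖ ≤ C * Cd := fun z hz i => by
    rw [norm_mul]
    exact mul_le_mul (h2 z hz i).2.2.2 (hprod _ z hz) (norm_nonneg _) hC
  have hre : ∀ z ∈ V, ∀ i, (e i z + 1).re ≤ B + 1 := fun z hz i => by
    simpa using (h2 z hz i).2.1
  refine ⟨d, fun z t => d z * ((∫ s in T..t, F z s) - ∫ s in Set.Ioi T, ρ z s) + K z, hdd, ?_,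
    ⟨?_, ?_, ?_, ?_⟩, ?_⟩
  · intro z hz h0
    obtain ⟨i, -, hi⟩ := Finset.prod_eq_zero_iff.1 h0
    rw [← hi]
    exact Set.add_mem_add (h2 z hz i).1 rfl
  · intro z hz
    exact (continuous_const.mul ((intervalIntegral.continuous_primitive
      (fun _ _ => (h.continuous z hz).intervalIntegrable _ _) T).sub continuous_const)).add
        continuous_const
  · intro t
    exact (hdd.mul ((h.differentiableOn_integral hV T t).sub hρd)).add hKd
  · intro T'
    obtain ⟨C', hC'⟩ := h.bounded (max T T')
    refine ⟨Cd * (C' * (T' + T) + C / (M - 1) * T ^ (-(M - 1))) +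
      Fintype.card ι * (C * Cd) * T ^ (B + 1), fun z hz t ht => ?_⟩
    have b1 : ‖∫ s in T..t, F z s‖ ≤ C' * (T' + T) := by
      have h5 : ∀ s ∈ Set.uIoc T t, ‖F z s‖ ≤ C' := fun s hs => by
        refine hC' z hz s ?_
        refine (abs_le_of_mem_uIoc hs).trans ?_
        rw [abs_of_pos hT0]
        exact max_le_max le_rfl ht
      have hC0 : 0 ≤ C' := (norm_nonneg _).trans (hC' z hz T (by
        rw [abs_of_pos hT0]; exact le_max_left _ _))
      refine (intervalIntegral.norm_integral_le_of_norm_le_const h5).trans ?_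
      refine mul_le_mul_of_nonneg_left ((abs_sub _ _).trans ?_) hC0
      rw [abs_of_pos hT0]
      linarith
    refine (norm_add_le _ _).trans (add_le_add ?_ ?_)
    · rw [norm_mul]
      exact mul_le_mul (hprod _ z hz) ((norm_sub_le _ _).trans (add_le_add b1 (hρb z hz T le_rfl)))
        (norm_nonneg _) hCd0
    · exact norm_sum_mul_cpow_le (hAD z hz) (hre z hz) hT
  · refine ⟨ι, inferInstance, fun i z => e i z + 1, fun i z => A i z * D i z,
      max (C + 1) (max (C * Cd) (Cd * (C / (M - 1)))), T,
      le_trans (by positivity) (le_max_left _ _), hT,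
      fun i => ⟨(h1 i).1.add_const 1, (h1 i).2.mul (hDd i)⟩,
      fun z hz i => ⟨Set.add_mem_add (h2 z hz i).1 rfl, hre z hz i, ?_, ?_⟩, fun z hz t ht => ?_⟩
    · exact ((norm_add_le _ _).trans (by simpa using (h2 z hz i).2.2.1)).trans (le_max_left _ _)
    · exact (hAD z hz i).trans ((le_max_left _ _).trans (le_max_right _ _))
    · have ht0 : 0 < t := hT0.trans_le ht
      have e0 : ∀ i, IntervalIntegrable (fun s : ℝ => A i z * (s : ℂ) ^ e i z) volume T t :=
        fun i => ContinuousOn.intervalIntegrable fun s hs => by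
          rw [Set.uIcc_of_le ht] at hs
          exact (continuousAt_const.mul (Complex.continuousAt_ofReal_cpow_const _ _
            (Or.inr (hT0.trans_le hs.1).ne'))).continuousWithinAt
      have e1 : ∫ s in T..t, ρ z s =
          (∫ s in T..t, F z s) - ∑ i, A i z * ∫ s in T..t, (s : ℂ) ^ e i z := by
        rw [hρ]
        simp only
        rw [intervalIntegral.integral_sub ((h.continuous z hz).intervalIntegrable _ _),
          intervalIntegral.integral_finsetSum fun i _ => e0 i]
        · simp only [intervalIntegral.integral_const_mul]
        · have := IntervalIntegrable.sum Finset.univ fun i _ => e0 i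
          refine this.congr fun s _ => ?_
          simp
      have e2 := intervalIntegral.integral_Ioi_sub_Ioi (hρi z hz) ht
      have e3 : d z * ∑ i, A i z * ∫ s in T..t, (s : ℂ) ^ e i z =
          (∑ i, A i z * D i z * (t : ℂ) ^ (e i z + 1)) - K z := by
        rw [hK, Finset.mul_sum, ← Finset.sum_sub_distrib]
        refine Finset.sum_congr rfl fun i _ => ?_
        rw [← hdD i z]
        linear_combination A i z * D i z * mul_integral_cpow (w := e i z) hT0 ht
      have e4 : d z * ((∫ s in T..t, F z s) - ∫ s in Set.Ioi T, ρ z s) + K z -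
          ∑ i, A i z * D i z * (t : ℂ) ^ (e i z + 1) = - (d z * ∫ s in Set.Ioi t, ρ z s) := by
        linear_combination -d z * e2 - d z * e1 + e3
      rw [e4, norm_neg, norm_mul]
      calc ‖d z‖ * ‖∫ s in Set.Ioi t, ρ z s‖ ≤ Cd * (C / (M - 1) * t ^ (-(M - 1))) :=
            mul_le_mul (hprod _ z hz) (hρb z hz t ht) (norm_nonneg _) hCd0
        _ = Cd * (C / (M - 1)) * t ^ (-(M - 1)) := by ring
        _ ≤ _ := mul_le_mul_of_nonneg_right ((le_max_right _ _).trans (le_max_right _ _))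
            (by positivity)
  · intro z hz t
    have hc := h.continuous z hz
    have := ((intervalIntegral.integral_hasDerivAt_right (hc.intervalIntegrable T t)
      (hc.stronglyMeasurableAtFilter _ _) hc.continuousAt).sub_const
        (∫ s in Set.Ioi T, ρ z s)).const_mul (d z)
    exact this.add_const (K z)

end IsRadialFamily

/-! ### Dependence of finite parts of iterated integrals on a parameter -/

lemma isBigO_integral {f : ℝ → ℂ} {c : ℝ} (hf : Continuous f) (hc : 0 ≤ c)
    (h : f =O[atTop] fun t : ℝ => t ^ c) (r : ℝ) :
    (fun R => ∫ t in r..R, f t) =O[atTop] fun t : ℝ => t ^ (c + 1) := by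
  obtain ⟨C, hC⟩ := h.bound
  obtain ⟨T, hT⟩ := eventually_atTop.1 hC
  set T' := max T 1
  have hT1 : 1 ≤ T' := le_max_right _ _
  refine IsBigO.of_bound (‖∫ t in r..T', f t‖ + |C|) ((eventually_ge_atTop T').mono fun R hR => ?_)
  have hR1 : 1 ≤ R := hT1.trans hR
  have h1 : ‖∫ t in T'..R, f t‖ ≤ (|C| * R ^ c) * |R - T'| := by
    refine intervalIntegral.norm_integral_le_of_norm_le_const fun t ht => ?_
    rw [Set.uIoc_of_le hR] at ht
    refine (hT t ((le_max_left _ _).trans ht.1.le)).trans ?_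
    have ht0 : 0 ≤ t := by linarith [ht.1]
    rw [Real.norm_of_nonneg (by positivity)]
    exact mul_le_mul (le_abs_self C) (Real.rpow_le_rpow ht0 ht.2 hc) (by positivity) (abs_nonneg _)
  rw [← intervalIntegral.integral_add_adjacent_intervals (hf.intervalIntegrable r T')
    (hf.intervalIntegrable T' R), Real.norm_of_nonneg (by positivity), add_mul]
  refine (norm_add_le _ _).trans (add_le_add ?_ (h1.trans ?_))
  · exact le_mul_of_one_le_right (norm_nonneg _) (Real.one_le_rpow hR1 (by linarith))
  · rw [Real.rpow_add (by linarith), Real.rpow_one, ← mul_assoc]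
    refine mul_le_mul_of_nonneg_left ?_ (by positivity)
    rw [abs_of_nonneg (by linarith)]
    linarith

lemma isBigO_iterInt {l : List (ℝ → ℂ)} {B : ℝ} (hB : 0 ≤ B) (hc : ∀ a ∈ l, Continuous a)
    (h : ∀ a ∈ l, a =O[atTop] fun t : ℝ => t ^ B) (r : ℝ) :
    iterInt r l =O[atTop] fun t : ℝ => t ^ (l.length * (B + 1)) := by
  induction l with
  | nil =>
    refine IsBigO.of_bound 1 (Eventually.of_forall fun t => ?_)
    simp [iterInt]
  | cons a l ih =>
    simp only [List.mem_cons, forall_eq_or_imp] at hc h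
    have := isBigO_integral (hc.1.mul (continuous_iterInt (r := r) hc.2)) (by positivity)
      (IsBigO.mul_rpow h.1 (ih hc.2 h.2)) r
    have e : ((a :: l).length : ℝ) * (B + 1) = B + l.length * (B + 1) + 1 := by
      push_cast [List.length_cons]
      ring
    rw [e]
    exact this

/-- The integral of `G` against the derivative of an iterated integral. -/
def weightedIterInt (r : ℝ) (G : ℝ → ℂ) : List (ℝ → ℂ) → ℝ → ℂ
  | [] => fun _ => 0
  | a :: l => fun R => ∫ t in r..R, G t * (a t * iterInt r l t)

lemma weightedIterInt_one (r : ℝ) (a : ℝ → ℂ) (l : List (ℝ → ℂ)) :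
    weightedIterInt r (fun _ => 1) (a :: l) = iterInt r (a :: l) := by
  funext R
  simp [weightedIterInt, iterInt]

/-- Integration by parts, with G₁ a primitive of d·G·a. The new integral carries the derivative of
`iterInt r l`, which is zero for the empty word; hence the value 0 of `weightedIterInt` there. -/
lemma mul_weightedIterInt_cons {r : ℝ} {G G₁ a : ℝ → ℂ} {l : List (ℝ → ℂ)} {d : ℂ}
    (hG : Continuous G) (hl : ∀ b ∈ a :: l, Continuous b)
    (hG₁ : ∀ t, HasDerivAt G₁ (d * (G t * a t)) t) (R : ℝ) :
    d * weightedIterInt r G (a :: l) R =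
      G₁ R * iterInt r l R - G₁ r * iterInt r l r - weightedIterInt r G₁ l R := by
  have hl' := hl
  simp only [List.mem_cons, forall_eq_or_imp] at hl'
  have hcG₁ : Continuous G₁ := continuous_iff_continuousAt.2 fun t => (hG₁ t).continuousAt
  have hcl : Continuous (iterInt r l) := continuous_iterInt hl'.2
  have hca := hl'.1
  have key : ∀ g : ℝ → ℂ, Continuous g → (∀ t, HasDerivAt (iterInt r l) (g t) t) →
      (∫ t in r..R, d * (G t * (a t * iterInt r l t))) + ∫ t in r..R, G₁ t * g t =
        G₁ R * iterInt r l R - G₁ r * iterInt r l r := by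
    intro g hg hd
    have i1 : Continuous fun t => d * (G t * (a t * iterInt r l t)) := by fun_prop
    have i2 : Continuous fun t => G₁ t * g t := by fun_prop
    rw [← intervalIntegral.integral_add (i1.intervalIntegrable _ _) (i2.intervalIntegrable _ _)]
    exact intervalIntegral.integral_eq_sub_of_hasDerivAt
      (f := fun t => G₁ t * iterInt r l t)
      (fun t _ => ((hG₁ t).mul (hd t)).congr_deriv (by ring))
      ((i1.intervalIntegrable _ _).add (i2.intervalIntegrable _ _))
  have e1 : d * weightedIterInt r G (a :: l) R =
      ∫ t in r..R, d * (G t * (a t * iterInt r l t)) :=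
    (intervalIntegral.integral_const_mul _ _).symm
  rw [e1]
  cases l with
  | nil =>
    have := key (fun _ => 0) continuous_const fun t => hasDerivAt_const _ _
    simp only [mul_zero, intervalIntegral.integral_zero, add_zero] at this
    rw [this]
    simp [weightedIterInt]
  | cons b l =>
    have h2 := hl'.2
    simp only [List.mem_cons, forall_eq_or_imp] at h2
    rw [← key _ (h2.1.mul (continuous_iterInt (r := r) h2.2)) (hasDerivAt_iterInt hl'.2)]
    simp [weightedIterInt]

/-- Each integration by parts moves one letter into the weight. The boundary term at R only has
exponents from the listed sums, while the one at r is holomorphic in z and goes into c; after the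
last letter nothing is left. Per letter M' drops and B' grows by B + 1, so M' + B' is preserved, and
`h2` leaves room for the whole word. -/
lemma exists_hasExpansion_weightedIterInt {X : Type*} {V : Set ℂ} (hV : IsOpen V)
    {a : X → ℂ → ℝ → ℂ} {E : X → ℂ → Set ℂ} {B M₀ : ℝ} (hB : 0 ≤ B) (hM₀ : 0 ≤ M₀) {l : List X}
    (ha : ∀ x ∈ l, IsRadialFamily V (E x) B M₀ (a x))
    (hE : ∀ x ∈ l, ∀ z ∈ V, ∀ M, HasExpansion (E x z) M (a x z)) (r : ℝ)
    {D : ℂ → Set ℂ} {B' M' : ℝ} {G : ℂ → ℝ → ℂ} (hG : IsRadialFamily V D B' M' G)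
    (h1 : M' + B' ≤ M₀ + B) (h2 : l.length * (B + 1) + 1 ≤ M') :
    ∃ d c : ℂ → ℂ, DifferentiableOn ℂ d V ∧ DifferentiableOn ℂ c V ∧ ∀ z ∈ V,
      (d z = 0 → 0 ∈ D z + leftSums (l.map (E · z))) ∧
      HasExpansion (D z + leftSums (l.map (E · z))) 1
        (fun R => d z * weightedIterInt r (G z) (l.map (a · z)) R - c z) := by
  induction l generalizing D B' M' G with
  | nil =>
    refine ⟨fun _ => 1, fun _ => 0, differentiableOn_const _, differentiableOn_const _,
      fun z hz => ⟨fun h => absurd h one_ne_zero, ?_⟩⟩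
    refine HasExpansion.zero.congr (Eventually.of_forall fun R => ?_)
    simp [weightedIterInt]
  | cons x l ih =>
    simp only [List.mem_cons, forall_eq_or_imp] at ha hE
    have hlen : ((x :: l).length : ℝ) = l.length + 1 := by push_cast [List.length_cons]; rfl
    rw [hlen] at h2
    have hl0 : 0 ≤ (l.length : ℝ) * (B + 1) := by positivity
    have hGa : IsRadialFamily V (D + E x) (B' + B) (M' - B) (fun z t => G z t * a x z t) :=
      hG.mul ha.1 le_rfl (by linarith) (by linarith)
    obtain ⟨d₁, G₁, hd₁, hd₁0, hG₁, hder⟩ := hGa.exists_primitive hV (by nlinarith)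
    obtain ⟨d₂, c₂, hd₂, hc₂, h⟩ := ih ha.2 hE.2 hG₁ (by linarith) (by nlinarith)
    -- The iterated integral at its lower end is 1 for the empty word and 0 otherwise, hence
    -- constant in z.
    have hself : DifferentiableOn ℂ (fun z => iterInt r (l.map (a · z)) r) V := by
      cases l with
      | nil => exact differentiableOn_const _
      | cons y l =>
        simp only [List.map_cons, iterInt_cons_self]
        exact differentiableOn_const _
    refine ⟨fun z => d₂ z * d₁ z,
      fun z => -(d₂ z * (G₁ z r * iterInt r (l.map (a · z)) r)) - c₂ z, hd₂.mul hd₁,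
      ((hd₂.mul ((hG₁.differentiableOn r).mul hself)).neg).sub hc₂, fun z hz => ⟨?_, ?_⟩⟩
    · intro h0
      rw [List.map_cons, leftSums, ← add_assoc, ← add_assoc]
      -- A zero of d comes from a longer prefix through d₂, or from the present letter through d₁;
      -- the latter uses the element 0 of {0} ∪ `leftSums`.
      rcases mul_eq_zero.1 h0 with h0 | h0
      · refine Set.add_subset_add_left Set.subset_union_right ((h z hz).1 h0)
      · have := hd₁0 z hz h0
        have h3 := Set.add_mem_add this (Set.mem_union_left (leftSums (l.map (E · z)))
          (Set.mem_singleton (0 : ℂ)))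
        rwa [add_zero] at h3
    · rw [List.map_cons, List.map_cons, leftSums, ← add_assoc, ← add_assoc]
      have hc : ∀ b ∈ a x z :: l.map (a · z), Continuous b := by
        simp only [List.mem_cons, List.mem_map, forall_eq_or_imp]
        refine ⟨ha.1.continuous z hz, ?_⟩
        rintro _ ⟨y, hy, rfl⟩
        exact (ha.2 y hy).continuous z hz
      have hO : ∀ b ∈ l.map (a · z), b =O[atTop] fun t : ℝ => t ^ B := by
        simp only [List.mem_map]
        rintro _ ⟨y, hy, rfl⟩
        exact (ha.2 y hy).isBigO (by linarith) hz
      have e1 : HasExpansion (D z + E x z + {1} + ({0} ∪ leftSums (l.map (E · z)))) 1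
          (fun R => G₁ z R * iterInt r (l.map (a · z)) R) := by
        have hI := hasExpansion_iterInt (a := (a · z)) (E := (E · z)) (l := l)
          (fun y hy => (ha.2 y hy).continuous z hz) (fun y hy => hE.2 y hy z hz) r
        have hbig := isBigO_iterInt hB (fun b hb => hc b (List.mem_cons_of_mem _ hb)) hO r
        rw [List.length_map] at hbig
        exact ((hG₁.hasExpansion hz).mul_of_isBigO hI hbig).mono subset_rfl (by linarith)
      have e2 := (h z hz).2.mono (Set.add_subset_add_left
        (Set.subset_union_right (s := {(0 : ℂ)}))) le_rfl
      refine ((e1.const_mul (d₂ z)).sub e2).congr (Eventually.of_forall fun R => ?_)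
      have := mul_weightedIterInt_cons (r := r) (hG.continuous z hz) hc (hder z hz) R
      linear_combination (-d₂ z) * this

/-- The iterated integral is the weighted one with weight 1, whose only exponent is 0. If 0 is not
among the left sums then d(z) ≠ 0, and c(z)/d(z) is the constant term. -/
lemma exists_finitePart_iterInt_eq_div {X : Type*} {V : Set ℂ} (hV : IsOpen V)
    {a : X → ℂ → ℝ → ℂ} {E : X → ℂ → Set ℂ} {B M₀ : ℝ} (hB : 0 ≤ B) {l : List X}
    (hM₀ : l.length * (B + 1) + 1 ≤ M₀)
    (ha : ∀ x ∈ l, IsRadialFamily V (E x) B M₀ (a x))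
    (hE : ∀ x ∈ l, ∀ z ∈ V, ∀ M, HasExpansion (E x z) M (a x z)) (r : ℝ) :
    ∃ d c : ℂ → ℂ, DifferentiableOn ℂ d V ∧ DifferentiableOn ℂ c V ∧ ∀ z ∈ V,
      0 ∉ leftSums (l.map (E · z)) → d z ≠ 0 ∧
        finitePart (iterInt r (l.map (a · z))) = c z / d z := by
  cases l with
  | nil =>
    refine ⟨fun _ => 1, fun _ => 1, differentiableOn_const _, differentiableOn_const _,
      fun z hz _ => ⟨one_ne_zero, ?_⟩⟩
    refine HasFinitePart.finitePart_eq ⟨∅, 0, by simp, ?_⟩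
    simp [iterInt]
  | cons x l =>
    have h0 : 0 ≤ M₀ := le_trans (by positivity) hM₀
    obtain ⟨d, c, hd, hc, h⟩ := exists_hasExpansion_weightedIterInt hV hB h0 ha hE r
      (IsRadialFamily.one (E := fun _ => {0}) (fun _ _ => rfl) le_rfl) (by linarith) hM₀
    refine ⟨d, c, hd, hc, fun z hz hz0 => ?_⟩
    obtain ⟨h1, h2⟩ := h z hz
    rw [Set.singleton_zero, zero_add] at h1 h2
    have hdz : d z ≠ 0 := fun h => hz0 (h1 h)
    refine ⟨hdz, HasFinitePart.finitePart_eq (HasExpansion.hasFinitePart hz0 one_pos ?_)⟩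
    · refine (h2.const_mul (d z)⁻¹).congr (Eventually.of_forall fun R => ?_)
      simp only [List.map_cons, weightedIterInt_one]
      field_simp

section Parameter

variable {X : Type*} {z₀ : ℂ} {a : X → ℂ → ℝ → ℂ} {E : X → ℂ → Set ℂ} {l : List X}

/-- The growth bound B must not depend on M, since the precision required, length·(B + 1) + 1,
depends on B. -/
lemma exists_nhds_finitePart_iterInt_eq_div
    (ha : ∀ x ∈ l, ∃ B : ℝ, ∀ M : ℝ, ∃ V : Set ℂ, IsOpen V ∧ z₀ ∈ V ∧
      IsRadialFamily V (E x) B M (a x))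
    (hE : ∀ᶠ z in 𝓝 z₀, ∀ x ∈ l, ∀ M, HasExpansion (E x z) M (a x z)) (r : ℝ) :
    ∃ d c : ℂ → ℂ, AnalyticAt ℂ d z₀ ∧ AnalyticAt ℂ c z₀ ∧ ∀ᶠ z in 𝓝 z₀,
      0 ∉ leftSums (l.map (E · z)) → d z ≠ 0 ∧
        finitePart (iterInt r (l.map (a · z))) = c z / d z := by
  have hB : ∃ B : ℝ, 0 ≤ B ∧ ∀ M : ℝ, ∃ V : Set ℂ, IsOpen V ∧ z₀ ∈ V ∧
      ∀ x ∈ l, IsRadialFamily V (E x) B M (a x) := by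
    clear hE
    induction l with
    | nil => exact ⟨0, le_rfl, fun M => ⟨Set.univ, isOpen_univ, trivial, by simp⟩⟩
    | cons x l ih =>
      simp only [List.mem_cons, forall_eq_or_imp] at ha ⊢
      obtain ⟨B, hB, h⟩ := ih ha.2
      obtain ⟨B', h'⟩ := ha.1
      refine ⟨max B B', hB.trans (le_max_left _ _), fun M => ?_⟩
      obtain ⟨V, hV, hz, hVl⟩ := h M
      obtain ⟨V', hV', hz', hVx⟩ := h' M
      exact ⟨V ∩ V', hV.inter hV', ⟨hz, hz'⟩,
        hVx.mono Set.inter_subset_right (fun _ _ => subset_rfl) (le_max_right _ _) le_rfl,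
        fun y hy => (hVl y hy).mono Set.inter_subset_left (fun _ _ => subset_rfl)
          (le_max_left _ _) le_rfl⟩
  obtain ⟨B, hB0, hB⟩ := hB
  obtain ⟨V, hV, hz, hVl⟩ := hB (l.length * (B + 1) + 1)
  obtain ⟨U, hU, hUo, hUz⟩ := mem_nhds_iff.1 hE
  obtain ⟨d, c, hd, hc, h⟩ := exists_finitePart_iterInt_eq_div (hV.inter hUo) hB0 le_rfl
    (fun x hx => (hVl x hx).mono Set.inter_subset_left (fun _ _ => subset_rfl) le_rfl le_rfl)
    (fun x hx z hz => hU hz.2 x hx) r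
  have hmem : V ∩ U ∈ 𝓝 z₀ := (hV.inter hUo).mem_nhds ⟨hz, hUz⟩
  exact ⟨d, c, hd.analyticAt hmem, hc.analyticAt hmem, mem_of_superset hmem h⟩

lemma meromorphicAt_finitePart_iterInt
    (ha : ∀ x ∈ l, ∃ B : ℝ, ∀ M : ℝ, ∃ V : Set ℂ, IsOpen V ∧ z₀ ∈ V ∧
      IsRadialFamily V (E x) B M (a x))
    (hE : ∀ᶠ z in 𝓝 z₀, ∀ x ∈ l, ∀ M, HasExpansion (E x z) M (a x z))
    (h0 : ∀ᶠ z in 𝓝[≠] z₀, 0 ∉ leftSums (l.map (E · z))) (r : ℝ) :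
    MeromorphicAt (fun z => finitePart (iterInt r (l.map (a · z)))) z₀ := by
  obtain ⟨d, c, hd, hc, h⟩ := exists_nhds_finitePart_iterInt_eq_div ha hE r
  refine (hc.meromorphicAt.div hd.meromorphicAt).congr ?_
  filter_upwards [h0, h.filter_mono nhdsWithin_le_nhds] with z h1 h2
  exact (h2 h1).2.symm

lemma analyticAt_finitePart_iterInt
    (ha : ∀ x ∈ l, ∃ B : ℝ, ∀ M : ℝ, ∃ V : Set ℂ, IsOpen V ∧ z₀ ∈ V ∧
      IsRadialFamily V (E x) B M (a x))
    (hE : ∀ᶠ z in 𝓝 z₀, ∀ x ∈ l, ∀ M, HasExpansion (E x z) M (a x z))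
    (h0 : ∀ᶠ z in 𝓝 z₀, 0 ∉ leftSums (l.map (E · z))) (r : ℝ) :
    AnalyticAt ℂ (fun z => finitePart (iterInt r (l.map (a · z)))) z₀ := by
  obtain ⟨d, c, hd, hc, h⟩ := exists_nhds_finitePart_iterInt_eq_div ha hE r
  refine (hc.div hd (h.self_of_nhds h0.self_of_nhds).1).congr ?_
  filter_upwards [h0, h] with z h1 h2
  exact (h2 h1).2.symm

end Parameter

/-! ### Polar coordinates -/

section Polar

variable {n : ℕ} {N : Seminorm ℝ (Space n)}

lemma continuous_seminorm (N : Seminorm ℝ (Space n)) : Continuous N :=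
  continuousOn_univ.1 (N.convexOn.continuousOn isOpen_univ)

lemma IsSmoothNorm.pos (hN : IsSmoothNorm N) {ξ : Space n} (hξ : ξ ≠ 0) : 0 < N ξ :=
  lt_of_le_of_ne (apply_nonneg N ξ) fun h => hξ (hN.1 ξ h.symm)

lemma IsSmoothNorm.isCompact (hN : IsSmoothNorm N) (R : ℝ) : IsCompact {ξ | N ξ ≤ R} := by
  refine Metric.isCompact_of_isClosed_isBounded
    (isClosed_le (continuous_seminorm N) continuous_const) ?_
  -- The sphere is empty for n = 0. Otherwise the minimum of N on it is positive and bounds the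
  -- Euclidean norm by a multiple of N.
  rcases (Metric.sphere (0 : Space n) 1).eq_empty_or_nonempty with he | hne
  · refine (Bornology.isBounded_singleton (x := (0 : Space n))).subset fun ξ _ => ?_
    by_contra hξ
    have : (‖ξ‖⁻¹ • ξ) ∈ Metric.sphere (0 : Space n) 1 := by
      simp [norm_smul, norm_ne_zero_iff.2 hξ]
    rw [he] at this
    exact this
  · obtain ⟨x, hx, hmin⟩ := (isCompact_sphere (0 : Space n) 1).exists_isMinOn hne
      (continuous_seminorm N).continuousOn
    have hx0 : 0 < N x := hN.pos (by
      rintro rfl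
      simp at hx)
    refine (Metric.isBounded_closedBall (x := (0 : Space n)) (r := R / N x)).subset fun ξ hξ => ?_
    rw [mem_closedBall_zero_iff, le_div_iff₀ hx0]
    refine le_trans ?_ (show N ξ ≤ R from hξ)
    by_cases h0 : ξ = 0
    · simp [h0]
    · have h1 : (‖ξ‖⁻¹ • ξ) ∈ Metric.sphere (0 : Space n) 1 := by
        simp [norm_smul, norm_ne_zero_iff.2 h0]
      have h2 : N x ≤ N (‖ξ‖⁻¹ • ξ) := hmin h1
      rw [map_smul_eq_mul, norm_inv, norm_norm] at h2
      rwa [← le_inv_mul_iff₀ (norm_pos_iff.2 h0)]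

/-- The unit sphere of the Euclidean norm. -/
abbrev Sphere (n : ℕ) : Type := Metric.sphere (0 : Space n) 1

/-- The radial projection of a point of the sphere to the unit sphere of `N`. -/
def direction (N : Seminorm ℝ (Space n)) (x : Sphere n) : Space n := (N x)⁻¹ • (x : Space n)

/-- The density of the measure on the unit sphere of `N` which appears in polar coordinates. -/
def directionWeight (N : Seminorm ℝ (Space n)) (x : Sphere n) : ℂ := (((N x)⁻¹ ^ n : ℝ) : ℂ)

/-- The measure on the Euclidean unit sphere. -/
def sphereMeasure (n : ℕ) : Measure (Sphere n) := (volume : Measure (Space n)).toSphere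

instance : IsFiniteMeasure (sphereMeasure n) := by
  unfold sphereMeasure
  infer_instance

/-- The mean of `f` over the sphere of radius `t`, times `t ^ (n - 1)`. -/
def radial (N : Seminorm ℝ (Space n)) (f : Space n → ℂ) (t : ℝ) : ℂ :=
  (t : ℂ) ^ (n - 1) * ∫ x, directionWeight N x * f (t • direction N x) ∂sphereMeasure n

lemma sphere_ne_zero (x : Sphere n) : (x : Space n) ≠ 0 := by
  intro h
  have := x.2
  rw [h] at this
  simp at this

lemma IsSmoothNorm.sphere_pos (hN : IsSmoothNorm N) (x : Sphere n) : 0 < N x :=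
  hN.pos (sphere_ne_zero x)

lemma IsSmoothNorm.continuous_direction (hN : IsSmoothNorm N) : Continuous (direction N) :=
  (((continuous_seminorm N).comp continuous_subtype_val).inv₀
    fun x => (hN.sphere_pos x).ne').smul continuous_subtype_val

lemma IsSmoothNorm.continuous_directionWeight (hN : IsSmoothNorm N) :
    Continuous (directionWeight N) :=
  Complex.continuous_ofReal.comp ((((continuous_seminorm N).comp continuous_subtype_val).inv₀
    fun x => (hN.sphere_pos x).ne').pow n)

lemma IsSmoothNorm.norm_smul_direction (hN : IsSmoothNorm N) (t : ℝ) (x : Sphere n) :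
    N (t • direction N x) = |t| := by
  rw [direction, map_smul_eq_mul, map_smul_eq_mul, Real.norm_eq_abs, Real.norm_eq_abs,
    abs_of_pos (inv_pos.2 (hN.sphere_pos x)), inv_mul_cancel₀ (hN.sphere_pos x).ne', mul_one]

lemma IsSmoothNorm.direction_ne_zero (hN : IsSmoothNorm N) (x : Sphere n) : direction N x ≠ 0 :=
  smul_ne_zero (inv_ne_zero (hN.sphere_pos x).ne') (sphere_ne_zero x)

lemma integral_eq_integral_sphere (hn : 0 < n) {F : Space n → ℂ} (hF : Integrable F) :
    ∫ ξ, F ξ = ∫ x, (∫ s in Set.Ioi (0 : ℝ), (s : ℂ) ^ (n - 1) * F (s • (x : Space n)))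
      ∂sphereMeasure n := by
  have : Nonempty (Fin n) := ⟨⟨0, hn⟩⟩
  have hmp := (volume : Measure (Space n)).measurePreserving_homeomorphUnitSphereProd
  have hemb := (homeomorphUnitSphereProd (Space n)).measurableEmbedding
  rw [finrank_euclideanSpace_fin] at hmp
  set F' : Sphere n × Set.Ioi (0 : ℝ) → ℂ := fun p => F ((p.2 : ℝ) • (p.1 : Space n)) with hF'
  have hcomp : ∀ ξ : ({0}ᶜ : Set (Space n)), F' (homeomorphUnitSphereProd (Space n) ξ) = F ξ := by
    intro ξ
    have h0 : ‖(ξ : Space n)‖ ≠ 0 := norm_ne_zero_iff.2 ξ.2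
    simp [hF', smul_smul, h0]
  have hint : Integrable F' ((volume : Measure (Space n)).toSphere.prod
      (Measure.volumeIoiPow (n - 1))) := by
    rw [← hmp.integrable_comp_emb hemb]
    have : F' ∘ (homeomorphUnitSphereProd (Space n)) = F ∘ Subtype.val := funext hcomp
    rw [this, ← integrableOn_iff_comap_subtypeVal (measurableSet_singleton _).compl]
    exact hF.integrableOn
  calc ∫ ξ, F ξ = ∫ ξ : ({0}ᶜ : Set (Space n)), F ξ ∂(volume.comap Subtype.val) := by
        rw [integral_subtype_comap (measurableSet_singleton _).compl F, restrict_compl_singleton]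
    _ = ∫ p, F' p ∂((volume : Measure (Space n)).toSphere.prod
          (Measure.volumeIoiPow (n - 1))) := by
        rw [← hmp.integral_comp hemb]
        simp only [hcomp]
    _ = _ := by
        rw [integral_prod _ hint]
        refine integral_congr_ae (Eventually.of_forall fun x => ?_)
        simp only [Measure.volumeIoiPow, ENNReal.ofReal, hF']
        rw [integral_withDensity_eq_integral_smul,
          integral_subtype_comap measurableSet_Ioi fun a =>
            Real.toNNReal (a ^ (n - 1)) • F (a • (x : Space n)),
          setIntegral_congr_fun measurableSet_Ioi fun s hs => ?_]
        · beta_reduce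
          rw [NNReal.smul_def, Real.coe_toNNReal _ (pow_nonneg (le_of_lt hs) _)]
          simp
        · exact (measurable_subtype_coe.pow_const _).real_toNNReal

/-- Euclidean polar coordinates are followed, in each direction x, by the substitution t = N(x)s,
which makes t the value of N; its Jacobian N(x)^(−n) is `directionWeight`. The factor g(N ξ) is
meant for the inner Chen integral. -/
lemma IsSmoothNorm.integral_shell (hN : IsSmoothNorm N) (hn : 0 < n) {f : Space n → ℂ}
    {g : ℝ → ℂ} (hf : Continuous f) (hg : Continuous g) {r R : ℝ} (hr : 0 ≤ r) (hR : r ≤ R) :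
    ∫ ξ in {ξ | r ≤ N ξ ∧ N ξ ≤ R}, f ξ * g (N ξ) = ∫ t in r..R, radial N f t * g t := by
  have hNc := continuous_seminorm N
  have hclosed : IsClosed {ξ | r ≤ N ξ ∧ N ξ ≤ R} :=
    (isClosed_le continuous_const hNc).inter (isClosed_le hNc continuous_const)
  have hcompact : IsCompact {ξ | r ≤ N ξ ∧ N ξ ≤ R} :=
    (hN.isCompact R).of_isClosed_subset hclosed fun ξ hξ => hξ.2
  have hfg : Continuous fun ξ => f ξ * g (N ξ) := hf.mul (hg.comp hNc)
  rw [← integral_indicator hclosed.measurableSet, integral_eq_integral_sphere hn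
    ((integrable_indicator_iff hclosed.measurableSet).2 (hfg.continuousOn.integrableOn_compact hcompact))]
  have hθ := hN.continuous_direction
  have hw := hN.continuous_directionWeight
  have step : ∀ x : Sphere n, ∫ s in Set.Ioi (0 : ℝ), (s : ℂ) ^ (n - 1) *
      Set.indicator {ξ | r ≤ N ξ ∧ N ξ ≤ R} (fun ξ => f ξ * g (N ξ)) (s • (x : Space n)) =
      ∫ t in Set.Ioc r R, directionWeight N x * ((t : ℂ) ^ (n - 1) *
        (f (t • direction N x) * g t)) := by
    intro x
    have hb := hN.sphere_pos x
    set b := N (x : Space n) with hbdef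
    have h1 := integral_comp_mul_right_Ioi (fun t : ℝ => (((b⁻¹ * t : ℝ) : ℂ)) ^ (n - 1) *
      Set.indicator (Set.Icc r R) (fun t => f (t • direction N x) * g t) t) 0 hb
    rw [zero_mul] at h1
    have h2 : ∀ s : ℝ, 0 < s → (s : ℂ) ^ (n - 1) *
        Set.indicator {ξ | r ≤ N ξ ∧ N ξ ≤ R} (fun ξ => f ξ * g (N ξ)) (s • (x : Space n)) =
        (((b⁻¹ * (s * b) : ℝ) : ℂ)) ^ (n - 1) *
          Set.indicator (Set.Icc r R) (fun t => f (t • direction N x) * g t) (s * b) := by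
      intro s hs
      have e1 : b⁻¹ * (s * b) = s := by field_simp
      have e2 : N (s • (x : Space n)) = s * b := by
        rw [map_smul_eq_mul, Real.norm_of_nonneg hs.le]
      have e3 : (s * b) • direction N x = s • (x : Space n) := by
        rw [direction, smul_smul, ← hbdef, mul_assoc, mul_inv_cancel₀ hb.ne', mul_one]
      rw [e1]
      congr 1
      simp only [Set.indicator, Set.mem_ofPred_eq, Set.mem_Icc, e2, e3]
    rw [setIntegral_congr_fun measurableSet_Ioi fun s hs => h2 s hs, h1]
    have h3 : (fun t : ℝ => (((b⁻¹ * t : ℝ) : ℂ)) ^ (n - 1) *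
        Set.indicator (Set.Icc r R) (fun t => f (t • direction N x) * g t) t) =
        Set.indicator (Set.Icc r R) (fun t => (((b⁻¹ * t : ℝ) : ℂ)) ^ (n - 1) *
          (f (t • direction N x) * g t)) := by
      funext t
      by_cases ht : t ∈ Set.Icc r R <;> simp [ht]
    -- As r ≥ 0, the two sets differ at most in the point r.
    have h4 : (Set.Ioi 0 ∩ Set.Icc r R : Set ℝ) =ᵐ[volume] Set.Ioc r R := by
      have a1 : (Set.Ioi 0 ∩ Set.Ioc r R : Set ℝ) = Set.Ioc r R :=
        Set.inter_eq_right.2 fun t ht => hr.trans_lt ht.1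
      rw [← a1]
      exact (Filter.EventuallyEq.refl _ _).inter Ioc_ae_eq_Icc.symm
    rw [h3, setIntegral_indicator measurableSet_Icc, setIntegral_congr_set h4, Complex.real_smul,
      ← integral_const_mul]
    refine integral_congr_ae (Eventually.of_forall fun t => ?_)
    simp only [directionWeight, ← hbdef]
    push_cast
    obtain ⟨m, rfl⟩ : ∃ m, n = m + 1 := ⟨n - 1, by omega⟩
    rw [Nat.add_sub_cancel, mul_pow, pow_succ]
    ring
  simp only [step]
  have hcont : Continuous fun p : Sphere n × ℝ => directionWeight N p.1 *
      ((p.2 : ℂ) ^ (n - 1) * (f (p.2 • direction N p.1) * g p.2)) :=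
    (hw.comp continuous_fst).mul (((Complex.continuous_ofReal.comp continuous_snd).pow _).mul
      ((hf.comp (continuous_snd.smul (hθ.comp continuous_fst))).mul (hg.comp continuous_snd)))
  rw [integral_integral_swap]
  · rw [intervalIntegral.integral_of_le hR]
    refine integral_congr_ae (Eventually.of_forall fun t => ?_)
    simp only [radial]
    rw [mul_assoc, ← integral_mul_const, ← integral_const_mul]
    refine integral_congr_ae (Eventually.of_forall fun x => ?_)
    ring
  · obtain ⟨C, hC⟩ := (isCompact_univ.prod (isCompact_Icc (a := r) (b := R))).exists_bound_of_continuousOn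
      hcont.continuousOn
    refine Integrable.of_bound hcont.aestronglyMeasurable C ?_
    have : (sphereMeasure n).prod (volume.restrict (Set.Ioc r R)) =
        ((sphereMeasure n).prod volume).restrict (Set.univ ×ˢ Set.Ioc r R) := by
      rw [← Measure.prod_restrict, Measure.restrict_univ]
    rw [this]
    refine (ae_restrict_iff' (MeasurableSet.univ.prod measurableSet_Ioc)).2
      (Eventually.of_forall fun p hp => hC p ⟨trivial, Set.Ioc_subset_Icc_self hp.2⟩)

lemma IsSmoothNorm.continuous_radial (hN : IsSmoothNorm N) {f : Space n → ℂ} (hf : Continuous f) :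
    Continuous (radial N f) := by
  refine ((Complex.continuous_ofReal).pow _).mul ?_
  have hcont : Continuous fun p : ℝ × Sphere n => directionWeight N p.2 *
      f (p.1 • direction N p.2) :=
    (hN.continuous_directionWeight.comp continuous_snd).mul
      (hf.comp (continuous_fst.smul (hN.continuous_direction.comp continuous_snd)))
  exact continuous_parametric_integral_of_continuous hcont isCompact_univ |>.congr fun t => by
    rw [Measure.restrict_univ]

end Polar

/-! ### Chen integrals as iterated integrals -/

section Chen

variable {n : ℕ} {N : Seminorm ℝ (Space n)}

/-- The domain of integration of Chen integrals. -/
def chenDomain (N : Seminorm ℝ (Space n)) (r R : ℝ) (k : ℕ) : Set (Fin k → Space n) :=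
  {ξ | (∀ i, r ≤ N (ξ i) ∧ N (ξ i) ≤ R) ∧ Antitone (fun i => N (ξ i))}

lemma isClosed_chenDomain (N : Seminorm ℝ (Space n)) (r R : ℝ) (k : ℕ) :
    IsClosed (chenDomain N r R k) := by
  have hc : ∀ i : Fin k, Continuous fun ξ : Fin k → Space n => N (ξ i) := fun i =>
    (continuous_seminorm N).comp (continuous_apply i)
  simp only [chenDomain, Antitone, Set.ofPred_and, Set.ofPred_forall]
  exact (isClosed_iInter fun i => (isClosed_le continuous_const (hc i)).inter
    (isClosed_le (hc i) continuous_const)).inter (isClosed_iInter fun i => isClosed_iInter fun j =>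
      isClosed_iInter fun _ => isClosed_le (hc j) (hc i))

lemma IsSmoothNorm.isCompact_chenDomain (hN : IsSmoothNorm N) (r R : ℝ) (k : ℕ) :
    IsCompact (chenDomain N r R k) :=
  (isCompact_univ_pi fun _ : Fin k => hN.isCompact R).of_isClosed_subset
    (isClosed_chenDomain N r R k) fun _ hξ i _ => (hξ.1 i).2

lemma IsSmoothNorm.integrableOn_chenDomain (hN : IsSmoothNorm N) (r R : ℝ) {k : ℕ}
    {σ : Fin k → Space n → ℂ} (hσ : ∀ i, Continuous (σ i)) :
    IntegrableOn (fun ξ => ∏ i, σ i (ξ i)) (chenDomain N r R k) := by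
  have : Continuous fun ξ : Fin k → Space n => ∏ i, σ i (ξ i) :=
    continuous_finsetProd _ fun i _ => (hσ i).comp (continuous_apply i)
  exact this.continuousOn.integrableOn_compact (hN.isCompact_chenDomain r R k)

lemma cons_mem_chenDomain {r R : ℝ} {k : ℕ} {ξ : Space n} {τ : Fin k → Space n} :
    (Fin.cons ξ τ : Fin (k + 1) → Space n) ∈ chenDomain N r R (k + 1) ↔
      (r ≤ N ξ ∧ N ξ ≤ R) ∧ τ ∈ chenDomain N r (N ξ) k := by
  constructor
  · rintro ⟨h1, h2⟩
    refine ⟨by simpa using h1 0, fun i => ⟨by simpa using (h1 i.succ).1, ?_⟩, fun i j hij => ?_⟩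
    · simpa using h2 (Fin.zero_le i.succ)
    · simpa using h2 (Fin.succ_le_succ_iff.2 hij)
  · rintro ⟨h1, h2, h3⟩
    refine ⟨fun i => ?_, fun i j hij => ?_⟩
    · refine Fin.cases ?_ (fun i => ?_) i
      · simpa using h1
      · simpa using ⟨(h2 i).1, (h2 i).2.trans h1.2⟩
    · revert hij
      refine Fin.cases (fun hij => ?_) (fun j => ?_) j
      · obtain rfl := Fin.le_zero_iff.1 hij
        exact le_rfl
      · refine Fin.cases (fun _ => ?_) (fun i hij => ?_) i
        · simpa using (h2 j).2
        · simpa using h3 (Fin.succ_le_succ_iff.1 hij)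

/-- Fubini, peeling off the variable of largest norm: the fibre of the domain over ξ is the Chen
domain with upper bound N ξ. -/
lemma IsSmoothNorm.chenIntegral_succ (hN : IsSmoothNorm N) (r R : ℝ) {k : ℕ}
    {σ : Fin (k + 1) → Space n → ℂ} (hσ : ∀ i, Continuous (σ i)) :
    chenIntegral N r R σ = ∫ ξ in {ξ | r ≤ N ξ ∧ N ξ ≤ R},
      σ 0 ξ * chenIntegral N r (N ξ) (fun i => σ i.succ) := by
  have hNc := continuous_seminorm N
  have hclosed : IsClosed {ξ : Space n | r ≤ N ξ ∧ N ξ ≤ R} :=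
    (isClosed_le continuous_const hNc).inter (isClosed_le hNc continuous_const)
  have hmp := (volume_preserving_piFinSuccAbove (fun _ : Fin (k + 1) => Space n) 0).symm
  have hm := (isClosed_chenDomain N r R (k + 1)).measurableSet
  have hint := (integrable_indicator_iff hm).2 (hN.integrableOn_chenDomain r R hσ)
  change ∫ ξ in chenDomain N r R (k + 1), ∏ i, σ i (ξ i) = _
  rw [← integral_indicator hm, ← integral_indicator hclosed.measurableSet, ← hmp.integral_comp',
    Measure.volume_eq_prod, integral_prod]
  · refine integral_congr_ae (Eventually.of_forall fun ξ => ?_)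
    have key : ∀ τ : Fin k → Space n,
        Set.indicator (chenDomain N r R (k + 1)) (fun ξ => ∏ i, σ i (ξ i))
          ((MeasurableEquiv.piFinSuccAbove (fun _ : Fin (k + 1) => Space n) 0).symm (ξ, τ)) =
        Set.indicator {ξ | r ≤ N ξ ∧ N ξ ≤ R} (fun ξ => σ 0 ξ *
          Set.indicator (chenDomain N r (N ξ) k) (fun τ => ∏ i, σ i.succ (τ i)) τ) ξ := by
      intro τ
      have e1 : (MeasurableEquiv.piFinSuccAbove (fun _ : Fin (k + 1) => Space n) 0).symm (ξ, τ) =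
          Fin.cons ξ τ := by
        simp [MeasurableEquiv.piFinSuccAbove, Fin.insertNthEquiv, Fin.insertNth_zero']
      rw [e1]
      by_cases h1 : r ≤ N ξ ∧ N ξ ≤ R
      · by_cases h2 : τ ∈ chenDomain N r (N ξ) k
        · rw [Set.indicator_of_mem (cons_mem_chenDomain.2 ⟨h1, h2⟩), Set.indicator_of_mem (by exact h1),
            Set.indicator_of_mem h2, Fin.prod_univ_succ]
          simp
        · rw [Set.indicator_of_notMem fun h => h2 (cons_mem_chenDomain.1 h).2,
            Set.indicator_of_mem (by exact h1), Set.indicator_of_notMem h2, mul_zero]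
      · rw [Set.indicator_of_notMem fun h => h1 (cons_mem_chenDomain.1 h).1,
          Set.indicator_of_notMem (by exact h1)]
    simp only [key]
    by_cases h1 : r ≤ N ξ ∧ N ξ ≤ R
    · simp only [Set.indicator_of_mem (show ξ ∈ {ξ : Space n | r ≤ N ξ ∧ N ξ ≤ R} from h1)]
      rw [integral_const_mul, integral_indicator (isClosed_chenDomain N r (N ξ) k).measurableSet]
      rfl
    · simp [Set.indicator_of_notMem (show ξ ∉ {ξ : Space n | r ≤ N ξ ∧ N ξ ≤ R} from h1)]
  · exact (hmp.integrable_comp_emb (MeasurableEquiv.measurableEmbedding _)).2 hint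

lemma chenIntegral_zero (r R : ℝ) (σ : Fin 0 → Space n → ℂ) : chenIntegral N r R σ = 1 := by
  have : {ξ : Fin 0 → Space n | (∀ i, r ≤ N (ξ i) ∧ N (ξ i) ≤ R) ∧ Antitone (fun i => N (ξ i))} =
      Set.univ := Set.eq_univ_of_forall fun ξ => ⟨fun i => i.elim0, fun i => i.elim0⟩
  rw [chenIntegral, this, Measure.restrict_univ]
  simp [integral_unique, Measure.real, volume_pi]

lemma IsSmoothNorm.chenIntegral_eq_iterInt (hN : IsSmoothNorm N) (hn : 0 < n) {r R : ℝ}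
    (hr : 0 ≤ r) (hR : r ≤ R) {k : ℕ} {σ : Fin k → Space n → ℂ} (hσ : ∀ i, Continuous (σ i)) :
    chenIntegral N r R σ = iterInt r (List.ofFn fun i => radial N (σ i)) R := by
  induction k generalizing R with
  | zero => simp [chenIntegral_zero, iterInt]
  | succ k ih =>
    have hm : MeasurableSet {ξ : Space n | r ≤ N ξ ∧ N ξ ≤ R} :=
      ((isClosed_le continuous_const (continuous_seminorm N)).inter
        (isClosed_le (continuous_seminorm N) continuous_const)).measurableSet
    rw [hN.chenIntegral_succ r R hσ, List.ofFn_succ, iterInt,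
      setIntegral_congr_fun hm fun ξ hξ => by rw [ih hξ.1 fun i => hσ i.succ]]
    refine hN.integral_shell hn (hσ 0) (continuous_iterInt ?_) hr hR
    simp only [List.mem_ofFn]
    rintro _ ⟨i, rfl⟩
    exact hN.continuous_radial (hσ i.succ)

lemma IsSmoothNorm.cutoffChen_eq (hN : IsSmoothNorm N) (hn : 0 < n) {r : ℝ}
    (hr : 0 ≤ r) {k : ℕ} {σ : Fin k → Space n → ℂ} (hσ : ∀ i, Continuous (σ i)) (c : ℂ) :
    HasFinitePart (fun R => chenIntegral N r R σ) c ↔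
      HasFinitePart (iterInt r (List.ofFn fun i => radial N (σ i))) c := by
  have h : (fun R => chenIntegral N r R σ) =ᶠ[atTop]
      iterInt r (List.ofFn fun i => radial N (σ i)) :=
    (eventually_ge_atTop r).mono fun R hR => hN.chenIntegral_eq_iterInt hn hr hR hσ
  exact ⟨fun H => H.congr h, fun H => H.congr h.symm⟩

lemma cutoffIntegral_eq_cutoffChen (r : ℝ) (f : Space n → ℂ) :
    cutoffIntegral N r f = cutoffChen N r ![f] := by
  unfold cutoffIntegral cutoffChen chenIntegral
  congr 1
  funext R
  have hmp := volume_preserving_funUnique (Fin 1) (Space n)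
  have hemb := (MeasurableEquiv.funUnique (Fin 1) (Space n)).measurableEmbedding
  rw [← hmp.setIntegral_preimage_emb hemb]
  have : (MeasurableEquiv.funUnique (Fin 1) (Space n)) ⁻¹' {ξ | r ≤ N ξ ∧ N ξ ≤ R} =
      {ξ : Fin 1 → Space n | (∀ i, r ≤ N (ξ i) ∧ N (ξ i) ≤ R) ∧ Antitone (fun i => N (ξ i))} := by
    ext ξ
    simp [Subsingleton.antitone]
  rw [this]
  simp
  rfl

end Chen

/-! ### Spherical means of symbols and of holomorphic families -/

section HolomorphicFamily

variable {n : ℕ} {W : Set ℂ} {U : Set (Space n)} {f : ℂ → Space n → ℂ}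

lemma IsHolomorphicFamily.exists_tendstoUniformlyOn (hf : IsHolomorphicFamily W U f) {z₀ : ℂ}
    (hz₀ : z₀ ∈ W) : ∃ ρ : ℝ, 0 < ρ ∧ Metric.ball z₀ ρ ⊆ W ∧
      ∃ c : ℕ → Space n → ℂ, (∀ k, ContinuousOn (c k) U) ∧
        ∀ L : Set ℂ, L ⊆ Metric.ball z₀ ρ → IsCompact L →
        ∀ K : Set (Space n), K ⊆ U → IsCompact K → TendstoUniformlyOn
          (fun (M : ℕ) (p : ℂ × Space n) => ∑ k ∈ Finset.range M, (p.1 - z₀) ^ k * c k p.2)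
          (fun p => f p.1 p.2) atTop (L ×ˢ K) := by
  obtain ⟨ρ, hρ, hball, c, hc, h⟩ := hf.2 z₀ hz₀
  refine ⟨ρ, hρ, hball, c, fun k => (hc k).continuousOn, fun L hL hLc K hK hKc => ?_⟩
  have := h L hL hLc K hK hKc 0
  simp only [iteratedFDeriv_zero_eq_comp] at this
  rw [Metric.tendstoUniformlyOn_iff] at this ⊢
  refine fun ε hε => (this ε hε).mono fun M hM p hp => ?_
  simpa only [Function.comp, LinearIsometryEquiv.dist_map] using hM p hp

lemma IsHolomorphicFamily.differentiableOn (hf : IsHolomorphicFamily W U f) {ξ : Space n}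
    (hξ : ξ ∈ U) : DifferentiableOn ℂ (fun z => f z ξ) W := by
  intro z₀ hz₀
  obtain ⟨ρ, hρ, hball, c, hc, h⟩ := hf.exists_tendstoUniformlyOn hz₀
  have h1 : TendstoLocallyUniformlyOn
      (fun (M : ℕ) (z : ℂ) => ∑ k ∈ Finset.range M, (z - z₀) ^ k * c k ξ) (fun z => f z ξ) atTop
      (Metric.ball z₀ ρ) := by
    rw [tendstoLocallyUniformlyOn_iff_forall_isCompact Metric.isOpen_ball]
    intro L hL hLc
    have := h L hL hLc {ξ} (by simpa using hξ) isCompact_singleton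
    rw [Metric.tendstoUniformlyOn_iff] at this ⊢
    exact fun ε hε => (this ε hε).mono fun M hM z hz => hM (z, ξ) ⟨hz, rfl⟩
  have h2 : DifferentiableOn ℂ (fun z => f z ξ) (Metric.ball z₀ ρ) := by
    refine h1.differentiableOn (Eventually.of_forall fun M => ?_) Metric.isOpen_ball
    fun_prop
  exact (h2.differentiableAt (Metric.ball_mem_nhds z₀ hρ)).differentiableWithinAt

lemma IsHolomorphicFamily.continuousOn (hf : IsHolomorphicFamily W U f) (hU : IsOpen U) :
    ContinuousOn (fun p : ℂ × Space n => f p.1 p.2) (W ×ˢ U) := by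
  rintro ⟨z₀, ξ₀⟩ ⟨hz₀, hξ₀⟩
  obtain ⟨ρ, hρ, hball, c, hc, h⟩ := hf.exists_tendstoUniformlyOn hz₀
  obtain ⟨K, hKc, hK⟩ := exists_compact_subset hU hξ₀
  have h1 := h (Metric.closedBall z₀ (ρ / 2)) (Metric.closedBall_subset_ball (half_lt_self hρ))
    (isCompact_closedBall _ _) K hK.2 hKc
  have h2 : ContinuousOn (fun p : ℂ × Space n => f p.1 p.2)
      (Metric.closedBall z₀ (ρ / 2) ×ˢ K) := by
    refine h1.continuousOn (Frequently.of_forall fun M => ?_)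
    refine continuousOn_finsetSum _ fun k _ => ContinuousOn.mul (by fun_prop) ?_
    exact ((hc k).mono hK.2).comp continuousOn_snd fun p hp => hp.2
  exact (h2.continuousAt (prod_mem_nhds (Metric.closedBall_mem_nhds _ (half_pos hρ))
    (mem_interior_iff_mem_nhds.1 hK.1))).continuousWithinAt

lemma IsHolomorphicFamily.exists_bound (hf : IsHolomorphicFamily W U f) (hU : IsOpen U)
    {L : Set ℂ} (hL : L ⊆ W) (hLc : IsCompact L) {K : Set (Space n)} (hK : K ⊆ U)
    (hKc : IsCompact K) : ∃ C : ℝ, ∀ z ∈ L, ∀ ξ ∈ K, ‖f z ξ‖ ≤ C := by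
  obtain ⟨C, hC⟩ := (hLc.prod hKc).exists_bound_of_continuousOn
    ((hf.continuousOn hU).mono (Set.prod_mono hL hK))
  exact ⟨C, fun z hz ξ hξ => hC (z, ξ) ⟨hz, hξ⟩⟩

end HolomorphicFamily

section Radial

variable {n : ℕ} {N : Seminorm ℝ (Space n)}

/-- The integral over the unit sphere of `N` of a homogeneous function. -/
def sphereIntegral (N : Seminorm ℝ (Space n)) (a : Space n → ℂ) : ℂ :=
  ∫ x, directionWeight N x * a (direction N x) ∂sphereMeasure n

/-- The exponents in the expansion of the spherical mean of a symbol of order `β`. -/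
def exponents (n : ℕ) (β : ℂ) : Set ℂ := Set.range fun j : ℕ => β - j + ((n - 1 : ℕ) : ℂ)

lemma integrable_sphere_of_continuous {g : Sphere n → ℂ} (hg : Continuous g) :
    Integrable g (sphereMeasure n) := by
  obtain ⟨C, hC⟩ := isCompact_univ.exists_bound_of_continuousOn hg.continuousOn
  exact Integrable.of_bound hg.aestronglyMeasurable C (Eventually.of_forall fun x => hC x trivial)

lemma IsSmoothNorm.continuous_comp_direction (hN : IsSmoothNorm N) {a : Space n → ℂ}
    (ha : ContinuousOn a {0}ᶜ) {t : ℝ} (ht : t ≠ 0) :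
    Continuous fun x => directionWeight N x * a (t • direction N x) :=
  hN.continuous_directionWeight.mul (ha.comp_continuous (hN.continuous_direction.const_smul t)
    fun x => smul_ne_zero ht (hN.direction_ne_zero x))

lemma norm_radial_le {f : Space n → ℂ} {t b : ℝ} (hN : IsSmoothNorm N) (ht : 0 ≤ t)
    (hb : ∀ x, ‖f (t • direction N x)‖ ≤ b) :
    ‖radial N f t‖ ≤ t ^ (n - 1) * ((∫ x, ‖directionWeight N x‖ ∂sphereMeasure n) * b) := by
  rw [radial, norm_mul, norm_pow, Complex.norm_real, Real.norm_of_nonneg ht]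
  refine mul_le_mul_of_nonneg_left ?_ (by positivity)
  rw [← integral_mul_const]
  refine norm_integral_le_of_norm_le
    ((integrable_sphere_of_continuous hN.continuous_directionWeight).norm.mul_const b)
    (Eventually.of_forall fun x => ?_)
  rw [norm_mul]
  exact mul_le_mul_of_nonneg_left (hb x) (norm_nonneg _)

lemma IsSmoothNorm.radial_sub_sum (hN : IsSmoothNorm N) {f : Space n → ℂ}
    (hf : ContinuousOn f {0}ᶜ) {α : ℂ} {a : ℕ → Space n → ℂ} {s : Finset ℕ}
    (ha : ∀ j ∈ s, IsPosHomogeneous (α - j) (a j)) {t : ℝ} (ht : 0 < t) :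
    radial N f t - ∑ j ∈ s, sphereIntegral N (a j) * (t : ℂ) ^ (α - j + ((n - 1 : ℕ) : ℂ)) =
      radial N (fun ξ => f ξ - ∑ j ∈ s, a j ξ) t := by
  have h1 : ∀ j ∈ s, sphereIntegral N (a j) * (t : ℂ) ^ (α - j + ((n - 1 : ℕ) : ℂ)) =
      (t : ℂ) ^ (n - 1) * ∫ x, directionWeight N x * a j (t • direction N x) ∂sphereMeasure n := by
    intro j hj
    rw [Complex.cpow_add _ _ (by exact_mod_cast ht.ne'), Complex.cpow_natCast, sphereIntegral,
      mul_comm ((t : ℂ) ^ (α - j)), mul_left_comm, ← integral_mul_const]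
    congr 1
    refine integral_congr_ae (Eventually.of_forall fun x => ?_)
    beta_reduce
    rw [(ha j hj).2 t ht _ (hN.direction_ne_zero x)]
    ring
  rw [Finset.sum_congr rfl h1, ← Finset.mul_sum, radial, radial, ← mul_sub,
    ← integral_finsetSum, ← integral_sub]
  · congr 1
    refine integral_congr_ae (Eventually.of_forall fun x => ?_)
    simp only [mul_sub, Finset.mul_sum]
  · exact integrable_sphere_of_continuous (hN.continuous_comp_direction hf ht.ne')
  · exact integrable_finsetSum _ fun j hj =>
      integrable_sphere_of_continuous (hN.continuous_comp_direction (ha j hj).1.continuousOn ht.ne')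
  · exact fun j hj =>
      integrable_sphere_of_continuous (hN.continuous_comp_direction (ha j hj).1.continuousOn ht.ne')

lemma radial_add (hN : IsSmoothNorm N) {f g : Space n → ℂ} (hf : Continuous f)
    (hg : Continuous g) : radial N (f + g) = radial N f + radial N g := by
  funext t
  have h : ∀ {f : Space n → ℂ}, Continuous f → Integrable
      (fun x => directionWeight N x * f (t • direction N x)) (sphereMeasure n) := fun hf =>
    integrable_sphere_of_continuous (hN.continuous_directionWeight.mul
      (hf.comp (hN.continuous_direction.const_smul t)))
  simp only [radial, Pi.add_apply, mul_add]
  rw [integral_add (h hf) (h hg), mul_add]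

lemma radial_smul (c : ℂ) (f : Space n → ℂ) : radial N (c • f) = c • radial N f := by
  funext t
  simp only [radial, Pi.smul_apply, smul_eq_mul, mul_left_comm _ c]
  rw [integral_const_mul, mul_left_comm]

lemma radial_zero : radial N (0 : Space n → ℂ) = 0 := by
  funext t
  simp [radial]

lemma radial_sum (hN : IsSmoothNorm N) {ι : Type*} {s : Finset ι} {f : ι → Space n → ℂ}
    (hf : ∀ i ∈ s, Continuous (f i)) : radial N (∑ i ∈ s, f i) = ∑ i ∈ s, radial N (f i) := by
  classical
  induction s using Finset.induction_on with
  | empty => simp [radial_zero]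
  | insert i s hi ih =>
    have h1 : ∀ j ∈ s, Continuous (f j) := fun j hj => hf j (Finset.mem_insert_of_mem hj)
    rw [Finset.sum_insert hi, Finset.sum_insert hi, radial_add hN (hf i (Finset.mem_insert_self _ _)),
      ih h1]
    have : (∑ j ∈ s, f j) = fun ξ => ∑ j ∈ s, f j ξ := by
      funext ξ
      simp
    rw [this]
    exact continuous_finsetSum _ h1

lemma HasSymbolExpansion.hasExpansion_radial (hN : IsSmoothNorm N) {α : ℂ} {f : Space n → ℂ}
    {a : ℕ → Space n → ℂ} (h : HasSymbolExpansion N α f a) (hf : Continuous f) (M : ℝ) :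
    HasExpansion (exponents n α) M (radial N f) := by
  -- The first bound makes the exponent Re α − J − 1 negative, so that 1 + t may be replaced by t.
  -- The second absorbs the factor t^(n−1) and leaves the precision M.
  obtain ⟨J, hJ⟩ := exists_nat_gt (max (α.re - 1) (α.re - 1 + (n - 1 : ℕ) + M))
  have hJ1 := (le_max_left _ _).trans_lt hJ
  have hJ2 := (le_max_right _ _).trans_lt hJ
  obtain ⟨C, hC⟩ := h.2 J 0
  refine ⟨fun t => ∑ j ∈ Finset.range (J + 1),
    sphereIntegral N (a j) * (t : ℂ) ^ (α - j + ((n - 1 : ℕ) : ℂ)), ?_,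
    IsBigO.of_bound ((∫ x, ‖directionWeight N x‖ ∂sphereMeasure n) * |C|)
    ((eventually_ge_atTop 1).mono fun t ht => ?_)⟩
  · have : (fun t : ℝ => ∑ j ∈ Finset.range (J + 1),
        sphereIntegral N (a j) * (t : ℂ) ^ (α - j + ((n - 1 : ℕ) : ℂ))) =
        ∑ j ∈ Finset.range (J + 1),
          sphereIntegral N (a j) • logPower (α - j + ((n - 1 : ℕ) : ℂ), 0) := by
      funext t
      simp [logPower]
    rw [this]
    exact sum_mem fun j _ => Submodule.smul_mem _ _ (logPower_mem ⟨j, rfl⟩)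
  · have ht0 : 0 < t := by linarith
    rw [hN.radial_sub_sum hf.continuousOn (fun j _ => h.1 j) ht0]
    refine (norm_radial_le hN ht0.le (b := |C| * t ^ (α.re - J - 1)) fun x => ?_).trans ?_
    · have hx : N (t • direction N x) = t := by rw [hN.norm_smul_direction, abs_of_pos ht0]
      have := hC (t • direction N x) (by rw [hx]; exact ht)
      rw [norm_iteratedFDeriv_zero, hx] at this
      refine this.trans (mul_le_mul (le_abs_self C) ?_ (by positivity) (abs_nonneg _))
      simp only [CharP.cast_eq_zero, sub_zero]
      exact Real.rpow_le_rpow_of_nonpos ht0 (by linarith) (by linarith)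
    · rw [Real.norm_of_nonneg (by positivity), ← mul_assoc _ |C|, mul_left_comm,
        ← Real.rpow_natCast, ← Real.rpow_add ht0]
      refine mul_le_mul_of_nonneg_left (Real.rpow_le_rpow_of_exponent_le ht (by linarith)) ?_
      exact mul_nonneg (integral_nonneg fun _ => norm_nonneg _) (abs_nonneg _)

/-- Comparing the sum at 2t with 2^(γ−i) times the sum at t eliminates the i-th term and multiplies
A_j by 2^(γ−j) − 2^(γ−i), which never vanishes for j ≠ i. Induction applies to the remaining terms.
-/
lemma differentiableOn_of_sum_mul_cpow {V : Set ℂ} {γ : ℂ → ℂ} (hγ : DifferentiableOn ℂ γ V)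
    {s : Finset ℕ} {A : ℕ → ℂ → ℂ}
    (h : ∀ t : ℝ, 0 < t → DifferentiableOn ℂ (fun z => ∑ j ∈ s, A j z * (t : ℂ) ^ (γ z - j)) V) :
    ∀ j ∈ s, DifferentiableOn ℂ (A j) V := by
  induction s using Finset.induction_on generalizing A with
  | empty => simp
  | insert i s hi ih =>
    have hpow : ∀ j : ℕ, DifferentiableOn ℂ (fun z => (2 : ℂ) ^ (γ z - j)) V := fun j =>
      (hγ.sub_const _).const_cpow (Or.inl two_ne_zero)
    have h1 : ∀ j ∈ s, DifferentiableOn ℂ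
        (fun z => A j z * ((2 : ℂ) ^ (γ z - j) - (2 : ℂ) ^ (γ z - i))) V := by
      refine ih fun t ht => ?_
      refine ((h (2 * t) (by positivity)).sub ((hpow i).mul (h t ht))).congr fun z _ => ?_
      simp only [Pi.sub_apply, Pi.mul_apply]
      have e : ∀ j : ℕ, ((2 * t : ℝ) : ℂ) ^ (γ z - j) = (2 : ℂ) ^ (γ z - j) * (t : ℂ) ^ (γ z - j) :=
        fun j => by
          rw [Complex.ofReal_mul, Complex.mul_cpow_ofReal_nonneg (by norm_num) ht.le]
          simp
      rw [Finset.sum_insert hi, Finset.sum_insert hi, mul_add, Finset.mul_sum, add_sub_add_comm,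
        ← Finset.sum_sub_distrib, e i]
      rw [show A i z * ((2 : ℂ) ^ (γ z - i) * (t : ℂ) ^ (γ z - i)) -
        (2 : ℂ) ^ (γ z - i) * (A i z * (t : ℂ) ^ (γ z - i)) = 0 by ring, zero_add]
      refine Finset.sum_congr rfl fun j _ => ?_
      rw [e j]
      ring
    have h2 : ∀ j ∈ s, DifferentiableOn ℂ (A j) V := fun j hj => by
      have hne : ∀ z, (2 : ℂ) ^ (γ z - j) - (2 : ℂ) ^ (γ z - i) ≠ 0 := fun z => by
        rw [sub_ne_zero]
        intro he
        rw [Complex.cpow_sub _ _ two_ne_zero, Complex.cpow_sub _ _ two_ne_zero,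
          Complex.cpow_natCast, Complex.cpow_natCast] at he
        have h0 : (2 : ℂ) ^ γ z ≠ 0 := by simp [Complex.cpow_eq_zero_iff]
        have h3 : (2 : ℂ) ^ j = 2 ^ i := by
          field_simp at he
          exact he.symm
        have h4 : (2 : ℕ) ^ j = 2 ^ i := by exact_mod_cast h3
        exact hi (Nat.pow_right_injective le_rfl h4 ▸ hj)
      refine ((h1 j hj).div ((hpow j).sub (hpow i)) fun z _ => hne z).congr fun z _ => ?_
      simp only [Pi.div_apply, Pi.sub_apply]
      rw [mul_div_cancel_right₀ _ (hne z)]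
    intro j hj
    rcases Finset.mem_insert.1 hj with rfl | hj
    · refine ((h 1 one_pos).sub (DifferentiableOn.fun_sum h2)).congr fun z _ => ?_
      simp [Finset.sum_insert hi]
    · exact h2 j hj

lemma IsHolomorphicFamily.differentiableOn_radial (hN : IsSmoothNorm N) {W : Set ℂ}
    (hW : IsOpen W) {U : Set (Space n)} (hU : IsOpen U) {f : ℂ → Space n → ℂ}
    (hf : IsHolomorphicFamily W U f) {t : ℝ} (ht : ∀ x, t • direction N x ∈ U) :
    DifferentiableOn ℂ (fun z => radial N (f z) t) W := by
  intro z₀ hz₀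
  obtain ⟨δ, hδ, hball⟩ := Metric.isOpen_iff.1 hW z₀ hz₀
  have hdir : Continuous fun x => t • direction N x := hN.continuous_direction.const_smul t
  have hsub : Metric.ball z₀ (δ / 2) ⊆ W := (Metric.ball_subset_ball (by linarith)).trans hball
  obtain ⟨C, hC⟩ := hf.exists_bound hU
    ((Metric.closedBall_subset_ball (half_lt_self hδ)).trans hball) (isCompact_closedBall _ _)
    (K := Set.range fun x => t • direction N x) (by rintro _ ⟨x, rfl⟩; exact ht x)
    (isCompact_range hdir)
  have h1 : DifferentiableOn ℂ (fun z => radial N (f z) t) (Metric.ball z₀ (δ / 2)) := by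
    refine DifferentiableOn.const_mul ?_ _
    refine differentiableOn_integral_of_dominated Metric.isOpen_ball
      (g := fun x => ‖directionWeight N x‖ * C) (fun z hz => ?_) (Eventually.of_forall fun x => ?_)
      (Eventually.of_forall fun x z hz => ?_)
      ((integrable_sphere_of_continuous hN.continuous_directionWeight).norm.mul_const C)
    · exact (hN.continuous_directionWeight.mul ((hf.1 z (hsub hz)).continuousOn.comp_continuous
        hdir ht)).aestronglyMeasurable
    · exact ((hf.differentiableOn (ht x)).mono hsub).const_mul _
    · rw [norm_mul]
      exact mul_le_mul_of_nonneg_left (hC z (Metric.ball_subset_closedBall hz) _ ⟨x, rfl⟩)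
        (norm_nonneg _)
  exact (h1.differentiableAt (Metric.ball_mem_nhds _ (half_pos hδ))).differentiableWithinAt

/-- A simple family has f and its remainders holomorphic in z, but nothing is required of the
individual homogeneous terms. Their spherical integrals are nevertheless holomorphic: the radial
function of f minus that of the remainder is holomorphic at each t, and
`differentiableOn_of_sum_mul_cpow` separates the coefficients. -/
lemma IsSimpleHolomorphicFamily.exists_isRadialFamily (hN : IsSmoothNorm N) {W : Set ℂ}
    (hW : IsOpen W) {α : ℂ → ℂ} {f : ℂ → Space n → ℂ} (hf : IsSimpleHolomorphicFamily N W α f)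
    {z₀ : ℂ} (hz₀ : z₀ ∈ W) :
    ∃ B : ℝ, ∀ M : ℝ, ∃ V : Set ℂ, IsOpen V ∧ z₀ ∈ V ∧
      IsRadialFamily V (fun z => exponents n (α z)) B M (fun z => radial N (f z)) := by
  obtain ⟨hα, hfam, a, ha, hrem⟩ := hf
  refine ⟨(α z₀).re + 1 + (n - 1 : ℕ), fun M => ?_⟩
  have hαc : ContinuousAt α z₀ := hα.continuousOn.continuousAt (hW.mem_nhds hz₀)
  have hev : ∀ᶠ z in 𝓝 z₀, z ∈ W ∧ (α z).re < (α z₀).re + 1 :=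
    (hW.eventually_mem hz₀).and
      ((Complex.continuous_re.continuousAt.comp hαc).eventually_lt continuousAt_const (by simp))
  obtain ⟨δ, hδ, hball⟩ := Metric.eventually_nhds_iff_ball.1 hev
  set L := Metric.closedBall z₀ (δ / 2) with hL
  have hLb : ∀ z ∈ L, z ∈ W ∧ (α z).re < (α z₀).re + 1 := fun z hz =>
    hball z (Metric.closedBall_subset_ball (half_lt_self hδ) hz)
  have hLW : L ⊆ W := fun z hz => (hLb z hz).1
  have hLc : IsCompact L := isCompact_closedBall _ _
  set V := Metric.ball z₀ (δ / 2) with hV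
  have hVL : V ⊆ L := Metric.ball_subset_closedBall
  have hVW : V ⊆ W := hVL.trans hLW
  -- The surplus n − 1 pays for the factor t^(n−1) of `radial`, and the surplus 1 for the loss ε = 1
  -- in the remainder estimate.
  obtain ⟨M', hM'⟩ := exists_nat_ge (M + 1 + (n - 1 : ℕ))
  obtain ⟨K, rem, hremdef, hremfam, -, hremb⟩ := hrem M' L hLW hLc
  have hremeq : ∀ z, rem z = fun ξ => f z ξ - ∑ j ∈ Finset.range (K + 1), a j z ξ := fun z =>
    funext (hremdef z)
  set s := Finset.range (K + 1)
  have hfc : ∀ z ∈ W, Continuous (f z) := fun z hz =>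
    continuousOn_univ.1 (hfam.1 z hz).continuousOn
  have hexp : ∀ z ∈ W, ∀ t : ℝ, 0 < t → radial N (f z) t - ∑ j ∈ s, sphereIntegral N (a j z) *
      (t : ℂ) ^ (α z - j + ((n - 1 : ℕ) : ℂ)) = radial N (rem z) t := fun z hz t ht => by
    rw [hremeq z]
    exact hN.radial_sub_sum (hfc z hz).continuousOn (fun j _ => (ha z hz).1 j) ht
  have hA : ∀ j ∈ s, DifferentiableOn ℂ (fun z => sphereIntegral N (a j z)) W := by
    refine differentiableOn_of_sum_mul_cpow (γ := fun z => α z + ((n - 1 : ℕ) : ℂ))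
      (hα.add_const _) fun t ht => ?_
    refine ((hfam.differentiableOn_radial hN hW isOpen_univ (t := t) fun x => trivial).sub
      (hremfam.differentiableOn_radial hN hW isOpen_compl_singleton fun x =>
        smul_ne_zero ht.ne' (hN.direction_ne_zero x))).congr fun z hz => ?_
    rw [Pi.sub_apply, ← hexp z hz t ht, sub_sub_cancel]
    refine Finset.sum_congr rfl fun j _ => ?_
    rw [add_sub_right_comm]
  have hbound : ∀ g : ℂ → ℂ, DifferentiableOn ℂ g W → ∃ C, ∀ z ∈ L, ‖g z‖ ≤ C := fun g hg =>
    hLc.exists_bound_of_continuousOn (hg.continuousOn.mono hLW)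
  obtain ⟨Cα, hCα⟩ := hbound α hα
  have hCA : ∃ C : ℝ, ∀ j ∈ s, ∀ z ∈ L, ‖sphereIntegral N (a j z)‖ ≤ C := by
    choose! C hC using fun j (hj : j ∈ s) => hbound _ (hA j hj)
    exact ⟨∑ j ∈ s, |C j|, fun j hj z hz => (hC j hj z hz).trans ((le_abs_self _).trans
      (Finset.single_le_sum (f := fun j => |C j|) (fun _ _ => abs_nonneg _) hj))⟩
  obtain ⟨CA, hCA⟩ := hCA
  obtain ⟨T, hT⟩ := hremb 0 0 1 one_pos 1 one_pos
  set w := ∫ x, ‖directionWeight N x‖ ∂sphereMeasure n with hw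
  have hw0 : 0 ≤ w := integral_nonneg fun _ => norm_nonneg _
  refine ⟨V, Metric.isOpen_ball, Metric.mem_ball_self (half_pos hδ), ?_, ?_, ?_, ?_⟩
  · exact fun z hz => hN.continuous_radial (hfc z (hVW hz))
  · exact fun t => (hfam.differentiableOn_radial hN hW isOpen_univ fun x => trivial).mono hVW
  · intro T'
    have hc : Continuous fun p : ℝ × Sphere n => p.1 • direction N p.2 :=
      continuous_fst.smul (hN.continuous_direction.comp continuous_snd)
    obtain ⟨C, hC⟩ := hfam.exists_bound isOpen_univ hLW hLc
      (K := (fun p : ℝ × Sphere n => p.1 • direction N p.2) '' (Set.Icc (-T') T' ×ˢ Set.univ))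
      (Set.subset_univ _) ((isCompact_Icc.prod isCompact_univ).image hc)
    have hint := integrable_sphere_of_continuous hN.continuous_directionWeight
    refine ⟨|T'| ^ (n - 1) * (w * |C|), fun z hz t ht => ?_⟩
    rw [radial, norm_mul, norm_pow, Complex.norm_real, Real.norm_eq_abs]
    refine mul_le_mul (pow_le_pow_left₀ (abs_nonneg _) (ht.trans (le_abs_self _)) _) ?_
      (norm_nonneg _) (by positivity)
    rw [hw, ← integral_mul_const]
    refine norm_integral_le_of_norm_le (hint.norm.mul_const _) (Eventually.of_forall fun x => ?_)
    rw [norm_mul]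
    exact mul_le_mul_of_nonneg_left ((hC z (hVL hz) _
      ⟨(t, x), ⟨abs_le.1 ht, trivial⟩, rfl⟩).trans (le_abs_self C)) (norm_nonneg _)
  · refine ⟨Fin (K + 1), inferInstance, fun j z => α z - (j : ℕ) + ((n - 1 : ℕ) : ℂ),
      fun j z => sphereIntegral N (a j z), |Cα| + K + (n - 1 : ℕ) + |CA| + w, max T 1, by positivity,
      le_max_right _ _, fun j => ⟨((hα.mono hVW).sub_const _).add_const _,
        (hA j (Finset.mem_range.2 j.2)).mono hVW⟩, fun z hz j => ⟨⟨j, rfl⟩, ?_, ?_, ?_⟩,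
      fun z hz t ht => ?_⟩
    · simp only [Complex.add_re, Complex.sub_re, Complex.natCast_re]
      have := (hLb z (hVL hz)).2
      have hj : (0 : ℝ) ≤ ((j : ℕ) : ℝ) := Nat.cast_nonneg _
      linarith
    · refine (norm_add_le _ _).trans ?_
      refine (add_le_add (norm_sub_le _ _) le_rfl).trans ?_
      rw [Complex.norm_natCast, Complex.norm_natCast]
      have h1 := (hCα z (hVL hz)).trans (le_abs_self _)
      have h2 : ((j : ℕ) : ℝ) ≤ K := by exact_mod_cast Nat.lt_succ_iff.1 j.2
      have h3 := abs_nonneg CA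
      linarith
    · have h1 := (hCA j (Finset.mem_range.2 j.2) z (hVL hz)).trans (le_abs_self _)
      have h2 := abs_nonneg Cα
      have h3 : (0 : ℝ) ≤ K := Nat.cast_nonneg _
      have h4 : (0 : ℝ) ≤ (n - 1 : ℕ) := Nat.cast_nonneg _
      linarith
    · have ht1 : 1 ≤ t := (le_max_right _ _).trans ht
      have ht0 : 0 < t := by linarith
      have hsum := Finset.sum_range (n := K + 1) fun j => sphereIntegral N (a j z) *
        (t : ℂ) ^ (α z - j + ((n - 1 : ℕ) : ℂ))
      rw [← hsum, hexp z (hVW hz) t ht0]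
      refine (norm_radial_le hN ht0.le (b := t ^ (-(M' : ℝ) + 1)) fun x => ?_).trans ?_
      · have hx : N (t • direction N x) = t := by rw [hN.norm_smul_direction, abs_of_pos ht0]
        have := hT z (hVL hz) (t • direction N x) (by rw [hx]; exact (le_max_left _ _).trans ht)
        rw [norm_iteratedFDeriv_zero, hx] at this
        simpa using this
      · rw [mul_left_comm, ← Real.rpow_natCast, ← Real.rpow_add ht0]
        have h1 : t ^ (((n - 1 : ℕ) : ℝ) + (-(M' : ℝ) + 1)) ≤ t ^ (-M) :=
          Real.rpow_le_rpow_of_exponent_le ht1 (by linarith)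
        refine mul_le_mul ?_ h1 (by positivity) (by positivity)
        have h2 := abs_nonneg Cα
        have h3 : (0 : ℝ) ≤ K := Nat.cast_nonneg _
        have h4 : (0 : ℝ) ≤ (n - 1 : ℕ) := Nat.cast_nonneg _
        have h5 := abs_nonneg CA
        linarith

end Radial

/-! ### Words, shuffles and deconcatenation in the tensor algebra. -/

variable {V : Type} [AddCommGroup V] [Module ℂ V]

/-- The tensor `v₁ ⊗ ⋯ ⊗ v_k` of a word `[v₁, …, v_k]`. -/
def word (l : List V) : Tensors V := pureTensor l.get

lemma pureTensor_congr {k k' : ℕ} (h : k = k') {v : Fin k → V} {v' : Fin k' → V}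
    (hv : ∀ i, v i = v' (Fin.cast h i)) : pureTensor v = pureTensor v' := by
  subst h
  exact congrArg pureTensor (funext hv)

lemma word_ofFn {k : ℕ} (v : Fin k → V) : word (List.ofFn v) = pureTensor v :=
  pureTensor_congr (List.length_ofFn (f := v)) fun i => by rw [List.get_ofFn]

lemma linearMap_ext_word {M : Type*} [AddCommGroup M] [Module ℂ M] {f g : Tensors V →ₗ[ℂ] M}
    (h : ∀ l, f (word l) = g (word l)) : f = g := by
  refine DirectSum.linearMap_ext ℂ fun k => PiTensorProduct.ext (MultilinearMap.ext fun v => ?_)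
  have := h (List.ofFn v)
  rwa [word_ofFn] at this

lemma nodup_shuffles {α : Type*} {u v : List α} (h : (u ++ v).Nodup) : (shuffles u v).Nodup := by
  induction u, v using shuffles_induction with
  | nil_left v => simp [shuffles_nil_left]
  | nil_right u => simp [shuffles_nil_right]
  | cons_cons a u b v h1 h2 =>
    rw [shuffles_cons_cons, List.nodup_append]
    refine ⟨(h1 (List.nodup_cons.1 h).2).map List.cons_injective,
      (h2 (List.nodup_middle.1 h).of_cons).map List.cons_injective, ?_⟩
    intro x hx y hy hxy
    obtain ⟨x', -, rfl⟩ := List.mem_map.1 hx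
    obtain ⟨y', -, rfl⟩ := List.mem_map.1 hy
    have hab : a = b := (List.cons.inj hxy).1
    simp [hab] at h

/-- For distinct letters this turns the recursive description into one by order, as in `IsShuffle`.
In the converse direction w must start with the head of u or of v: any other first letter would
occur again later in w. -/
lemma mem_shuffles_iff {α : Type*} {u v w : List α} (h : (u ++ v).Nodup) :
    w ∈ shuffles u v ↔ w.Perm (u ++ v) ∧ u.Sublist w ∧ v.Sublist w := by
  constructor
  · intro hw
    refine ⟨perm_of_mem_shuffles hw, ?_⟩
    clear h
    induction u, v using shuffles_induction generalizing w with
    | nil_left v => simp_all [shuffles_nil_left]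
    | nil_right u => simp_all [shuffles_nil_right]
    | cons_cons a u b v h1 h2 =>
      rw [shuffles_cons_cons, List.mem_append, List.mem_map, List.mem_map] at hw
      rcases hw with ⟨w, hw, rfl⟩ | ⟨w, hw, rfl⟩
      · exact ⟨(h1 hw).1.cons_cons a, (h1 hw).2.cons a⟩
      · exact ⟨(h2 hw).1.cons b, (h2 hw).2.cons_cons b⟩
  · rintro ⟨hp, hu, hv⟩
    induction u, v using shuffles_induction generalizing w with
    | nil_left v =>
      rw [shuffles_nil_left, List.mem_singleton]
      exact (hv.eq_of_length (by simpa using hp.length_eq.symm)).symm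
    | nil_right u =>
      rw [shuffles_nil_right, List.mem_singleton]
      exact (hu.eq_of_length (by simpa using hp.length_eq.symm)).symm
    | cons_cons a u b v h1 h2 =>
      obtain _ | ⟨x, w⟩ := w
      · simp at hu
      have hw : (x :: w).Nodup := hp.nodup_iff.2 h
      have hab : a ≠ b := fun hab => by simp [hab] at h
      rw [shuffles_cons_cons, List.mem_append, List.mem_map, List.mem_map]
      by_cases hxa : x = a
      · subst hxa
        have hv' : (b :: v).Sublist w := by
          rcases List.sublist_cons_iff.1 hv with h' | ⟨r, h', -⟩
          · exact h'
          · exact absurd (List.cons.inj h').1.symm hab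
        exact Or.inl ⟨w, h1 (List.nodup_cons.1 h).2 ((List.perm_cons x).1 hp)
          (List.cons_sublist_cons.1 hu) hv', rfl⟩
      by_cases hxb : x = b
      · subst hxb
        have hu' : (a :: u).Sublist w := by
          rcases List.sublist_cons_iff.1 hu with h' | ⟨r, h', -⟩
          · exact h'
          · exact absurd (List.cons.inj h').1 hab
        exact Or.inr ⟨w, h2 (List.nodup_middle.1 h).of_cons
          ((List.perm_cons x).1 (hp.trans List.perm_middle)) hu' (List.cons_sublist_cons.1 hv), rfl⟩
      exfalso
      have hu' : (a :: u).Sublist w := by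
        rcases List.sublist_cons_iff.1 hu with h' | ⟨r, h', -⟩
        · exact h'
        · exact absurd (List.cons.inj h').1.symm hxa
      have hv' : (b :: v).Sublist w := by
        rcases List.sublist_cons_iff.1 hv with h' | ⟨r, h', -⟩
        · exact h'
        · exact absurd (List.cons.inj h').1.symm hxb
      have hx : x ∈ (a :: u) ++ (b :: v) := hp.mem_iff.1 List.mem_cons_self
      rcases List.mem_append.1 hx with hx | hx
      · exact (List.nodup_cons.1 hw).1 (hu'.subset hx)
      · exact (List.nodup_cons.1 hw).1 (hv'.subset hx)

lemma ofFn_castAdd_append_ofFn_natAdd (k l : ℕ) :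
    List.ofFn (Fin.castAdd l : Fin k → Fin (k + l)) ++ List.ofFn (Fin.natAdd k : Fin l → Fin (k + l))
      = List.ofFn (id : Fin (k + l) → Fin (k + l)) := by
  rw [← List.ofFn_fin_append]
  congr 1
  funext i
  refine Fin.addCases (fun i => ?_) (fun i => ?_) i <;> simp

/-- The word of τ⁻¹ lists the labels by increasing position τ. A word of distinct labels is
therefore a sublist of it exactly when τ increases along that word. -/
lemma ofFn_symm_mem_shuffles_iff {k l : ℕ} (τ : Equiv.Perm (Fin (k + l))) :
    List.ofFn τ.symm ∈ shuffles (List.ofFn (Fin.castAdd l : Fin k → Fin (k + l)))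
      (List.ofFn (Fin.natAdd k : Fin l → Fin (k + l))) ↔ IsShuffle k l τ := by
  have hnd : (List.ofFn (id : Fin (k + l) → Fin (k + l))).Nodup :=
    List.nodup_ofFn.2 Function.injective_id
  have hnd' : (List.ofFn τ.symm).Nodup := List.nodup_ofFn.2 τ.symm.injective
  have hperm : (List.ofFn τ.symm).Perm (List.ofFn (id : Fin (k + l) → Fin (k + l))) := by
    rw [List.perm_ext_iff_of_nodup hnd' hnd]
    intro a
    simp only [List.mem_ofFn', Set.mem_range]
    exact ⟨fun _ => ⟨a, rfl⟩, fun _ => ⟨τ a, by simp⟩⟩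
  have hsorted : (List.ofFn τ.symm).Pairwise (fun i j => τ i < τ j) := by
    rw [List.pairwise_ofFn]
    intro i j hij
    simpa using hij
  have key : ∀ {m : ℕ} (e : Fin m → Fin (k + l)), Function.Injective e →
      ((List.ofFn e).Sublist (List.ofFn τ.symm) ↔ StrictMono fun i => τ (e i)) := by
    intro m e he
    constructor
    · intro h
      have := hsorted.sublist h
      rw [List.pairwise_ofFn] at this
      exact fun i j hij => this hij
    · intro h
      have h1 : (List.ofFn e).Pairwise (fun i j => τ i < τ j) := by
        rw [List.pairwise_ofFn]
        exact fun i j hij => h hij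
      have : Std.Antisymm (fun i j : Fin (k + l) => τ i ≤ τ j) :=
        ⟨fun i j h1 h2 => τ.injective (le_antisymm h1 h2)⟩
      refine List.sublist_of_subperm_of_pairwise (r := fun i j => τ i ≤ τ j)
        ((List.nodup_ofFn.2 he).subperm fun x _ => hperm.mem_iff.2 ?_)
        (h1.imp le_of_lt) (hsorted.imp le_of_lt)
      simp
  rw [mem_shuffles_iff (by rw [ofFn_castAdd_append_ofFn_natAdd]; exact hnd),
    ofFn_castAdd_append_ofFn_natAdd, key _ (Fin.castAdd_injective k l),
    key _ (Fin.natAdd_injective l k)]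
  exact and_iff_right hperm

lemma exists_perm_of_mem_shuffles {k l : ℕ} {w : List (Fin (k + l))}
    (hw : w ∈ shuffles (List.ofFn (Fin.castAdd l : Fin k → Fin (k + l)))
      (List.ofFn (Fin.natAdd k : Fin l → Fin (k + l)))) :
    ∃ τ : Equiv.Perm (Fin (k + l)), List.ofFn τ.symm = w := by
  have hp := perm_of_mem_shuffles hw
  rw [ofFn_castAdd_append_ofFn_natAdd] at hp
  have hlen : w.length = k + l := by simpa using hp.length_eq
  have hnd : w.Nodup := hp.nodup_iff.2 (List.nodup_ofFn.2 Function.injective_id)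
  let σ : Fin (k + l) → Fin (k + l) := fun i => w.get (Fin.cast hlen.symm i)
  have hσ : Function.Bijective σ := Finite.injective_iff_bijective.1 fun i j hij =>
    Fin.cast_injective _ (hnd.injective_get hij)
  refine ⟨(Equiv.ofBijective σ hσ).symm, ?_⟩
  refine List.ext_get (by simp [hlen]) fun i h1 h2 => ?_
  simp [σ]

lemma tprod_append {k l : ℕ} (a : Fin k → V) (b : Fin l → V) :
    TensorPower.mulEquiv (R := ℂ) (PiTensorProduct.tprod ℂ a ⊗ₜ PiTensorProduct.tprod ℂ b) =
      PiTensorProduct.tprod ℂ (Fin.append a b) :=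
  TensorPower.tprod_mul_tprod ℂ a b

/-- The bijection between permutations and shuffles is made on distinct labels in Fin (k + l), which
are then mapped to vectors; repeated vectors thus keep their multiplicities. -/
lemma shuffle_pureTensor {k l : ℕ} (a : Fin k → V) (b : Fin l → V) :
    shuffle (pureTensor a) (pureTensor b) =
      ((shuffles (List.ofFn a) (List.ofFn b)).map word).sum := by
  classical
  have h1 : shuffle (pureTensor a) (pureTensor b) =
      ∑ τ : Equiv.Perm (Fin (k + l)) with IsShuffle k l τ,
        word ((List.ofFn τ.symm).map (Fin.append a b)) := by
    simp only [shuffle, pureTensor, ofDeg, DirectSum.toModule_lof, LinearMap.flip_apply,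
      LinearMap.compr₂_apply, shuffleDeg, LinearMap.comp_apply, TensorProduct.mk_apply,
      LinearEquiv.coe_coe, tprod_append, LinearMap.sum_apply, map_sum,
      PiTensorProduct.reindex_tprod]
    refine Finset.sum_congr (by congr) fun τ _ => ?_
    rw [List.map_ofFn, word_ofFn]
    rfl
  have h2 : (shuffles (List.ofFn a) (List.ofFn b)) =
      (shuffles (List.ofFn (Fin.castAdd l : Fin k → Fin (k + l)))
        (List.ofFn (Fin.natAdd k : Fin l → Fin (k + l)))).map (List.map (Fin.append a b)) := by
    rw [← shuffles_map, List.map_ofFn, List.map_ofFn]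
    congr 2
    · funext i; simp
    · funext i; simp
  have hnd : (List.ofFn (Fin.castAdd l : Fin k → Fin (k + l)) ++
      List.ofFn (Fin.natAdd k : Fin l → Fin (k + l))).Nodup := by
    rw [ofFn_castAdd_append_ofFn_natAdd]
    exact List.nodup_ofFn.2 Function.injective_id
  rw [h1, h2, List.map_map, ← List.sum_toFinset _ (nodup_shuffles hnd)]
  refine Finset.sum_bij (fun τ _ => List.ofFn τ.symm) ?_ ?_ ?_ ?_
  · intro τ hτ
    rw [List.mem_toFinset, ofFn_symm_mem_shuffles_iff]
    exact (Finset.mem_filter.1 hτ).2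
  · intro τ _ τ' _ h
    exact Equiv.symm_bijective.injective (DFunLike.coe_injective (List.ofFn_injective h))
  · intro w hw
    rw [List.mem_toFinset] at hw
    obtain ⟨τ, rfl⟩ := exists_perm_of_mem_shuffles hw
    exact ⟨τ, Finset.mem_filter.2 ⟨Finset.mem_univ _, (ofFn_symm_mem_shuffles_iff τ).1 hw⟩, rfl⟩
  · intro τ _
    rfl

lemma shuffle_word (u v : List V) :
    shuffle (word u) (word v) = ((shuffles u v).map word).sum := by
  rw [word, word, shuffle_pureTensor]
  simp

lemma deconcatenation_word (l : List V) :
    deconcatenation (word l) =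
      ∑ i ∈ Finset.range (l.length + 1), word (l.take i) ⊗ₜ[ℂ] word (l.drop i) := by
  rw [Finset.sum_range]
  simp only [deconcatenation, word, pureTensor, ofDeg, DirectSum.toModule_lof,
    LinearMap.sum_apply, LinearMap.comp_apply, LinearEquiv.coe_coe, TensorPower.cast_tprod]
  refine Finset.sum_congr rfl fun j _ => ?_
  have hj : (j : ℕ) ≤ l.length := Nat.lt_succ_iff.1 j.2
  have h : (TensorPower.mulEquiv (R := ℂ) (M := V) (n := j) (m := l.length - j)).symm
      (PiTensorProduct.tprod ℂ (l.get ∘ Fin.cast (show l.length = j + (l.length - j) by omega).symm))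
      = PiTensorProduct.tprod ℂ (fun i : Fin j => l.get (Fin.cast (by omega) (Fin.castAdd (l.length - j) i)))
        ⊗ₜ PiTensorProduct.tprod ℂ
          (fun i : Fin (l.length - j) => l.get (Fin.cast (by omega) (Fin.natAdd j i))) := by
    rw [LinearEquiv.symm_apply_eq, tprod_append]
    congr 1
    funext i
    refine Fin.addCases (fun i => ?_) (fun i => ?_) i <;> simp
  rw [h, TensorProduct.map_tmul]
  congr 1
  · exact pureTensor_congr (by simp [hj]) fun i => by simp
  · exact pureTensor_congr (by simp) fun i => by simp

/-! ### Sums over the splittings of a word. -/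

/-- The sum of `f p q` over the ways to write the word `l` as `p ++ q`. -/
def deconc {X A : Type*} [AddCommMonoid A] (f : List X → List X → A) (l : List X) : A :=
  ∑ i ∈ Finset.range (l.length + 1), f (l.take i) (l.drop i)

section deconc

variable {X A : Type*}

@[simp] lemma deconc_nil [AddCommMonoid A] (f : List X → List X → A) : deconc f [] = f [] [] := by
  simp [deconc]

lemma deconc_cons [AddCommMonoid A] (f : List X → List X → A) (a : X) (l : List X) :
    deconc f (a :: l) = f [] (a :: l) + deconc (fun p q => f (a :: p) q) l := by
  rw [deconc, List.length_cons, Finset.sum_range_succ', add_comm]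
  rfl

lemma deconc_add [AddCommMonoid A] (f g : List X → List X → A) (l : List X) :
    deconc (fun p q => f p q + g p q) l = deconc f l + deconc g l :=
  Finset.sum_add_distrib

lemma deconc_sub [AddCommGroup A] (f g : List X → List X → A) (l : List X) :
    deconc (fun p q => f p q - g p q) l = deconc f l - deconc g l :=
  Finset.sum_sub_distrib ..

lemma mul_deconc [NonUnitalNonAssocSemiring A] (c : A) (f : List X → List X → A) (l : List X) :
    c * deconc f l = deconc (fun p q => c * f p q) l :=
  Finset.mul_sum ..

lemma deconc_mul [NonUnitalNonAssocSemiring A] (c : A) (f : List X → List X → A) (l : List X) :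
    deconc f l * c = deconc (fun p q => f p q * c) l :=
  Finset.sum_mul ..

lemma deconc_congr [AddCommMonoid A] {f g : List X → List X → A} {l : List X}
    (h : ∀ p q, p ++ q = l → f p q = g p q) : deconc f l = deconc g l :=
  Finset.sum_congr rfl fun _ _ => h _ _ (List.take_append_drop _ _)

lemma deconc_eq_zero [AddCommMonoid A] {f : List X → List X → A} {l : List X}
    (h : ∀ p q, p ++ q = l → f p q = 0) : deconc f l = 0 :=
  Finset.sum_eq_zero fun _ _ => h _ _ (List.take_append_drop _ _)

lemma deconc_eq_last [AddCommMonoid A] {f : List X → List X → A} {l : List X}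
    (h : ∀ p q, p ++ q = l → q ≠ [] → f p q = 0) : deconc f l = f l [] := by
  rw [deconc, Finset.sum_range_succ, Finset.sum_eq_zero, List.take_length, List.drop_length,
    zero_add]
  intro i hi
  refine h _ _ (List.take_append_drop _ _) fun h => ?_
  rw [List.drop_eq_nil_iff] at h
  have := Finset.mem_range.1 hi
  omega

lemma deconc_assoc [AddCommMonoid A] (f : List X → List X → List X → A) (l : List X) :
    deconc (fun p q => deconc (fun p₁ p₂ => f p₁ p₂ q) p) l =
      deconc (fun p q => deconc (fun q₁ q₂ => f p q₁ q₂) q) l := by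
  induction l generalizing f with
  | nil => simp
  | cons a l ih => simp [deconc_cons, deconc_add, ih (fun p => f (a :: p)), add_assoc]

/-- Cutting a shuffle of u and v cuts u and v, and each half is a shuffle of the corresponding
pieces. Thus deconcatenation is multiplicative for the shuffle product, which makes convolutions of
characters characters. -/
lemma sum_deconc_shuffles [AddCommMonoid A] (f : List X → List X → A) (u v : List X) :
    ((shuffles u v).map (deconc f)).sum =
      deconc (fun u₁ u₂ => deconc (fun v₁ v₂ =>
        ((shuffles u₁ v₁).map fun p => ((shuffles u₂ v₂).map fun q => f p q).sum).sum) v) u := by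
  induction u, v using shuffles_induction generalizing f with
  | nil_left v => simp [shuffles_nil_left]
  | nil_right u => simp [shuffles_nil_right]
  | cons_cons a u b v h1 h2 =>
    have h1 := h1 fun p q => f (a :: p) q
    have h2 := h2 fun p q => f (b :: p) q
    simp only [deconc_cons, deconc_add, shuffles_nil_right, shuffles_nil_left, List.map_cons,
      List.map_nil, List.sum_cons, List.sum_nil, add_zero] at h1 h2
    simp only [shuffles_cons_cons, deconc_cons, deconc_add, shuffles_nil_right, shuffles_nil_left,
      List.map_append, List.sum_append, List.map_map, Function.comp_def, List.sum_map_add, h1, h2,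
      List.map_cons, List.map_nil, List.sum_cons, List.sum_nil, add_zero]
    abel

end deconc

/-! ### Convolution and the algebraic Birkhoff factorisation. -/

section convolution

variable {V : Type} [AddCommGroup V] [Module ℂ V] {A : Type} [CommRing A] [Algebra ℂ A]

lemma convolution_word (φ ψ : Tensors V →ₗ[ℂ] A) (l : List V) :
    convolution φ ψ (word l) = deconc (fun p q => φ (word p) * ψ (word q)) l := by
  simp [convolution, deconcatenation_word, deconc]

lemma convolutionUnit_nil : (convolutionUnit : Tensors V →ₗ[ℂ] A) (word []) = 1 := by
  have : (DirectSum.component ℂ ℕ (fun k => ⨂[ℂ]^k V) 0) (word ([] : List V)) =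
      PiTensorProduct.tprod ℂ ([] : List V).get := DirectSum.component.lof_self ..
  simp [convolutionUnit, this]

lemma convolutionUnit_cons (a : V) (l : List V) :
    (convolutionUnit : Tensors V →ₗ[ℂ] A) (word (a :: l)) = 0 := by
  have : (DirectSum.component ℂ ℕ (fun k => ⨂[ℂ]^k V) 0) (word (a :: l)) = 0 :=
    by
    rw [word, pureTensor, ofDeg, DirectSum.component.of, dif_neg (by simp)]
  simp [convolutionUnit, this]

lemma convolution_assoc (φ ψ χ : Tensors V →ₗ[ℂ] A) :
    convolution (convolution φ ψ) χ = convolution φ (convolution ψ χ) := by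
  refine linearMap_ext_word fun l => ?_
  simp only [convolution_word, mul_deconc, deconc_mul, mul_assoc]
  exact deconc_assoc (fun p q s => φ (word p) * (ψ (word q) * χ (word s))) l

lemma convolution_unit (φ : Tensors V →ₗ[ℂ] A) : convolution φ convolutionUnit = φ := by
  refine linearMap_ext_word fun l => ?_
  rw [convolution_word, deconc_eq_last, convolutionUnit_nil, mul_one]
  intro p q _ hq
  obtain _ | ⟨a, q⟩ := q
  · exact absurd rfl hq
  · rw [convolutionUnit_cons, mul_zero]

lemma unit_convolution (φ : Tensors V →ₗ[ℂ] A) : convolution convolutionUnit φ = φ := by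
  refine linearMap_ext_word fun l => ?_
  rw [convolution_word]
  obtain _ | ⟨a, l⟩ := l
  · rw [deconc_nil, convolutionUnit_nil, one_mul]
  · rw [deconc_cons, convolutionUnit_nil, one_mul, deconc_eq_zero, add_zero]
    intro p q _
    rw [convolutionUnit_cons, zero_mul]

lemma convolution_sub (φ ψ χ : Tensors V →ₗ[ℂ] A) :
    convolution φ (ψ - χ) = convolution φ ψ - convolution φ χ := by
  refine linearMap_ext_word fun l => ?_
  simp only [convolution_word, LinearMap.sub_apply, mul_sub, deconc_sub]

lemma isShuffleCharacter_iff {φ : Tensors V →ₗ[ℂ] A} :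
    IsShuffleCharacter φ ↔ φ (word []) = 1 ∧ ∀ u v : List V,
      ((shuffles u v).map fun w => φ (word w)).sum = φ (word u) * φ (word v) := by
  have h0 : pureTensor (Fin.elim0 : Fin 0 → V) = word [] :=
    pureTensor_congr rfl fun i => i.elim0
  have h1 : ∀ u v : List V,
      φ (shuffle (word u) (word v)) = ((shuffles u v).map fun w => φ (word w)).sum := by
    intro u v
    rw [shuffle_word, map_list_sum, List.map_map]
    rfl
  rw [IsShuffleCharacter, h0]
  refine and_congr_right fun _ => ⟨fun h u v => by rw [← h1, h], fun h => ?_⟩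
  have : (shuffle (V := V)).compr₂ φ = (LinearMap.mul ℂ A).compl₁₂ φ φ :=
    linearMap_ext_word fun u => linearMap_ext_word fun v => by
      simp [h1, h]
  intro x y
  exact LinearMap.congr_fun (LinearMap.congr_fun this x) y

lemma mem_of_forall_word {M : Type*} [AddCommGroup M] [Module ℂ M] {S : Submodule ℂ M}
    {f : Tensors V →ₗ[ℂ] M} (h : ∀ l, f (word l) ∈ S) (x : Tensors V) : f x ∈ S := by
  have : S.mkQ ∘ₗ f = 0 := linearMap_ext_word fun l => by simpa using h l
  simpa using LinearMap.congr_fun this x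

lemma mem_of_forall_word_ne_nil {M : Type*} [AddCommGroup M] [Module ℂ M] {S : Submodule ℂ M}
    {f : Tensors V →ₗ[ℂ] M} (h : ∀ l, l ≠ [] → f (word l) ∈ S) {k : ℕ} (hk : 0 < k)
    (x : ⨂[ℂ]^k V) : f (ofDeg k x) ∈ S := by
  have : S.mkQ ∘ₗ f ∘ₗ ofDeg k = 0 := PiTensorProduct.ext (MultilinearMap.ext fun v => by
    have := h (List.ofFn v) (by simpa using hk.ne')
    rw [word_ofFn] at this
    exact (Submodule.Quotient.mk_eq_zero S).2 this)
  simpa using LinearMap.congr_fun this x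

/-- As χ kills the empty word, the right side at a word only involves ψ at shorter words, so the
equation is a recursion on length. It gives convolution inverses for π = id and the minus part for π
the projection to polar parts. -/
lemma exists_eq_unit_sub_comp_convolution {χ : Tensors V →ₗ[ℂ] A} (hχ : χ (word []) = 0)
    (π : A →ₗ[ℂ] A) :
    ∃ ψ : Tensors V →ₗ[ℂ] A, ψ = convolutionUnit - π ∘ₗ convolution ψ χ := by
  let ψ : ℕ → Tensors V →ₗ[ℂ] A := fun m =>
    Nat.rec 0 (fun _ ψ => convolutionUnit - π ∘ₗ convolution ψ χ) m
  have hψ : ∀ m, ψ (m + 1) = convolutionUnit - π ∘ₗ convolution (ψ m) χ := fun m => rfl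
  have key : ∀ (m : ℕ) (f g : Tensors V →ₗ[ℂ] A) (l : List V), l.length ≤ m →
      (∀ p : List V, p.length < l.length → f (word p) = g (word p)) →
      convolution f χ (word l) = convolution g χ (word l) := by
    intro m f g l hl h
    rw [convolution_word, convolution_word]
    refine deconc_congr fun p q hpq => ?_
    obtain _ | ⟨a, q⟩ := q
    · simp [hχ]
    · rw [h p (by simp [← hpq])]
  have stable : ∀ (m : ℕ) (l : List V), l.length < m → ψ (m + 1) (word l) = ψ m (word l) := by
    intro m
    induction m with
    | zero => intro l hl; omega
    | succ m ih =>
      intro l hl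
      rw [hψ (m + 1)]
      conv_rhs => rw [hψ m]
      simp only [LinearMap.sub_apply, LinearMap.comp_apply]
      rw [key m (ψ (m + 1)) (ψ m) l (by omega) fun p hp => ih p (by omega)]
  have stable' : ∀ (m : ℕ) (l : List V), l.length < m → ψ m (word l) = ψ (l.length + 1) (word l) := by
    intro m l hl
    induction m, hl using Nat.le_induction with
    | base => rfl
    | succ m hm ih => rw [stable m l hm, ih]
  -- The iterates starting from 0 are stationary on words of length k from the index k + 1 on.
  let Ψ : Tensors V →ₗ[ℂ] A := DirectSum.toModule ℂ ℕ _ fun k => ψ (k + 1) ∘ₗ ofDeg k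
  have hΨ : ∀ l : List V, Ψ (word l) = ψ (l.length + 1) (word l) := fun l => by
    simp [Ψ, word, pureTensor, ofDeg]
  refine ⟨Ψ, linearMap_ext_word fun l => ?_⟩
  rw [hΨ, hψ]
  simp only [LinearMap.sub_apply, LinearMap.comp_apply]
  rw [key l.length (ψ l.length) Ψ l le_rfl fun p hp => by rw [hΨ, stable' _ p hp]]

/-- With π = id the fixed-point equation says that ψ is a left inverse. Since ψ has a left inverse
too, associativity identifies that one with φ. -/
lemma exists_convolution_inverse {φ : Tensors V →ₗ[ℂ] A} (hφ : φ (word []) = 1) :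
    ∃ ψ : Tensors V →ₗ[ℂ] A,
      convolution ψ φ = convolutionUnit ∧ convolution φ ψ = convolutionUnit := by
  have left : ∀ φ : Tensors V →ₗ[ℂ] A, φ (word []) = 1 → ∃ ψ : Tensors V →ₗ[ℂ] A,
      convolution ψ φ = convolutionUnit ∧ ψ (word []) = 1 := by
    intro φ hφ
    obtain ⟨ψ, hψ⟩ := exists_eq_unit_sub_comp_convolution (χ := φ - convolutionUnit)
      (by simp [hφ, convolutionUnit_nil]) LinearMap.id
    rw [LinearMap.id_comp, convolution_sub, convolution_unit, sub_sub_eq_add_sub] at hψ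
    have h := eq_sub_iff_add_eq.1 hψ
    rw [add_comm] at h
    have h1 : convolution ψ φ = convolutionUnit := by
      have := add_right_cancel h
      exact this
    refine ⟨ψ, h1, ?_⟩
    have := LinearMap.congr_fun h1 (word [])
    simpa [convolution_word, hφ, convolutionUnit_nil] using this
  obtain ⟨ψ, h1, h2⟩ := left φ hφ
  obtain ⟨ψ', h3, -⟩ := left ψ h2
  refine ⟨ψ, h1, ?_⟩
  have : ψ' = φ := by
    rw [← convolution_unit ψ', ← h1, ← convolution_assoc, h3, unit_convolution]
  rw [← this, h3]

lemma convolution_word_eq_of_agree {φ φ' ψ : Tensors V →ₗ[ℂ] A} {l : List V}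
    (h : ∀ p : List V, p.length < l.length → φ (word p) = φ' (word p)) :
    convolution φ ψ (word l) - convolution φ' ψ (word l) =
      (φ (word l) - φ' (word l)) * ψ (word []) := by
  rw [convolution_word, convolution_word, ← deconc_sub, deconc_eq_last, sub_mul]
  intro p q hpq hq
  rw [h p, sub_self]
  rw [← hpq, List.length_append]
  exact Nat.lt_add_of_pos_right (List.length_pos_iff.2 hq)

lemma IsShuffleCharacter.convolution {φ ψ : Tensors V →ₗ[ℂ] A} (hφ : IsShuffleCharacter φ)
    (hψ : IsShuffleCharacter ψ) : IsShuffleCharacter (convolution φ ψ) := by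
  rw [isShuffleCharacter_iff] at hφ hψ ⊢
  refine ⟨by simp [convolution_word, hφ.1, hψ.1], fun u v => ?_⟩
  simp only [convolution_word]
  rw [sum_deconc_shuffles (fun p q => φ (word p) * ψ (word q)) u v, deconc_mul]
  refine deconc_congr fun u₁ u₂ _ => ?_
  rw [mul_deconc]
  refine deconc_congr fun v₁ v₂ _ => ?_
  simp only [List.sum_map_mul_left, List.sum_map_mul_right, hφ.2, hψ.2]
  ring

lemma eq_of_mem_of_isCompl {P H : Submodule ℂ A} (hPH : IsCompl P H) {x y : A} (h : x - y ∈ P)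
    (h' : x - y ∈ H) : x = y :=
  sub_eq_zero.1 ((Submodule.disjoint_def.1 hPH.disjoint) _ h h')

/-- With π the projection to P along H and ε the unit, take ψ = ε − π(ψ ⋆ (Φ − ε)). Then ψ ⋆ Φ = ε +
(1 − π)(ψ ⋆ (Φ − ε)) takes values in H. For the shuffle relation, induct on the total length of u
and v: as Φ is a character, the defects of ψ and of ψ ⋆ Φ at (u, v) differ by defects of ψ at
shorter pairs, which vanish. The common defect lies in P, which is closed under products, and in H,
so it is zero. -/
theorem exists_birkhoff {P : Submodule ℂ A} {H : Subalgebra ℂ A}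
    (hP : ∀ x ∈ P, ∀ y ∈ P, x * y ∈ P) (hPH : IsCompl P (Subalgebra.toSubmodule H))
    {Φ : Tensors V →ₗ[ℂ] A} (hΦ : IsShuffleCharacter Φ) :
    ∃ Φm : Tensors V →ₗ[ℂ] A, IsShuffleCharacter Φm ∧ (∀ l, l ≠ [] → Φm (word l) ∈ P) ∧
      ∀ x, convolution Φm Φ x ∈ H := by
  obtain ⟨hΦ1, hΦ2⟩ := isShuffleCharacter_iff.1 hΦ
  let π : A →ₗ[ℂ] A := P.subtype ∘ₗ P.projectionOnto _ hPH
  have hπP : ∀ x, π x ∈ P := fun x => (P.projectionOnto _ hPH x).2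
  have hπH : ∀ x, x - π x ∈ Subalgebra.toSubmodule H := fun x => by
    rw [← Submodule.ker_projectionOnto hPH, LinearMap.mem_ker, map_sub, sub_eq_zero]
    exact (Submodule.projectionOnto_apply_left hPH _).symm
  obtain ⟨ψ, hψ⟩ := exists_eq_unit_sub_comp_convolution (χ := Φ - convolutionUnit)
    (by simp [hΦ1, convolutionUnit_nil]) π
  have hψ1 : ψ (word []) = 1 := by
    have := LinearMap.congr_fun hψ (word [])
    simpa [convolution_word, hΦ1, convolutionUnit_nil] using this
  have hψP : ∀ l, l ≠ [] → ψ (word l) ∈ P := by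
    intro l hl
    obtain _ | ⟨a, l⟩ := l
    · exact absurd rfl hl
    rw [hψ, LinearMap.sub_apply, convolutionUnit_cons, zero_sub]
    exact P.neg_mem (hπP _)
  have hH : ∀ x, convolution ψ Φ x ∈ Subalgebra.toSubmodule H := by
    refine mem_of_forall_word fun l => ?_
    have h1 : convolution ψ Φ =
        convolution ψ (Φ - convolutionUnit) + (convolutionUnit -
          π ∘ₗ convolution ψ (Φ - convolutionUnit)) := by
      rw [← hψ, convolution_sub, convolution_unit, sub_add_cancel]
    have h2 : convolution ψ Φ (word l) = convolutionUnit (word l) +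
        (convolution ψ (Φ - convolutionUnit) (word l) -
          π (convolution ψ (Φ - convolutionUnit) (word l))) := by
      rw [h1]
      simp only [LinearMap.add_apply, LinearMap.sub_apply, LinearMap.comp_apply]
      ring
    rw [h2]
    refine Submodule.add_mem _ ?_ (hπH _)
    obtain _ | ⟨a, l⟩ := l
    · rw [convolutionUnit_nil]; exact H.one_mem
    · rw [convolutionUnit_cons]; exact Submodule.zero_mem _
  refine ⟨ψ, isShuffleCharacter_iff.2 ⟨hψ1, ?_⟩, hψP, hH⟩
  intro u v
  induction hm : u.length + v.length using Nat.strong_induction_on generalizing u v with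
  | _ m ih =>
  subst hm
  by_cases hu : u = []
  · simp [hu, shuffles_nil_left, hψ1]
  by_cases hv : v = []
  · simp [hv, shuffles_nil_right, hψ1]
  have key : ((shuffles u v).map fun w => convolution ψ Φ (word w)).sum -
      convolution ψ Φ (word u) * convolution ψ Φ (word v) =
      ((shuffles u v).map fun w => ψ (word w)).sum - ψ (word u) * ψ (word v) := by
    simp only [convolution_word]
    rw [sum_deconc_shuffles (fun p q => ψ (word p) * Φ (word q)) u v, deconc_mul, ← deconc_sub]
    have h : ∀ u₁ u₂ : List V, (deconc (fun v₁ v₂ => ((shuffles u₁ v₁).map fun p =>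
          ((shuffles u₂ v₂).map fun q => ψ (word p) * Φ (word q)).sum).sum) v -
        ψ (word u₁) * Φ (word u₂) * deconc (fun p q => ψ (word p) * Φ (word q)) v) =
        deconc (fun v₁ v₂ => (((shuffles u₁ v₁).map fun p => ψ (word p)).sum -
          ψ (word u₁) * ψ (word v₁)) * (Φ (word u₂) * Φ (word v₂))) v := by
      intro u₁ u₂
      rw [mul_deconc, ← deconc_sub]
      refine deconc_congr fun v₁ v₂ _ => ?_
      simp only [List.sum_map_mul_left, List.sum_map_mul_right, hΦ2]
      ring
    simp only [h]
    rw [deconc_eq_last, deconc_eq_last, hΦ1, mul_one, mul_one]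
    · intro v₁ v₂ hv' hv₂
      have : v₁.length < v.length := by
        rw [← hv', List.length_append]
        exact Nat.lt_add_of_pos_right (List.length_pos_iff.2 hv₂)
      rw [ih _ (by omega) u v₁ rfl, sub_self, zero_mul]
    · intro u₁ u₂ hu' hu₂
      have : u₁.length < u.length := by
        rw [← hu', List.length_append]
        exact Nat.lt_add_of_pos_right (List.length_pos_iff.2 hu₂)
      refine deconc_eq_zero fun v₁ v₂ hv' => ?_
      have : v₁.length ≤ v.length := by
        rw [← hv', List.length_append]
        exact Nat.le_add_right _ _
      rw [ih _ (by omega) u₁ v₁ rfl, sub_self, zero_mul]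
  refine eq_of_mem_of_isCompl hPH (P.sub_mem (list_sum_mem ?_) (hP _ (hψP u hu) _ (hψP v hv))) ?_
  · intro x hx
    obtain ⟨w, hw, rfl⟩ := List.mem_map.1 hx
    refine hψP w fun h => ?_
    rw [h] at hw
    have := (perm_of_mem_shuffles hw).length_eq
    rw [List.length_append, List.length_nil] at this
    exact hu (List.length_eq_zero_iff.1 (by omega))
  · rw [← key]
    refine Submodule.sub_mem _ (list_sum_mem ?_) (H.mul_mem (hH _) (hH _))
    intro x hx
    obtain ⟨w, hw, rfl⟩ := List.mem_map.1 hx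
    exact hH _

/-- If φ and φ' agree on shorter words, then φ − φ' at a word equals the difference of the two
convolutions there, and so lies in P and in H. -/
theorem birkhoff_unique {P H : Submodule ℂ A} (hPH : IsCompl P H) {Φ φ φ' : Tensors V →ₗ[ℂ] A}
    (hΦ : Φ (word []) = 1) (h1 : φ (word []) = 1) (h1' : φ' (word []) = 1)
    (hφ : ∀ l, l ≠ [] → φ (word l) ∈ P) (hφ' : ∀ l, l ≠ [] → φ' (word l) ∈ P)
    (hH : ∀ l, convolution φ Φ (word l) ∈ H) (hH' : ∀ l, convolution φ' Φ (word l) ∈ H) :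
    φ = φ' := by
  refine linearMap_ext_word fun l => ?_
  induction hm : l.length using Nat.strong_induction_on generalizing l with
  | _ m ih =>
  subst hm
  by_cases hl : l = []
  · rw [hl, h1, h1']
  refine eq_of_mem_of_isCompl hPH (P.sub_mem (hφ l hl) (hφ' l hl)) ?_
  have := convolution_word_eq_of_agree (ψ := Φ) (fun p hp => ih _ hp p rfl)
  rw [hΦ, mul_one] at this
  rw [← this]
  exact H.sub_mem (hH l) (hH' l)

end convolution

/-! ### Meromorphic functions on W: values and polar parts at the origin. -/

lemma eventually_codiscreteWithin_iff {W : Set ℂ} (hW : IsOpen W) {p : ℂ → Prop} :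
    (∀ᶠ z in codiscreteWithin W, p z) ↔ ∀ z ∈ W, ∀ᶠ w in 𝓝[≠] z, p w := by
  rw [Filter.Eventually, mem_codiscreteWithin]
  refine forall₂_congr fun z hz => ?_
  rw [disjoint_principal_right]
  constructor
  · intro h
    filter_upwards [h, mem_nhdsWithin_of_mem_nhds (hW.mem_nhds hz)] with w hw hwW
    by_contra hp
    exact hw ⟨hwW, hp⟩
  · intro h
    filter_upwards [h] with w hw hw'
    exact hw'.2 hw

namespace Mero

variable {W : Set ℂ}

lemma mk_eq_mk_iff {f g : ℂ → ℂ} {hf : MeromorphicOn f W} {hg : MeromorphicOn g W} :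
    mk f hf = mk g hg ↔ f =ᶠ[codiscreteWithin W] g := by
  refine Ideal.Quotient.eq.trans ?_
  have : (f - g =ᶠ[codiscreteWithin W] 0) ↔ f =ᶠ[codiscreteWithin W] g :=
    ⟨fun h => h.mono fun z hz => sub_eq_zero.1 hz, fun h => h.mono fun z hz => sub_eq_zero.2 hz⟩
  exact this

lemma exists_represents (g : Mero W) : ∃ f, g.Represents f := by
  obtain ⟨⟨f, hf⟩, rfl⟩ := Ideal.Quotient.mk_surjective g
  exact ⟨f, hf, rfl⟩

namespace Represents

lemma eq_iff {g g' : Mero W} {f f' : ℂ → ℂ} (h : g.Represents f) (h' : g'.Represents f') :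
    g = g' ↔ f =ᶠ[codiscreteWithin W] f' := by
  obtain ⟨hf, rfl⟩ := h
  obtain ⟨hf', rfl⟩ := h'
  exact mk_eq_mk_iff

lemma congr (hW : IsOpen W) {g : Mero W} {f f' : ℂ → ℂ} (h : g.Represents f)
    (hff' : f =ᶠ[codiscreteWithin W] f') : g.Represents f' := by
  obtain ⟨hf, rfl⟩ := h
  exact ⟨hf.congr_codiscreteWithin hff' hW, (mk_eq_mk_iff.2 hff').symm⟩

lemma add {g g' : Mero W} {f f' : ℂ → ℂ} (h : g.Represents f) (h' : g'.Represents f') :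
    (g + g').Represents (fun z => f z + f' z) := by
  obtain ⟨hf, rfl⟩ := h
  obtain ⟨hf', rfl⟩ := h'
  exact ⟨hf.add hf', rfl⟩

lemma mul {g g' : Mero W} {f f' : ℂ → ℂ} (h : g.Represents f) (h' : g'.Represents f') :
    (g * g').Represents (fun z => f z * f' z) := by
  obtain ⟨hf, rfl⟩ := h
  obtain ⟨hf', rfl⟩ := h'
  exact ⟨hf.mul hf', rfl⟩

lemma algebraMap (c : ℂ) : (algebraMap ℂ (Mero W) c).Represents (fun _ => c) :=
  ⟨MeromorphicOn.const c, rfl⟩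

lemma one : (1 : Mero W).Represents (fun _ => 1) :=
  ⟨MeromorphicOn.const 1, rfl⟩

lemma zero : (0 : Mero W).Represents (fun _ => 0) :=
  ⟨MeromorphicOn.const 0, rfl⟩

lemma smul (c : ℂ) {g : Mero W} {f : ℂ → ℂ} (h : g.Represents f) :
    (c • g).Represents (fun z => c * f z) := by
  rw [Algebra.smul_def]
  exact (algebraMap c).mul h

lemma meromorphicAt {g : Mero W} {f : ℂ → ℂ} (h : g.Represents f) {z : ℂ} (hz : z ∈ W) :
    MeromorphicAt f z := h.1 z hz

/-- The removable singularity theorem; redefining f at the single point 0 does not change its class.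
-/
lemma hasValueAtZero_iff (hW : IsOpen W) (h0 : (0 : ℂ) ∈ W) {g : Mero W} {f : ℂ → ℂ}
    (h : g.Represents f) {c : ℂ} : g.HasValueAtZero c ↔ Tendsto f (𝓝[≠] 0) (𝓝 c) := by
  constructor
  · rintro ⟨f', hf', han, rfl⟩
    have h1 := (eventually_codiscreteWithin_iff hW).1 ((hf'.eq_iff h).1 rfl) 0 h0
    exact (han.continuousAt.tendsto.mono_left nhdsWithin_le_nhds).congr' h1
  · intro hc
    have hu : f =ᶠ[codiscreteWithin W] Function.update f 0 c := by
      refine (eventually_codiscreteWithin_iff hW).2 fun z hz => ?_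
      by_cases hz0 : z = 0
      · filter_upwards [self_mem_nhdsWithin] with w hw
        rw [Function.update_of_ne (hz0 ▸ hw)]
      · filter_upwards [mem_nhdsWithin_of_mem_nhds (isOpen_ne.mem_nhds hz0)] with w hw
        rw [Function.update_of_ne hw]
    refine ⟨Function.update f 0 c, h.congr hW hu, ?_, by simp⟩
    refine Complex.analyticAt_of_differentiable_on_punctured_nhds_of_continuousAt ?_
      (continuousAt_update_same.2 hc)
    filter_upwards [((h.congr hW hu).meromorphicAt h0).eventually_analyticAt] with z hz
    exact hz.differentiableAt

end Represents

lemma HasValueAtZero.unique (hW : IsOpen W) (h0 : (0 : ℂ) ∈ W) {g : Mero W} {c c' : ℂ}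
    (h : g.HasValueAtZero c) (h' : g.HasValueAtZero c') : c = c' := by
  obtain ⟨f, hf⟩ := g.exists_represents
  exact tendsto_nhds_unique ((hf.hasValueAtZero_iff hW h0).1 h) ((hf.hasValueAtZero_iff hW h0).1 h')

lemma HasValueAtZero.add (hW : IsOpen W) (h0 : (0 : ℂ) ∈ W) {g g' : Mero W} {c c' : ℂ}
    (h : g.HasValueAtZero c) (h' : g'.HasValueAtZero c') : (g + g').HasValueAtZero (c + c') := by
  obtain ⟨f, hf⟩ := g.exists_represents
  obtain ⟨f', hf'⟩ := g'.exists_represents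
  exact ((hf.add hf').hasValueAtZero_iff hW h0).2
    (((hf.hasValueAtZero_iff hW h0).1 h).add ((hf'.hasValueAtZero_iff hW h0).1 h'))

lemma HasValueAtZero.mul (hW : IsOpen W) (h0 : (0 : ℂ) ∈ W) {g g' : Mero W} {c c' : ℂ}
    (h : g.HasValueAtZero c) (h' : g'.HasValueAtZero c') : (g * g').HasValueAtZero (c * c') := by
  obtain ⟨f, hf⟩ := g.exists_represents
  obtain ⟨f', hf'⟩ := g'.exists_represents
  exact ((hf.mul hf').hasValueAtZero_iff hW h0).2
    (((hf.hasValueAtZero_iff hW h0).1 h).mul ((hf'.hasValueAtZero_iff hW h0).1 h'))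

lemma hasValueAtZero_algebraMap (c : ℂ) : (algebraMap ℂ (Mero W) c).HasValueAtZero c :=
  ⟨fun _ => c, Represents.algebraMap c, analyticAt_const, rfl⟩

/-- The elements of `Mero W` which are holomorphic at `0`. -/
def holomorphicAtZero (hW : IsOpen W) (h0 : (0 : ℂ) ∈ W) : Subalgebra ℂ (Mero W) where
  carrier := {g | ∃ c, g.HasValueAtZero c}
  mul_mem' := fun ⟨_, h⟩ ⟨_, h'⟩ => ⟨_, h.mul hW h0 h'⟩
  add_mem' := fun ⟨_, h⟩ ⟨_, h'⟩ => ⟨_, h.add hW h0 h'⟩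
  algebraMap_mem' c := ⟨c, hasValueAtZero_algebraMap c⟩

/-- The elements of `z⁻¹ ℂ[z⁻¹]` in `Mero W`. -/
def polar (W : Set ℂ) : Submodule ℂ (Mero W) where
  carrier := {g | g.IsPolar}
  add_mem' := fun ⟨p, h1, h2⟩ ⟨q, h3, h4⟩ =>
    ⟨p + q, by simp [h1, h3], by simpa using h2.add h4⟩
  zero_mem' := ⟨0, by simp, by simpa using Represents.zero⟩
  smul_mem' := fun c _ ⟨p, h1, h2⟩ =>
    ⟨Polynomial.C c * p, by simp [h1], by simpa using h2.smul c⟩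

lemma mul_mem_polar {g g' : Mero W} (h : g ∈ polar W) (h' : g' ∈ polar W) :
    g * g' ∈ polar W := by
  obtain ⟨p, h1, h2⟩ := h
  obtain ⟨q, h3, h4⟩ := h'
  exact ⟨p * q, by simp [Polynomial.mul_coeff_zero, h1], by simpa using h2.mul h4⟩

lemma meromorphicOn_eval_inv (p : Polynomial ℂ) : MeromorphicOn (fun z => p.eval z⁻¹) W := by
  intro z _
  have : MeromorphicAt (fun z : ℂ => z⁻¹) z := (MeromorphicAt.id z).inv
  induction p using Polynomial.induction_on' with
  | add p q hp hq => simpa using hp.fun_add hq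
  | monomial k c => simpa using (MeromorphicAt.const c z).fun_mul (this.fun_pow k)

lemma tendsto_inv_ofReal_nhdsNE_zero :
    Tendsto (fun x : ℝ => ((x : ℂ))⁻¹) atTop (𝓝[≠] 0) := by
  refine tendsto_nhdsWithin_iff.2 ⟨?_, ?_⟩
  · have := (Complex.continuous_ofReal.tendsto 0).comp tendsto_inv_atTop_zero
    simpa [Function.comp_def] using this
  · filter_upwards [eventually_gt_atTop 0] with x hx
    simpa using hx.ne'

/-- Existence of the principal part: subtracting g(0)z^(−m−1) from g(z)z^(−m−1) leaves z^(−m) times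
the analytic slope of g. -/
lemma exists_polynomial_tendsto_sub (m : ℕ) {g : ℂ → ℂ} (hg : AnalyticAt ℂ g 0) :
    ∃ p : Polynomial ℂ, p.coeff 0 = 0 ∧
      ∃ c, Tendsto (fun z => g z * z⁻¹ ^ m - p.eval z⁻¹) (𝓝[≠] 0) (𝓝 c) := by
  induction m generalizing g with
  | zero =>
    refine ⟨0, by simp, g 0, ?_⟩
    simpa using hg.continuousAt.tendsto.mono_left nhdsWithin_le_nhds
  | succ m ih =>
    obtain ⟨q, hq⟩ := hg
    obtain ⟨p, hp, c, hc⟩ := ih ⟨_, hq.has_fpower_series_dslope_fslope⟩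
    refine ⟨p + Polynomial.C (g 0) * Polynomial.X ^ (m + 1), by simp [hp], c, hc.congr' ?_⟩
    filter_upwards [self_mem_nhdsWithin] with z hz
    have hz : z ≠ 0 := hz
    rw [dslope_of_ne _ hz, slope_def_field]
    simp only [Polynomial.eval_add, Polynomial.eval_mul, Polynomial.eval_C, Polynomial.eval_pow,
      Polynomial.eval_X, sub_zero, pow_succ, div_eq_mul_inv]
    ring

/-- If p(1/z) has a limit at 0, then p(x) converges as x → ∞ along the reals, so p is constant, and
its constant coefficient is 0. Sums exhaust the algebra by subtracting principal parts. -/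
lemma isCompl_polar (hW : IsOpen W) (h0 : (0 : ℂ) ∈ W) :
    IsCompl (polar W) (Subalgebra.toSubmodule (holomorphicAtZero hW h0)) := by
  constructor
  · rw [Submodule.disjoint_def]
    rintro g ⟨p, hp0, hp⟩ ⟨c, hc⟩
    have h1 := ((hp.hasValueAtZero_iff hW h0).1 hc).comp tendsto_inv_ofReal_nhdsNE_zero
    have h2 := polynomial_eq_zero_of_tendsto (p := p) (c := c) (by
      simpa [Function.comp_def] using h1)
    rw [h2, Polynomial.coeff_C_zero] at hp0
    rw [hp.eq_iff Represents.zero, h2, hp0]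
    exact Eventually.of_forall fun z => by simp
  · rw [codisjoint_iff, Submodule.eq_top_iff']
    intro g
    obtain ⟨f, hf⟩ := g.exists_represents
    obtain ⟨m, hm⟩ := hf.meromorphicAt h0
    obtain ⟨p, hp, c, hc⟩ := exists_polynomial_tendsto_sub m hm
    have hP : (mk (W := W) _ (meromorphicOn_eval_inv p)).Represents _ := ⟨_, rfl⟩
    refine Submodule.mem_sup.2 ⟨mk _ (meromorphicOn_eval_inv p), ⟨p, hp, hP⟩, g - mk _ (meromorphicOn_eval_inv p),
      ⟨c, ?_⟩, by abel⟩
    have h1 := hf.add (hP.smul (-1))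
    rw [neg_one_smul, ← sub_eq_add_neg] at h1
    rw [h1.hasValueAtZero_iff hW h0]
    refine hc.congr' ?_
    filter_upwards [self_mem_nhdsWithin] with z hz
    have hz : z ≠ 0 := hz
    have h2 : z ^ m * z⁻¹ ^ m = 1 := by rw [← mul_pow, mul_inv_cancel₀ hz, one_pow]
    rw [sub_zero, smul_eq_mul, mul_right_comm, h2]
    ring

end Mero

/-! ### Linearity of finite parts. -/

lemma HasFinitePart.add {F G : ℝ → ℂ} {c d : ℂ} (hF : HasFinitePart F c) (hG : HasFinitePart G d) :
    HasFinitePart (fun R => F R + G R) (c + d) := by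
  classical
  obtain ⟨s, a, hs, h⟩ := hF
  obtain ⟨s', a', hs', h'⟩ := hG
  refine ⟨s ∪ s', fun p => (if p ∈ s then a p else 0) + (if p ∈ s' then a' p else 0), by
    simp [hs, hs'], (h.add h').congr fun R => ?_⟩
  have h1 : ∀ (t : Finset (ℂ × ℕ)) (b : ℂ × ℕ → ℂ), t ⊆ s ∪ s' →
      ∑ p ∈ s ∪ s', (if p ∈ t then b p else 0) * (R : ℂ) ^ p.1 * (Real.log R : ℂ) ^ p.2 =
        ∑ p ∈ t, b p * (R : ℂ) ^ p.1 * (Real.log R : ℂ) ^ p.2 := fun t b ht => by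
    simp only [ite_mul, zero_mul, Finset.sum_ite_mem, Finset.inter_eq_right.2 ht]
  simp only [add_mul, Finset.sum_add_distrib]
  rw [h1 s a Finset.subset_union_left, h1 s' a' Finset.subset_union_right]
  ring

lemma HasFinitePart.const_mul {F : ℝ → ℂ} {c : ℂ} (hF : HasFinitePart F c) (b : ℂ) :
    HasFinitePart (fun R => b * F R) (b * c) := by
  obtain ⟨s, a, hs, h⟩ := hF
  refine ⟨s, fun p => b * a p, hs, (h.const_mul b).congr fun R => ?_⟩
  simp only [mul_sub, Finset.mul_sum, mul_assoc]

lemma hasFinitePart_const (c : ℂ) : HasFinitePart (fun _ => c) c :=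
  ⟨∅, 0, by simp, by simp⟩

lemma HasFinitePart.list_sum {X : Type*} {F : X → ℝ → ℂ} {c : X → ℂ} {L : List X}
    (h : ∀ x ∈ L, HasFinitePart (F x) (c x)) :
    HasFinitePart (fun R => (L.map fun x => F x R).sum) (L.map c).sum := by
  induction L with
  | nil => simpa using hasFinitePart_const 0
  | cons x L ih =>
    simp only [List.mem_cons, forall_eq_or_imp] at h
    simpa using h.1.add (ih h.2)

/-! ### Cut-off Chen integrals of symbols as multilinear maps. -/

section symbols

variable {n : ℕ} {N : Seminorm ℝ (Space n)}

lemma continuous_symbol (f : Symbols N) : Continuous (f : Space n → ℂ) := by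
  obtain ⟨f, hf⟩ := f
  induction hf using Submodule.span_induction with
  | mem f hf => exact hf.choose_spec.1.continuous
  | zero => exact continuous_const
  | add f g _ _ hf hg => exact hf.add hg
  | smul c f _ hf => exact hf.const_smul c

/-- Sums of symbols mix arbitrary orders, so the exponents are not tracked here; the existence of
finite parts does not need them. -/
lemma IsSmoothNorm.hasExpansion_radial (hN : IsSmoothNorm N) (f : Symbols N) (M : ℝ) :
    HasExpansion Set.univ M (radial N f) := by
  obtain ⟨f, hf⟩ := f
  induction hf using Submodule.span_induction with
  | mem f hf =>
    obtain ⟨α, hf, a, ha⟩ := hf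
    exact (ha.hasExpansion_radial hN hf.continuous M).mono (Set.subset_univ _) le_rfl
  | zero => exact HasExpansion.zero.congr (Eventually.of_forall fun R => by simp [radial_zero])
  | add f g hf' hg' hf hg =>
    refine (hf.add hg).congr (Eventually.of_forall fun R => ?_)
    simp only [radial_add hN (continuous_symbol ⟨f, hf'⟩) (continuous_symbol ⟨g, hg'⟩),
      Pi.add_apply]
  | smul c f _ hf =>
    exact (hf.const_mul c).congr (Eventually.of_forall fun R => by simp [radial_smul])

lemma IsSmoothNorm.hasFinitePart_iterInt (hN : IsSmoothNorm N) (r : ℝ) (l : List (Symbols N)) :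
    HasFinitePart (iterInt r (l.map fun f : Symbols N => radial N f))
      (finitePart (iterInt r (l.map fun f : Symbols N => radial N f))) := by
  have h := hasExpansion_iterInt (a := fun f : Symbols N => radial N f) (E := fun _ => Set.univ)
    (l := l) (fun f _ => hN.continuous_radial (continuous_symbol f))
    (fun f _ M => hN.hasExpansion_radial f M) r 1
  obtain ⟨c, hc⟩ := h.exists_hasFinitePart one_pos
  rwa [hc.finitePart_eq]

variable {r : ℝ}

lemma IsSmoothNorm.cutoffChen_eq_finitePart (hN : IsSmoothNorm N) (hn : 0 < n) (hr : 0 ≤ r) {k : ℕ}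
    (σ : Fin k → Symbols N) : HasFinitePart (fun R => chenIntegral N r R fun i => σ i)
      (finitePart (iterInt r ((List.ofFn σ).map fun f : Symbols N => radial N f))) := by
  rw [hN.cutoffChen_eq hn hr fun i => continuous_symbol (σ i)]
  have := hN.hasFinitePart_iterInt r (List.ofFn σ)
  rwa [List.map_ofFn] at this ⊢

lemma IsSmoothNorm.hasFinitePart_cutoffChen (hN : IsSmoothNorm N) (hn : 0 < n) (hr : 0 ≤ r) {k : ℕ}
    (σ : Fin k → Symbols N) : HasFinitePart (fun R => chenIntegral N r R fun i => σ i)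
      (cutoffChen N r fun i => (σ i : Space n → ℂ)) := by
  have := hN.cutoffChen_eq_finitePart hn hr σ
  rwa [← this.finitePart_eq] at this

/-- The Chen integral of symbols, as a multilinear map. -/
def chenMultilinear (hN : IsSmoothNorm N) (r R : ℝ) (k : ℕ) :
    MultilinearMap ℂ (fun _ : Fin k => Symbols N) ℂ where
  toFun σ := chenIntegral N r R fun i => σ i
  map_update_add' σ i f g := by
    have h := fun ξ : Fin k → Space n => ((MultilinearMap.mkPiAlgebra ℂ (Fin k) ℂ).compLinearMap
      fun i => LinearMap.proj (ξ i) ∘ₗ (Symbols N).subtype).map_update_add σ i f g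
    simp only [MultilinearMap.compLinearMap_apply, MultilinearMap.mkPiAlgebra_apply,
      LinearMap.comp_apply, LinearMap.proj_apply, Submodule.subtype_apply] at h
    simp only [chenIntegral, h]
    exact integral_add (hN.integrableOn_chenDomain r R fun i => continuous_symbol _)
      (hN.integrableOn_chenDomain r R fun i => continuous_symbol _)
  map_update_smul' σ i c f := by
    have h := fun ξ : Fin k → Space n => ((MultilinearMap.mkPiAlgebra ℂ (Fin k) ℂ).compLinearMap
      fun i => LinearMap.proj (ξ i) ∘ₗ (Symbols N).subtype).map_update_smul σ i c f
    simp only [MultilinearMap.compLinearMap_apply, MultilinearMap.mkPiAlgebra_apply,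
      LinearMap.comp_apply, LinearMap.proj_apply, Submodule.subtype_apply] at h
    simp only [chenIntegral, h]
    exact integral_smul c _

/-- The cut-off Chen integral of symbols, as a multilinear map. -/
def cutoffChenMultilinear (hN : IsSmoothNorm N) (hn : 0 < n) (hr : 0 ≤ r) (k : ℕ) :
    MultilinearMap ℂ (fun _ : Fin k => Symbols N) ℂ where
  toFun σ := cutoffChen N r fun i => σ i
  map_update_add' σ i f g := by
    refine (hN.hasFinitePart_cutoffChen hn hr _).unique
      (((hN.hasFinitePart_cutoffChen hn hr _).add (hN.hasFinitePart_cutoffChen hn hr _)).congr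
        (Eventually.of_forall fun R => ?_))
    exact ((chenMultilinear hN r R k).map_update_add σ i f g).symm
  map_update_smul' σ i c f := by
    refine (hN.hasFinitePart_cutoffChen hn hr _).unique
      (((hN.hasFinitePart_cutoffChen hn hr _).const_mul c).congr
        (Eventually.of_forall fun R => ?_))
    exact ((chenMultilinear hN r R k).map_update_smul σ i c f).symm

end symbols

/-! ### Exponents moving with the parameter. -/

/-- A family of sets of exponents contained in finitely many families `β + ℤ`, with `β` holomorphic
and `Re β' < 0`. -/
def IsMovingExponents (W : Set ℂ) (E : ℂ → Set ℂ) : Prop :=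
  ∃ Γ : Set (ℂ → ℂ), Γ.Finite ∧ (∀ β ∈ Γ, DifferentiableOn ℂ β W ∧ ∀ z ∈ W, (deriv β z).re < 0) ∧
    ∀ z ∈ W, ∀ e ∈ E z, ∃ β ∈ Γ, ∃ j : ℤ, e = β z + j

namespace IsMovingExponents

variable {W : Set ℂ} {E E' : ℂ → Set ℂ}

lemma empty : IsMovingExponents W fun _ => ∅ :=
  ⟨∅, Set.finite_empty, by simp, by simp⟩

lemma union (h : IsMovingExponents W E) (h' : IsMovingExponents W E') :
    IsMovingExponents W fun z => E z ∪ E' z := by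
  obtain ⟨Γ, hf, hΓ, hE⟩ := h
  obtain ⟨Γ', hf', hΓ', hE'⟩ := h'
  refine ⟨Γ ∪ Γ', hf.union hf', ?_, ?_⟩
  · rintro β (hβ | hβ)
    exacts [hΓ β hβ, hΓ' β hβ]
  · rintro z hz e (he | he)
    · obtain ⟨β, hβ, h⟩ := hE z hz e he
      exact ⟨β, Or.inl hβ, h⟩
    · obtain ⟨β, hβ, h⟩ := hE' z hz e he
      exact ⟨β, Or.inr hβ, h⟩

/-- Negativity of Re β', unlike mere nonvanishing of β', is stable under addition; this is why the
orders of a regularisation must all move to the same side. -/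
lemma add (hW : IsOpen W) (h : IsMovingExponents W E) (h' : IsMovingExponents W E') :
    IsMovingExponents W fun z => E z + E' z := by
  obtain ⟨Γ, hf, hΓ, hE⟩ := h
  obtain ⟨Γ', hf', hΓ', hE'⟩ := h'
  refine ⟨Γ + Γ', hf.add hf', ?_, ?_⟩
  · rintro _ ⟨β, hβ, β', hβ', rfl⟩
    refine ⟨(hΓ β hβ).1.add (hΓ' β' hβ').1, fun z hz => ?_⟩
    rw [deriv_add ((hΓ β hβ).1.differentiableAt (hW.mem_nhds hz))
      ((hΓ' β' hβ').1.differentiableAt (hW.mem_nhds hz)), Complex.add_re]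
    linarith [(hΓ β hβ).2 z hz, (hΓ' β' hβ').2 z hz]
  · rintro z hz _ ⟨e, he, e', he', rfl⟩
    obtain ⟨β, hβ, j, rfl⟩ := hE z hz e he
    obtain ⟨β', hβ', j', rfl⟩ := hE' z hz e' he'
    refine ⟨β + β', ⟨β, hβ, β', hβ', rfl⟩, j + j', ?_⟩
    simp only [Pi.add_apply, Int.cast_add]
    ring

lemma add_one (h : IsMovingExponents W E) : IsMovingExponents W fun z => E z + {1} := by
  obtain ⟨Γ, hf, hΓ, hE⟩ := h
  refine ⟨Γ, hf, hΓ, ?_⟩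
  rintro z hz _ ⟨e, he, _, rfl, rfl⟩
  obtain ⟨β, hβ, j, rfl⟩ := hE z hz e he
  exact ⟨β, hβ, j + 1, by push_cast; ring⟩

lemma iUnion_exponents {ι : Type*} [Finite ι] (n : ℕ) {α : ι → ℂ → ℂ}
    (hα : ∀ i, DifferentiableOn ℂ (α i) W ∧ ∀ z ∈ W, (deriv (α i) z).re < 0) :
    IsMovingExponents W fun z => ⋃ i, exponents n (α i z) := by
  refine ⟨Set.range α, Set.finite_range α, by rintro _ ⟨i, rfl⟩; exact hα i, ?_⟩
  rintro z _ e he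
  obtain ⟨i, j, rfl⟩ := Set.mem_iUnion.1 he
  exact ⟨α i, ⟨i, rfl⟩, (n - 1 : ℕ) - j, by push_cast; ring⟩

lemma leftSums (hW : IsOpen W) {X : Type*} {E : X → ℂ → Set ℂ} {l : List X}
    (h : ∀ x ∈ l, IsMovingExponents W (E x)) :
    IsMovingExponents W fun z => leftSums (l.map (E · z)) := by
  induction l with
  | nil => exact empty
  | cons x l ih =>
    simp only [List.mem_cons, forall_eq_or_imp] at h
    have h1 := h.1.add_one.union (h.1.add_one.add hW (ih h.2))
    convert h1 using 2 with z
    rw [List.map_cons, ChenRenorm.leftSums, Set.add_union, Set.singleton_zero, add_zero]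

/-- If 0 ∈ E(w), then some β(w) is an integer, that is, exp(2πiβ(w)) = 1. The exponential treats all
integers at once, and its derivative at z is nonzero since β'(z) ≠ 0, so the value 1 is avoided in a
punctured neighbourhood. -/
lemma eventually_zero_notMem (hW : IsOpen W) (h : IsMovingExponents W E) {z : ℂ} (hz : z ∈ W) :
    ∀ᶠ w in 𝓝[≠] z, 0 ∉ E w := by
  obtain ⟨Γ, hf, hΓ, hE⟩ := h
  have h1 : ∀ᶠ w in 𝓝[≠] z, ∀ β ∈ Γ, Complex.exp (2 * Real.pi * Complex.I * β w) ≠ 1 := by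
    refine (Set.Finite.eventually_all hf).2 fun β hβ => ?_
    have hd := ((hΓ β hβ).1.differentiableAt (hW.mem_nhds hz)).hasDerivAt
    refine ((hd.const_mul (2 * Real.pi * Complex.I)).cexp).eventually_ne ?_
    refine mul_ne_zero (Complex.exp_ne_zero _) (mul_ne_zero Complex.two_pi_I_ne_zero fun h0 => ?_)
    have := (hΓ β hβ).2 z hz
    simp [h0] at this
  filter_upwards [h1, mem_nhdsWithin_of_mem_nhds (hW.mem_nhds hz)] with w hw hwW h0
  obtain ⟨β, hβ, j, hj⟩ := hE w hwW 0 h0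
  refine hw β hβ (Complex.exp_eq_one_iff.2 ⟨-j, ?_⟩)
  have : β w = -j := by linear_combination -hj
  rw [this]
  push_cast
  ring

end IsMovingExponents

/-! ### The regularised Chen integral as a meromorphic shuffle character. -/

section regularisation

variable {n : ℕ} {N : Seminorm ℝ (Space n)} {W : Set ℂ} {R : ℂ → Symbols N →ₗ[ℂ] Symbols N}
  {r : ℝ}

lemma IsHolomorphicRegularisation.exists_exponents (hR : IsHolomorphicRegularisation N W R)
    (hN : IsSmoothNorm N) (hW : IsOpen W) (f : Symbols N) :
    ∃ E : ℂ → Set ℂ, IsMovingExponents W E ∧ ∀ z₀ ∈ W, ∃ B : ℝ, ∀ M : ℝ, ∃ V : Set ℂ,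
      IsOpen V ∧ z₀ ∈ V ∧ IsRadialFamily V E B M (fun z => radial N (R z f)) := by
  obtain ⟨s, α, g, hg, hf⟩ := hR.2 f
  refine ⟨fun z => ⋃ i, exponents n (α i z),
    IsMovingExponents.iUnion_exponents n fun i => ⟨(hg i).1.1, (hg i).2⟩, fun z₀ hz₀ => ?_⟩
  choose B hB using fun i => (hg i).1.exists_isRadialFamily hN hW hz₀
  obtain ⟨C, hC⟩ := Finite.exists_le B
  refine ⟨C, fun M => ?_⟩
  choose V hVo hVz hV using fun i => hB i M
  refine ⟨(⋂ i, V i) ∩ W, (isOpen_iInter_of_finite hVo).inter hW,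
    ⟨Set.mem_iInter.2 hVz, hz₀⟩, ?_⟩
  have h := IsRadialFamily.sum (s := Finset.univ) (M := M) (B := C) (V := (⋂ i, V i) ∩ W)
    (E := fun z => ⋃ i, exponents n (α i z)) fun i _ =>
      (hV i).mono (Set.inter_subset_left.trans (Set.iInter_subset V i))
        (fun z _ => Set.subset_iUnion (fun i => exponents n (α i z)) i) (hC i) le_rfl
  refine h.congr fun z hz => ?_
  rw [hf z hz.2, radial_sum hN]
  · funext t
    rw [Finset.sum_apply]
  · intro i _
    exact continuousOn_univ.1 ((hg i).1.2.1.1 z hz.2).continuousOn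

/-- The finite part of the regularised iterated integral of a word of symbols. -/
def regularisedIntegral (R : ℂ → Symbols N →ₗ[ℂ] Symbols N) (r : ℝ) (l : List (Symbols N))
    (z : ℂ) : ℂ :=
  finitePart (iterInt r (l.map fun f => radial N (R z f)))

lemma hasFinitePart_regularisedIntegral (hN : IsSmoothNorm N) (l : List (Symbols N)) (z : ℂ) :
    HasFinitePart (iterInt r (l.map fun f => radial N (R z f))) (regularisedIntegral R r l z) := by
  have := hN.hasFinitePart_iterInt r (l.map (R z))
  rwa [List.map_map] at this

lemma cutoffChen_eq_regularisedIntegral (hN : IsSmoothNorm N) (hn : 0 < n) (hr : 0 ≤ r) {k : ℕ}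
    (σ : Fin k → Symbols N) (z : ℂ) :
    cutoffChen N r (fun i => (R z (σ i) : Space n → ℂ)) =
      regularisedIntegral R r (List.ofFn σ) z := by
  have h := (hN.cutoffChen_eq_finitePart hn hr fun i => R z (σ i)).finitePart_eq
  rw [List.map_ofFn] at h
  rw [regularisedIntegral, List.map_ofFn]
  exact h

lemma IsHolomorphicRegularisation.meromorphicOn (hR : IsHolomorphicRegularisation N W R)
    (hN : IsSmoothNorm N) (hW : IsOpen W) (l : List (Symbols N)) :
    MeromorphicOn (regularisedIntegral R r l) W := by
  intro z hz
  choose E hE hE' using hR.exists_exponents hN hW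
  refine meromorphicAt_finitePart_iterInt (a := fun f z => radial N (R z f)) (E := E)
    (fun f _ => hE' f z hz) ?_ ?_ r
  · filter_upwards [hW.mem_nhds hz] with w hw f _ M
    obtain ⟨B, hB⟩ := hE' f w hw
    obtain ⟨V, -, hwV, hV⟩ := hB M
    exact hV.hasExpansion hwV
  · exact (IsMovingExponents.leftSums hW fun f _ => hE f).eventually_zero_notMem hW hz

/-- The left sums of u, those of v, and the sums of one of each are all moving exponents. Near z but
away from it none of them is 0, so the finite part of the product is the product of the finite
parts. -/
lemma IsHolomorphicRegularisation.sum_shuffles (hR : IsHolomorphicRegularisation N W R)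
    (hN : IsSmoothNorm N) (hW : IsOpen W) (u v : List (Symbols N)) {z : ℂ} (hz : z ∈ W) :
    ∀ᶠ w in 𝓝[≠] z, ((shuffles u v).map fun l => regularisedIntegral R r l w).sum =
      regularisedIntegral R r u w * regularisedIntegral R r v w := by
  choose E hE hE' using hR.exists_exponents hN hW
  have hu := IsMovingExponents.leftSums hW (l := u) fun f _ => hE f
  have hv := IsMovingExponents.leftSums hW (l := v) fun f _ => hE f
  filter_upwards [hu.eventually_zero_notMem hW hz, hv.eventually_zero_notMem hW hz,
    (hu.add hW hv).eventually_zero_notMem hW hz, mem_nhdsWithin_of_mem_nhds (hW.mem_nhds hz)]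
    with w h1 h2 h3 hw
  have hexp : ∀ f M, HasExpansion (E f w) M (radial N (R w f)) := fun f M => by
    obtain ⟨B, hB⟩ := hE' f w hw
    obtain ⟨V, -, hwV, hV⟩ := hB M
    exact hV.hasExpansion hwV
  have hc : ∀ f : Symbols N, Continuous (radial N (R w f)) := fun f =>
    hN.continuous_radial (continuous_symbol _)
  have hprod := HasFinitePart.mul_of_hasExpansion h1 h2 h3
    (F := iterInt r (u.map fun f => radial N (R w f)))
    (G := iterInt r (v.map fun f => radial N (R w f)))
    (exists_hasExpansion_iterInt (fun f _ => hc f) (fun f _ => hexp f) r)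
    (exists_hasExpansion_iterInt (fun f _ => hc f) (fun f _ => hexp f) r)
  refine (HasFinitePart.list_sum (L := shuffles u v)
    fun l _ => hasFinitePart_regularisedIntegral (R := R) (r := r) hN l w).unique
      (hprod.congr (Eventually.of_forall fun t => ?_))
  have := sum_iterInt_shuffles (r := r) (u := u.map fun f => radial N (R w f))
    (v := v.map fun f => radial N (R w f)) (List.forall_mem_map.2 fun f _ => hc f)
    (List.forall_mem_map.2 fun f _ => hc f) t
  rw [shuffles_map, List.map_map] at this
  exact this.symm

/-- The regularised cut-off Chen integrals on `V^{⊗ k}`, as a multilinear map. -/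
def chenMero (hR : IsHolomorphicRegularisation N W R) (hN : IsSmoothNorm N) (hn : 0 < n)
    (hW : IsOpen W) (hr : 0 ≤ r) (k : ℕ) :
    MultilinearMap ℂ (fun _ : Fin k => Symbols N) (Mero W) where
  toFun σ := Mero.mk (fun z => cutoffChen N r (fun i => (R z (σ i) : Space n → ℂ))) (by
    simp only [cutoffChen_eq_regularisedIntegral hN hn hr]
    exact hR.meromorphicOn hN hW _)
  map_update_add' σ i f g := by
    refine Mero.mk_eq_mk_iff.2 (Eventually.of_forall fun z => ?_)
    exact ((cutoffChenMultilinear hN hn hr k).compLinearMap fun _ => R z).map_update_add σ i f g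
  map_update_smul' σ i c f := by
    refine Mero.mk_eq_mk_iff.2 (Eventually.of_forall fun z => ?_)
    exact ((cutoffChenMultilinear hN hn hr k).compLinearMap fun _ => R z).map_update_smul σ i c f

/-- The regularised cut-off Chen integrals on `𝒯(V)`. -/
def chenCharacter (hR : IsHolomorphicRegularisation N W R) (hN : IsSmoothNorm N) (hn : 0 < n)
    (hW : IsOpen W) (hr : 0 ≤ r) : Tensors (Symbols N) →ₗ[ℂ] Mero W :=
  DirectSum.toModule ℂ ℕ _ fun k => PiTensorProduct.lift (chenMero hR hN hn hW hr k)

lemma chenCharacter_represents (hR : IsHolomorphicRegularisation N W R) (hN : IsSmoothNorm N)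
    (hn : 0 < n) (hW : IsOpen W) (hr : 0 ≤ r) {k : ℕ} (σ : Fin k → Symbols N) :
    (chenCharacter hR hN hn hW hr (pureTensor σ)).Represents
      (fun z => cutoffChen N r (fun i => (R z (σ i) : Space n → ℂ))) := by
  have : chenCharacter hR hN hn hW hr (pureTensor σ) = chenMero hR hN hn hW hr k σ := by
    simp [chenCharacter, pureTensor, ofDeg]
  rw [this]
  exact ⟨_, rfl⟩

lemma chenCharacter_word_represents (hR : IsHolomorphicRegularisation N W R) (hN : IsSmoothNorm N)
    (hn : 0 < n) (hW : IsOpen W) (hr : 0 ≤ r) (l : List (Symbols N)) :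
    (chenCharacter hR hN hn hW hr (word l)).Represents (regularisedIntegral R r l) := by
  have := chenCharacter_represents hR hN hn hW hr l.get
  simp only [cutoffChen_eq_regularisedIntegral hN hn hr, List.ofFn_get] at this
  exact this

lemma Mero.Represents.list_sum {X : Type*} {L : List X} {g : X → Mero W} {f : X → ℂ → ℂ}
    (h : ∀ x ∈ L, (g x).Represents (f x)) :
    (L.map g).sum.Represents (fun z => (L.map fun x => f x z).sum) := by
  induction L with
  | nil => simpa using Mero.Represents.zero
  | cons x L ih =>
    simp only [List.mem_cons, forall_eq_or_imp] at h
    simpa using h.1.add (ih h.2)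

lemma isShuffleCharacter_chenCharacter (hR : IsHolomorphicRegularisation N W R)
    (hN : IsSmoothNorm N) (hn : 0 < n) (hW : IsOpen W) (hr : 0 ≤ r) :
    IsShuffleCharacter (chenCharacter hR hN hn hW hr) := by
  rw [isShuffleCharacter_iff]
  constructor
  · rw [(chenCharacter_word_represents hR hN hn hW hr []).eq_iff Mero.Represents.one]
    exact Eventually.of_forall fun z => (hasFinitePart_const 1).finitePart_eq
  · intro u v
    rw [(Mero.Represents.list_sum fun l _ => chenCharacter_word_represents hR hN hn hW hr l).eq_iff
      ((chenCharacter_word_represents hR hN hn hW hr u).mul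
        (chenCharacter_word_represents hR hN hn hW hr v))]
    exact (eventually_codiscreteWithin_iff hW).2 fun z hz => hR.sum_shuffles hN hW u v hz

end regularisation

/-! ### The Birkhoff decomposition over `Mero W`. -/

section birkhoff

variable {V : Type} [AddCommGroup V] [Module ℂ V]

/-- By induction on length φ vanishes on the nonempty prefixes p of l: if it vanishes on the shorter
ones, then φ(p) = (φ ⋆ Φ)(p) − Φ(p) lies in P and in H. The left factors in a deconcatenation are
prefixes, which is why left partial sums enter the theorem. -/
lemma birkhoff_eq_of_mem {A : Type} [CommRing A] [Algebra ℂ A] {P H : Submodule ℂ A}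
    (hPH : IsCompl P H) {Φ φ : Tensors V →ₗ[ℂ] A} (hΦ : Φ (word []) = 1) (h1 : φ (word []) = 1)
    (hφ : ∀ l, l ≠ [] → φ (word l) ∈ P) (hH : ∀ l, convolution φ Φ (word l) ∈ H) {l : List V}
    (hl : ∀ p, p ≠ [] → p <+: l → Φ (word p) ∈ H) : convolution φ Φ (word l) = Φ (word l) := by
  have key : ∀ (a : V) (p : List V), (∀ q, q.length ≤ p.length → q ≠ [] → q <+: a :: p →
      φ (word q) = 0) → convolution φ Φ (word (a :: p)) = Φ (word (a :: p)) + φ (word (a :: p)) := by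
    intro a p h
    rw [convolution_word, deconc_cons, deconc_eq_last, h1, hΦ, one_mul, mul_one]
    intro q s hqs hs
    rw [h (a :: q) _ (List.cons_ne_nil _ _) ⟨s, by rw [← hqs, List.cons_append]⟩, zero_mul]
    rw [← hqs, List.length_append, List.length_cons]
    have := List.length_pos_iff.2 hs
    omega
  have hzero : ∀ (m : ℕ) (p : List V), p.length = m → p ≠ [] → p <+: l → φ (word p) = 0 := by
    intro m
    induction m using Nat.strong_induction_on with
    | _ m ih =>
    rintro p rfl hp hpl
    obtain _ | ⟨a, p⟩ := p
    · exact absurd rfl hp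
    have h2 := key a p fun q hq hq0 hqp =>
      ih q.length (Nat.lt_succ_of_le hq) q rfl hq0 (hqp.trans hpl)
    refine eq_of_mem_of_isCompl hPH (by simpa using hφ _ hp) ?_
    rw [sub_zero, ← sub_eq_iff_eq_add'.2 h2]
    exact H.sub_mem (hH _) (hl _ hp hpl)
  obtain _ | ⟨a, p⟩ := l
  · simp [convolution_word, h1]
  rw [key a p fun q _ hq0 hqp => hzero _ q rfl hq0 hqp,
    hzero _ _ rfl (List.cons_ne_nil a p) (List.prefix_refl _), add_zero]

variable {W : Set ℂ} {Φ Φm Φp : Tensors V →ₗ[ℂ] Mero W}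

lemma IsBirkhoffDecomposition.plus_eq (h : IsBirkhoffDecomposition Φ Φm Φp) :
    Φp = convolution Φm Φ := by
  obtain ⟨Ψ, -, h2, h3⟩ := h.factorisation
  rw [h3, ← convolution_assoc, h2, unit_convolution]

lemma IsBirkhoffDecomposition.minus_nil (h : IsBirkhoffDecomposition Φ Φm Φp) :
    Φm (word []) = 1 :=
  (isShuffleCharacter_iff.1 h.character_minus).1

lemma IsBirkhoffDecomposition.minus_mem_polar (h : IsBirkhoffDecomposition Φ Φm Φp) {l : List V}
    (hl : l ≠ []) : Φm (word l) ∈ Mero.polar W :=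
  h.polar_minus l.length (List.length_pos_iff.2 hl) _

lemma IsBirkhoffDecomposition.plus_mem (h : IsBirkhoffDecomposition Φ Φm Φp) (hW : IsOpen W)
    (h0 : (0 : ℂ) ∈ W) (x : Tensors V) :
    convolution Φm Φ x ∈ Subalgebra.toSubmodule (Mero.holomorphicAtZero hW h0) := by
  rw [← h.plus_eq]
  exact h.holomorphic_plus x

theorem exists_isBirkhoffDecomposition (hW : IsOpen W) (h0 : (0 : ℂ) ∈ W)
    (hΦ : IsShuffleCharacter Φ) : ∃ Φm Φp, IsBirkhoffDecomposition Φ Φm Φp := by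
  obtain ⟨Φm, h1, h2, h3⟩ := exists_birkhoff (fun _ hx _ hy => Mero.mul_mem_polar hx hy)
    (Mero.isCompl_polar hW h0) hΦ
  obtain ⟨Ψ, h4, h5⟩ := exists_convolution_inverse (isShuffleCharacter_iff.1 h1).1
  refine ⟨Φm, convolution Φm Φ, h1, h1.convolution hΦ,
    fun k hk x => mem_of_forall_word_ne_nil h2 hk x, h3, Ψ, h4, h5, ?_⟩
  rw [← convolution_assoc, h4, unit_convolution]

theorem IsBirkhoffDecomposition.unique (hW : IsOpen W) (h0 : (0 : ℂ) ∈ W)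
    (hΦ : IsShuffleCharacter Φ) {Φm' Φp' : Tensors V →ₗ[ℂ] Mero W}
    (h : IsBirkhoffDecomposition Φ Φm Φp) (h' : IsBirkhoffDecomposition Φ Φm' Φp') :
    Φm' = Φm ∧ Φp' = Φp := by
  have : Φm' = Φm := birkhoff_unique (Mero.isCompl_polar hW h0) (isShuffleCharacter_iff.1 hΦ).1
    h'.minus_nil h.minus_nil (fun _ hl => h'.minus_mem_polar hl) (fun _ hl => h.minus_mem_polar hl)
    (fun l => h'.plus_mem hW h0 _) (fun l => h.plus_mem hW h0 _)
  exact ⟨this, by rw [h.plus_eq, h'.plus_eq, this]⟩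

theorem IsBirkhoffDecomposition.exists_value (hW : IsOpen W) (h0 : (0 : ℂ) ∈ W)
    (h : IsBirkhoffDecomposition Φ Φm Φp) :
    ∃ φ : Tensors V →ₗ[ℂ] ℂ, (∀ x, (Φp x).HasValueAtZero (φ x)) ∧ IsShuffleCharacter φ := by
  choose φ hφ using h.holomorphic_plus
  refine ⟨{ toFun := φ, map_add' := fun x y => ?_, map_smul' := fun c x => ?_ }, hφ, ?_, ?_⟩
  · refine (hφ _).unique hW h0 ?_
    rw [map_add]
    exact (hφ x).add hW h0 (hφ y)
  · refine (hφ _).unique hW h0 ?_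
    rw [map_smul, Algebra.smul_def]
    exact (Mero.hasValueAtZero_algebraMap c).mul hW h0 (hφ x)
  · refine (hφ _).unique hW h0 ?_
    rw [h.character_plus.1]
    simpa using Mero.hasValueAtZero_algebraMap (W := W) 1
  · intro x y
    refine (hφ _).unique hW h0 ?_
    rw [h.character_plus.2]
    exact (hφ x).mul hW h0 (hφ y)

/-- In degree one Φ₊ = Φ + Φ₋, so Φ₋ is minus the principal part of Φ. -/
theorem IsBirkhoffDecomposition.isFinitePartAtZero (hW : IsOpen W) (h0 : (0 : ℂ) ∈ W)
    (hΦ : IsShuffleCharacter Φ) (h : IsBirkhoffDecomposition Φ Φm Φp) {v : V} {c : ℂ}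
    (hc : (Φp (word [v])).HasValueAtZero c) {f : ℂ → ℂ} (hf : (Φ (word [v])).Represents f) :
    IsFinitePartAtZero f c := by
  obtain ⟨p, hp, hp'⟩ := h.minus_mem_polar (List.cons_ne_nil v [])
  refine ⟨-p, by simp [hp], ?_⟩
  have h1 : Φp (word [v]) = Φ (word [v]) + Φm (word [v]) := by
    rw [h.plus_eq, convolution_word, deconc_cons, deconc_nil, h.minus_nil,
      (isShuffleCharacter_iff.1 hΦ).1, one_mul, mul_one]
  rw [h1] at hc
  simpa using ((hf.add hp').hasValueAtZero_iff hW h0).1 hc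

end birkhoff

/-! ### The order of a symbol with nonzero expansion is determined modulo ℤ. -/

section order

variable {n : ℕ} {N : Seminorm ℝ (Space n)}

/-- Multiplication by t^(−γ) makes the homogeneous term of degree γ constant along the ray and gives
the others nonzero exponents. The bound on J makes the remainder O(1/t). -/
lemma HasSymbolExpansion.hasFinitePart_ray (hN : IsSmoothNorm N) {α : ℂ} {f : Space n → ℂ}
    {a : ℕ → Space n → ℂ} (h : HasSymbolExpansion N α f a) {ξ : Space n} (hξ : ξ ≠ 0) (γ : ℂ)
    {J : ℕ} (hJ : max α.re (α.re - γ.re) ≤ J) :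
    HasFinitePart (fun t : ℝ => f (t • ξ) * (t : ℂ) ^ (-γ))
      (∑ j ∈ Finset.range (J + 1), if α - j = γ then a j ξ else 0) := by
  have hJ1 := (le_max_left _ _).trans hJ
  have hJ2 := (le_max_right _ _).trans hJ
  obtain ⟨C, hC⟩ := h.2 J 0
  have hpos := hN.pos hξ
  have hC0 : 0 ≤ C := by
    have h1 := hC ((N ξ)⁻¹ • ξ) (by
      rw [map_smul_eq_mul, Real.norm_of_nonneg (by positivity), inv_mul_cancel₀ hpos.ne'])
    exact nonneg_of_mul_nonneg_left ((norm_nonneg _).trans h1) (by positivity)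
  refine HasExpansion.hasFinitePart (E := {0}ᶜ) (M := 1) (by simp) one_pos ?_
  have h1 : HasExpansion {0}ᶜ 1 (fun t : ℝ => ∑ j ∈ Finset.range (J + 1),
      if α - j = γ then 0 else a j ξ * logPower (α - j - γ, 0) t) := by
    refine HasExpansion.sum fun j _ => ?_
    split_ifs with hj
    · exact HasExpansion.zero
    · exact (HasExpansion.of_mem (logPower_mem (by simpa [sub_eq_zero] using hj))).const_mul _
  have h2 : HasExpansion {0}ᶜ 1 (fun t : ℝ =>
      (f (t • ξ) - ∑ j ∈ Finset.range (J + 1), a j (t • ξ)) * (t : ℂ) ^ (-γ)) := by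
    refine HasExpansion.of_isBigO (IsBigO.of_bound (C * N ξ ^ (α.re - J - 1)) ?_)
    filter_upwards [eventually_ge_atTop 1, eventually_ge_atTop (N ξ)⁻¹] with t ht ht'
    have ht0 : 0 < t := by linarith
    have hNt : N (t • ξ) = t * N ξ := by
      rw [map_smul_eq_mul, Real.norm_of_nonneg ht0.le]
    have h3 := hC (t • ξ) (by
      rw [hNt, ← inv_mul_cancel₀ hpos.ne']
      exact mul_le_mul_of_nonneg_right ht' hpos.le)
    rw [norm_iteratedFDeriv_zero, hNt, Nat.cast_zero, sub_zero] at h3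
    rw [norm_mul, Complex.norm_cpow_eq_rpow_re_of_pos ht0, Real.norm_of_nonneg (by positivity),
      Complex.neg_re]
    have h4 : (1 + t * N ξ) ^ (α.re - J - 1) ≤ (t * N ξ) ^ (α.re - J - 1) :=
      Real.rpow_le_rpow_of_nonpos (by positivity) (by linarith) (by linarith)
    rw [Real.mul_rpow ht0.le hpos.le] at h4
    have h5 : t ^ (α.re - J - 1) * t ^ (-γ.re) ≤ t ^ (-1 : ℝ) := by
      rw [← Real.rpow_add ht0]
      exact Real.rpow_le_rpow_of_exponent_le ht (by linarith)
    calc _ ≤ C * (t ^ (α.re - J - 1) * N ξ ^ (α.re - J - 1)) * t ^ (-γ.re) :=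
          mul_le_mul_of_nonneg_right (h3.trans (mul_le_mul_of_nonneg_left h4 hC0)) (by positivity)
      _ = C * N ξ ^ (α.re - J - 1) * (t ^ (α.re - J - 1) * t ^ (-γ.re)) := by ring
      _ ≤ _ := mul_le_mul_of_nonneg_left h5 (by positivity)
  refine (h1.add h2).congr ((eventually_gt_atTop 0).mono fun t ht => ?_)
  have htc : (t : ℂ) ≠ 0 := Complex.ofReal_ne_zero.2 ht.ne'
  simp only [sub_mul, Finset.sum_mul]
  rw [add_sub_left_comm, ← Finset.sum_sub_distrib, sub_eq_add_neg _ (Finset.sum _ _),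
    ← Finset.sum_neg_distrib]
  congr 1
  refine Finset.sum_congr rfl fun j _ => ?_
  rw [(h.1 j).2 t ht ξ hξ]
  have h3 : (t : ℂ) ^ (α - j) * a j ξ * (t : ℂ) ^ (-γ) = a j ξ * (t : ℂ) ^ (α - j - γ) := by
    rw [sub_eq_add_neg _ γ, Complex.cpow_add _ _ htc]
    ring
  rw [h3]
  split_ifs with hj
  · simp [hj]
  · simp [logPower]

/-- The finite part of f(tξ)t^(−γ) with γ = α − j is computed from both expansions. The first gives
a_j(ξ) ≠ 0, whereas the second gives 0 unless β − α is an integer. -/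
lemma HasSymbolExpansion.exists_int_of_ne_zero (hN : IsSmoothNorm N) {α β : ℂ} {f : Space n → ℂ}
    {a b : ℕ → Space n → ℂ} (ha : HasSymbolExpansion N α f a) (hb : HasSymbolExpansion N β f b)
    {j : ℕ} {ξ : Space n} (hξ : ξ ≠ 0) (hj : a j ξ ≠ 0) : ∃ m : ℤ, β = α + m := by
  by_contra! hm
  obtain ⟨J, hJ⟩ := exists_nat_ge (max (max α.re (α.re - (α - j).re)) j)
  obtain ⟨J', hJ'⟩ := exists_nat_ge (max β.re (β.re - (α - j).re))
  have h1 := ha.hasFinitePart_ray hN hξ (α - j) ((le_max_left _ _).trans hJ)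
  have h2 := hb.hasFinitePart_ray hN hξ (α - j) hJ'
  have h3 := h1.unique h2
  have hjJ : j ≤ J := by exact_mod_cast (le_max_right _ _).trans hJ
  rw [Finset.sum_eq_single j, if_pos rfl, Finset.sum_eq_zero] at h3
  · exact hj h3
  · intro i _
    refine if_neg fun hi => hm (i - j) ?_
    push_cast
    linear_combination hi
  · intro i _ hij
    refine if_neg fun hi => hij ?_
    exact_mod_cast (sub_right_injective hi : (i : ℂ) = j)
  · intro hj'
    exact absurd (Finset.mem_range.2 (Nat.lt_succ_of_le hjJ)) hj'

/-- A symbol of order `α` with a nonzero term in its expansion. -/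
def HasNonzeroExpansion (N : Seminorm ℝ (Space n)) (α : ℂ) (f : Space n → ℂ) : Prop :=
  ContDiff ℝ ∞ f ∧ ∃ a, HasSymbolExpansion N α f a ∧ ∃ j ξ, ξ ≠ 0 ∧ a j ξ ≠ 0

lemma HasSymbolExpansion.add {α : ℂ} {f g : Space n → ℂ}
    {a b : ℕ → Space n → ℂ} (ha : HasSymbolExpansion N α f a) (hf : ContDiff ℝ ∞ f)
    (hb : HasSymbolExpansion N α g b) (hg : ContDiff ℝ ∞ g) :
    HasSymbolExpansion N α (f + g) (a + b) := by
  refine ⟨fun j => ⟨(ha.1 j).1.add (hb.1 j).1, fun t ht ξ hξ => ?_⟩, fun J m => ?_⟩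
  · simp only [Pi.add_apply, (ha.1 j).2 t ht ξ hξ, (hb.1 j).2 t ht ξ hξ, mul_add]
  · obtain ⟨C, hC⟩ := ha.2 J m
    obtain ⟨D, hD⟩ := hb.2 J m
    refine ⟨C + D, fun ξ hξ => ?_⟩
    have hξ0 : ξ ≠ 0 := fun h => by simp [h] at hξ; linarith
    have hs : ∀ {f : Space n → ℂ} {a : ℕ → Space n → ℂ}, ContDiff ℝ ∞ f →
        HasSymbolExpansion N α f a →
        ContDiffAt ℝ m (fun η => f η - ∑ j ∈ Finset.range (J + 1), a j η) ξ := fun hf ha =>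
      (hf.contDiffAt.sub (ContDiffAt.sum fun j _ => (ha.1 j).1.contDiffAt
        (isOpen_compl_singleton.mem_nhds hξ0))).of_le (by exact_mod_cast le_top)
    have h1 : (fun η => (f + g) η - ∑ j ∈ Finset.range (J + 1), (a + b) j η) =
        (fun η => f η - ∑ j ∈ Finset.range (J + 1), a j η) +
          fun η => g η - ∑ j ∈ Finset.range (J + 1), b j η := by
      funext η
      simp only [Pi.add_apply, Finset.sum_add_distrib]
      ring
    rw [h1, iteratedFDeriv_add_apply (hs hf ha) (hs hg hb), add_mul]
    exact (norm_add_le _ _).trans (add_le_add (hC ξ hξ) (hD ξ hξ))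

/-- A symbol equal to `c |ξ|^α` for large `ξ`. -/
def homogeneousSymbol (N : Seminorm ℝ (Space n)) (α c : ℂ) (ξ : Space n) : ℂ :=
  Real.smoothTransition (4 * N ξ - 1) * (c * Complex.exp (α * Real.log (N ξ)))

lemma IsSmoothNorm.contDiffOn_exp_log (hN : IsSmoothNorm N) (α c : ℂ) :
    ContDiffOn ℝ ∞ (fun ξ => c * Complex.exp (α * Real.log (N ξ))) {0}ᶜ := by
  refine contDiffOn_const.mul (ContDiffOn.cexp (contDiffOn_const.mul ?_))
  exact Complex.ofRealCLM.contDiff.comp_contDiffOn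
    (hN.2.log fun ξ hξ => (hN.pos hξ).ne')

lemma IsSmoothNorm.contDiff_homogeneousSymbol (hN : IsSmoothNorm N) (α c : ℂ) :
    ContDiff ℝ ∞ (homogeneousSymbol N α c) := by
  rw [contDiff_iff_contDiffAt]
  intro ξ
  by_cases hξ : ξ = 0
  · have : homogeneousSymbol N α c =ᶠ[𝓝 ξ] fun _ => 0 := by
      have h : ∀ᶠ η in 𝓝 ξ, N η < 1 / 4 :=
        (continuous_seminorm N).continuousAt.eventually_lt_const (by simp [hξ])
      filter_upwards [h] with η hη
      rw [homogeneousSymbol, Real.smoothTransition.zero_of_nonpos (by linarith)]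
      simp
    exact contDiffAt_const.congr_of_eventuallyEq this
  · have hmem : ({0}ᶜ : Set (Space n)) ∈ 𝓝 ξ := isOpen_compl_singleton.mem_nhds hξ
    refine ContDiffAt.mul ?_ ((hN.contDiffOn_exp_log α c).contDiffAt hmem)
    refine Complex.ofRealCLM.contDiff.contDiffAt.comp ξ
      (Real.smoothTransition.contDiffAt.comp ξ ?_)
    exact (contDiffAt_const.mul (hN.2.contDiffAt hmem)).sub contDiffAt_const

lemma IsSmoothNorm.hasSymbolExpansion_homogeneousSymbol (hN : IsSmoothNorm N) (α c : ℂ) :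
    HasSymbolExpansion N α (homogeneousSymbol N α c)
      (fun j ξ => if j = 0 then c * Complex.exp (α * Real.log (N ξ)) else 0) := by
  refine ⟨fun j => ?_, fun J m => ⟨0, fun ξ hξ => ?_⟩⟩
  · by_cases hj : j = 0
    · subst hj
      refine ⟨by simpa using hN.contDiffOn_exp_log α c, fun t ht ξ hξ => ?_⟩
      have hpos := hN.pos hξ
      simp only [if_true, Nat.cast_zero, sub_zero]
      rw [map_smul_eq_mul, Real.norm_of_nonneg ht.le,
        Real.log_mul ht.ne' hpos.ne', Complex.cpow_def_of_ne_zero (Complex.ofReal_ne_zero.2 ht.ne'),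
        ← Complex.ofReal_log ht.le, mul_left_comm, ← Complex.exp_add]
      congr 2
      push_cast
      ring
    · simp only [if_neg hj]
      exact ⟨contDiffOn_const, fun t _ ξ _ => by simp⟩
  · have h : ∀ᶠ η in 𝓝 ξ, 1 / 2 < N η :=
      (continuous_seminorm N).continuousAt.eventually_const_lt (by linarith)
    have h1 : (fun η => homogeneousSymbol N α c η - ∑ j ∈ Finset.range (J + 1),
        if j = 0 then c * Complex.exp (α * Real.log (N η)) else 0) =ᶠ[𝓝 ξ] fun _ => 0 := by
      filter_upwards [h] with η hη
      rw [homogeneousSymbol, Real.smoothTransition.one_of_one_le (by linarith),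
        Finset.sum_ite_eq' (Finset.range (J + 1)), if_pos (by simp)]
      simp
    rw [(h1.iteratedFDeriv ℝ m).eq_of_nhds, zero_mul, iteratedFDeriv_fun_zero]
    simp

/-- A symbol equal to c|ξ|^α at infinity is added and subtracted, with c such that both summands
have a nonzero leading term. -/
lemma IsSymbolOfOrder.exists_add (hN : IsSmoothNorm N) (hn : 0 < n) {α : ℂ} {f : Space n → ℂ}
    (hf : IsSymbolOfOrder N α f) :
    ∃ g h, f = g + h ∧ HasNonzeroExpansion N α g ∧ HasNonzeroExpansion N α h := by
  obtain ⟨hf, a, ha⟩ := hf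
  have : Nonempty (Fin n) := ⟨⟨0, hn⟩⟩
  obtain ⟨ξ, hξ⟩ := exists_ne (0 : Space n)
  set w := Complex.exp (α * Real.log (N ξ)) with hw
  have hw0 : w ≠ 0 := Complex.exp_ne_zero _
  -- One of c = 1 and c = −1 works, for otherwise w = 0.
  obtain ⟨c, hc, hac⟩ : ∃ c : ℂ, c ≠ 0 ∧ a 0 ξ + c * w ≠ 0 := by
    by_contra! h
    have h1 := h 1 one_ne_zero
    have h2 := h (-1) (by simp)
    refine hw0 ?_
    linear_combination (h1 - h2) / 2
  refine ⟨f + homogeneousSymbol N α c, homogeneousSymbol N α (-c), ?_, ?_, ?_⟩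
  · funext η
    simp only [Pi.add_apply, homogeneousSymbol]
    ring
  · exact ⟨hf.add (hN.contDiff_homogeneousSymbol α c), _,
      ha.add hf (hN.hasSymbolExpansion_homogeneousSymbol α c)
        (hN.contDiff_homogeneousSymbol α c), 0, ξ, hξ, by simpa using hac⟩
  · exact ⟨hN.contDiff_homogeneousSymbol α (-c), _,
      hN.hasSymbolExpansion_homogeneousSymbol α (-c), 0, ξ, hξ, by simpa using hc⟩

end order

/-- The slots are passed from S to T one at a time, expanding the slot concerned by additivity. -/
lemma MultilinearMap.eq_of_forall_exists_add {k : ℕ} {V A : Type*} [AddCommGroup V] [Module ℂ V]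
    [AddCommGroup A] [Module ℂ A] {F G : MultilinearMap ℂ (fun _ : Fin k => V) A}
    {S T : Fin k → Set V} (hT : ∀ i, ∀ x ∈ T i, ∃ y ∈ S i, ∃ y' ∈ S i, x = y + y')
    (h : ∀ σ : Fin k → V, (∀ i, σ i ∈ S i) → F σ = G σ) {σ : Fin k → V} (hσ : ∀ i, σ i ∈ T i) :
    F σ = G σ := by
  have key : ∀ (s : Finset (Fin k)) (σ : Fin k → V), (∀ i ∈ s, σ i ∈ T i) → (∀ i ∉ s, σ i ∈ S i) →
      F σ = G σ := by
    intro s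
    induction s using Finset.induction_on with
    | empty => exact fun σ _ hS => h σ fun i => hS i (Finset.notMem_empty i)
    | insert i s hi ih =>
      intro σ hσT hσS
      obtain ⟨y, hy, y', hy', hyy⟩ := hT i _ (hσT i (Finset.mem_insert_self i s))
      have hu : ∀ x ∈ S i, F (Function.update σ i x) = G (Function.update σ i x) := by
        refine fun x hx => ih _ (fun j hj => ?_) fun j hj => ?_
        · rw [Function.update_of_ne (show j ≠ i from fun hji => hi (hji ▸ hj))]
          exact hσT j (Finset.mem_insert_of_mem hj)
        · by_cases hji : j = i
          · subst hji
            rwa [Function.update_self]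
          · rw [Function.update_of_ne hji]
            exact hσS j (by simp [hji, hj])
      rw [← Function.update_eq_self i σ, hyy, F.map_update_add, G.map_update_add, hu y hy, hu y' hy']
  exact key Finset.univ σ (fun i _ => hσ i) fun i hi => absurd (Finset.mem_univ i) hi

/-! ### Agreement with the cut-off integral when no left partial sum is an integer. -/

section agreement

lemma leftSums_exponents_subset {X : Type*} (n : ℕ) (β : X → ℂ) (l : List X) :
    leftSums (l.map fun x => exponents n (β x)) ⊆
      {e | ∃ p, p ≠ [] ∧ p <+: l ∧ ∃ j : ℤ, e = (p.map β).sum + j} := by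
  induction l with
  | nil => simp [leftSums]
  | cons x l ih =>
    rw [List.map_cons, leftSums]
    rintro _ ⟨_, ⟨_, ⟨j, rfl⟩, _, rfl, rfl⟩, e, he, rfl⟩
    rcases he with rfl | he
    · exact ⟨[x], by simp, ⟨l, rfl⟩, -j + (n - 1 : ℕ) + 1, by simp; ring⟩
    · obtain ⟨p, -, hp, i, rfl⟩ := ih he
      exact ⟨x :: p, by simp, (List.prefix_cons_inj x).2 hp, -j + (n - 1 : ℕ) + 1 + i, by
        simp; ring⟩

/-- Here the centre z = 0 is included. The finitely many prefix sums are continuous and nonintegral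
at 0, so they stay nonintegral nearby. -/
lemma eventually_zero_notMem_leftSums {X : Type*} (n : ℕ) {β : X → ℂ → ℂ} {l : List X}
    (hβ : ∀ x ∈ l, ContinuousAt (β x) 0)
    (h : ∀ p, p ≠ [] → p <+: l → ∀ j : ℤ, (p.map (β · 0)).sum ≠ j) :
    ∀ᶠ z in 𝓝 0, 0 ∉ leftSums (l.map fun x => exponents n (β x z)) := by
  have h1 : ∀ᶠ z in 𝓝 (0 : ℂ), ∀ p ∈ {p | p ∈ l.inits}, p ≠ [] →
      Complex.exp (2 * Real.pi * Complex.I * (p.map (β · z)).sum) ≠ 1 := by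
    refine (Set.Finite.eventually_all (List.finite_toSet _)).2 fun p hp => ?_
    have hp : p <+: l := (List.mem_inits p l).1 hp
    by_cases hp0 : p = []
    · simp [hp0]
    have hc : ContinuousAt (fun z => (p.map (β · z)).sum) 0 :=
      tendsto_list_sum _ fun x hx => hβ x (hp.subset hx)
    have hc' : ContinuousAt
        (fun z => Complex.exp (2 * Real.pi * Complex.I * (p.map (β · z)).sum)) 0 :=
      (continuousAt_const.mul hc).cexp
    refine (hc'.eventually_ne fun h' => ?_).mono fun z hz _ => hz
    obtain ⟨j, hj⟩ := Complex.exp_eq_one_iff.1 h'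
    refine h p hp0 hp j (mul_left_cancel₀ Complex.two_pi_I_ne_zero ?_)
    rw [hj, mul_comm]
  filter_upwards [h1] with z hz h0
  obtain ⟨p, hp0, hp, j, hj⟩ := leftSums_exponents_subset n (β · z) l h0
  refine hz p ((List.mem_inits p l).2 hp) hp0 (Complex.exp_eq_one_iff.2 ⟨-j, ?_⟩)
  rw [eq_neg_of_add_eq_zero_left hj.symm]
  push_cast
  ring

variable {n : ℕ} {N : Seminorm ℝ (Space n)} {W : Set ℂ} {R : ℂ → Symbols N →ₗ[ℂ] Symbols N}
  {r : ℝ}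

lemma analyticAt_regularisedIntegral (hN : IsSmoothNorm N) (hW : IsOpen W) (h0 : (0 : ℂ) ∈ W)
    {X : Type*} {σ : X → Symbols N} {β : X → ℂ → ℂ}
    (hσ : ∀ x, IsSimpleHolomorphicFamily N W (β x) (fun z => (R z (σ x) : Space n → ℂ)))
    {l : List X} (h : ∀ p, p ≠ [] → p <+: l → ∀ j : ℤ, (p.map (β · 0)).sum ≠ j) :
    AnalyticAt ℂ (regularisedIntegral R r (l.map σ)) 0 := by
  have h1 := analyticAt_finitePart_iterInt (z₀ := 0) (l := l)
    (a := fun x z => radial N (R z (σ x))) (E := fun x z => exponents n (β x z))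
    (fun x _ => (hσ x).exists_isRadialFamily hN hW h0)
    (by
      filter_upwards [hW.mem_nhds h0] with z hz x _ M
      obtain ⟨B, hB⟩ := (hσ x).exists_isRadialFamily hN hW hz
      obtain ⟨V, -, hzV, hV⟩ := hB M
      exact hV.hasExpansion hzV)
    (eventually_zero_notMem_leftSums n
      (fun x _ => ((hσ x).1.differentiableAt (hW.mem_nhds h0)).continuousAt) h) r
  have h2 : regularisedIntegral R r (l.map σ) =
      fun z => finitePart (iterInt r (l.map fun x => radial N (R z (σ x)))) := by
    funext z
    rw [regularisedIntegral, List.map_map]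
    rfl
  rwa [h2]

lemma sum_map_ne_int_of_prefix {k : ℕ} {α β : Fin k → ℂ} (hαβ : ∀ i, ∃ m : ℤ, β i = α i + m)
    (hα : ∀ (m : Fin k) (j : ℤ), ∑ i ∈ Finset.Iic m, α i ≠ j) {p : List (Fin k)} (hp : p ≠ [])
    (hpk : p <+: List.finRange k) (j : ℤ) : (p.map β).sum ≠ j := by
  choose m hm using hαβ
  have hlen : p.length ≤ k := by simpa using hpk.length_le
  have hpos := List.length_pos_iff.2 hp
  rw [List.prefix_iff_eq_take.1 hpk, List.map_take, ← List.ofFn_eq_map, List.sum_take_ofFn]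
  have hI : Finset.univ.filter (fun i : Fin k => i.val < p.length) =
      Finset.Iic (⟨p.length - 1, by omega⟩ : Fin k) := by
    ext i
    simp only [Finset.mem_filter, Finset.mem_univ, true_and, Finset.mem_Iic, Fin.le_def]
    omega
  rw [hI]
  intro h
  refine hα ⟨p.length - 1, by omega⟩ (j - ∑ i ∈ Finset.Iic (⟨p.length - 1, by omega⟩ : Fin k), m i) ?_
  simp only [hm, Finset.sum_add_distrib] at h
  push_cast
  exact eq_sub_of_add_eq h

/-- At z = 0 the order of the i-th regularised family agrees with α_i modulo ℤ, because σ_i has a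
nonzero expansion. All prefixes are therefore sent to functions analytic at 0, so Φ₊ = Φ on the
tensor, and its value at 0 is the Chen integral of the unregularised symbols since R 0 = id. -/
lemma value_eq_of_hasNonzeroExpansion (hN : IsSmoothNorm N) (hn : 0 < n) (hW : IsOpen W)
    (h0 : (0 : ℂ) ∈ W) (hR : IsHolomorphicRegularisation N W R) (hr : 0 ≤ r)
    (hS : IsSimpleRegularisation N W R) {Φm Φp : Tensors (Symbols N) →ₗ[ℂ] Mero W}
    (h : IsBirkhoffDecomposition (chenCharacter hR hN hn hW hr) Φm Φp) {k : ℕ}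
    {σ : Fin k → Symbols N} {α : Fin k → ℂ}
    (hσ : ∀ i, HasNonzeroExpansion N (α i) (σ i : Space n → ℂ))
    (hα : ∀ (m : Fin k) (j : ℤ), ∑ i ∈ Finset.Iic m, α i ≠ j) :
    (Φp (pureTensor σ)).HasValueAtZero (cutoffChen N r fun i => (σ i : Space n → ℂ)) := by
  choose β hβ using fun i =>
    hS (α i) (σ i) ⟨(hσ i).1, (hσ i).2.choose, (hσ i).2.choose_spec.1⟩
  have hαβ : ∀ i, ∃ m : ℤ, β i 0 = α i + m := fun i => by
    obtain ⟨-, a, ha, j, ξ, hξ, hj⟩ := hσ i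
    obtain ⟨-, -, b, hb, -⟩ := hβ i
    have hb := hb 0 h0
    simp only [hR.1] at hb
    exact ha.exists_int_of_ne_zero hN hb hξ hj
  have hval : ∀ p : List (Fin k), p <+: List.finRange k →
      (chenCharacter hR hN hn hW hr (word (p.map σ))).HasValueAtZero
        (regularisedIntegral R r (p.map σ) 0) := fun p hp =>
    ⟨_, chenCharacter_word_represents hR hN hn hW hr _, analyticAt_regularisedIntegral hN hW h0 hβ
      fun q hq hqp => sum_map_ne_int_of_prefix hαβ hα hq (hqp.trans hp), rfl⟩
  have hΦ := isShuffleCharacter_chenCharacter hR hN hn hW hr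
  have heq := birkhoff_eq_of_mem (Mero.isCompl_polar hW h0) (isShuffleCharacter_iff.1 hΦ).1
    h.minus_nil (fun _ hl => h.minus_mem_polar hl) (fun l => h.plus_mem hW h0 _)
    (l := List.ofFn σ) fun p _ hp => by
      have hp' : p = ((List.finRange k).take p.length).map σ := by
        rw [List.map_take, ← List.ofFn_eq_map]
        exact List.prefix_iff_eq_take.1 hp
      rw [hp']
      exact ⟨_, hval _ (List.take_prefix _ _)⟩
  rw [← h.plus_eq, word_ofFn] at heq
  rw [heq]
  have h2 := hval _ (List.prefix_refl _)
  rw [← List.ofFn_eq_map, word_ofFn, ← cutoffChen_eq_regularisedIntegral hN hn hr] at h2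
  simpa only [hR.1] using h2

end agreement

end ChenRenorm

end

theorem mainTheorem7 (n : ℕ) (hn : 0 < n)
    (N : Seminorm ℝ (Space n)) (hN : IsSmoothNorm N)
    (W : Set ℂ) (hW : IsOpen W) (h0 : (0 : ℂ) ∈ W)
    (R : ℂ → Symbols N →ₗ[ℂ] Symbols N) (hR : IsHolomorphicRegularisation N W R)
    (r : ℝ) (hr : 0 ≤ r) :
    -- cut-off Chen integrals are well defined
    (∀ (k : ℕ) (σ : Fin k → Symbols N),
      ∃! c : ℂ, HasFinitePart (fun ρ => chenIntegral N r ρ (fun i => (σ i : Space n → ℂ))) c) ∧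
    -- the regularised cut-off Chen integrals define a meromorphic shuffle character
    ∃ Φ : Tensors (Symbols N) →ₗ[ℂ] Mero W,
      (∀ (k : ℕ) (σ : Fin k → Symbols N),
        (Φ (pureTensor σ)).Represents
          (fun z => cutoffChen N r (fun i => (R z (σ i) : Space n → ℂ)))) ∧
      IsShuffleCharacter Φ ∧
      -- it has a unique Birkhoff decomposition
      ∃ Φm Φp : Tensors (Symbols N) →ₗ[ℂ] Mero W,
        IsBirkhoffDecomposition Φ Φm Φp ∧
        (∀ Φm' Φp' : Tensors (Symbols N) →ₗ[ℂ] Mero W,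
          IsBirkhoffDecomposition Φ Φm' Φp' → Φm' = Φm ∧ Φp' = Φp) ∧
        -- `φ = Φ₊(0)` is a character extending the regularised integral
        ∃ φ : Tensors (Symbols N) →ₗ[ℂ] ℂ,
          (∀ x, (Φp x).HasValueAtZero (φ x)) ∧
          IsShuffleCharacter φ ∧
          (∀ σ : Symbols N, IsFinitePartAtZero
            (fun z => cutoffIntegral N r (R z σ : Space n → ℂ)) (φ (pureTensor ![σ]))) ∧
          -- and it agrees with the cut-off Chen integral off integer left partial sums of orders
          (IsSimpleRegularisation N W R →
            ∀ (k : ℕ) (σ : Fin k → Symbols N) (α : Fin k → ℂ),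
              (∀ i, IsSymbolOfOrder N (α i) (σ i : Space n → ℂ)) →
              (∀ (m : Fin k) (j : ℤ), ∑ i ∈ Finset.Iic m, α i ≠ (j : ℂ)) →
              φ (pureTensor σ) = cutoffChen N r (fun i => (σ i : Space n → ℂ))) := by
  refine ⟨fun k σ => ⟨_, hN.hasFinitePart_cutoffChen hn hr σ,
    fun c hc => hc.unique (hN.hasFinitePart_cutoffChen hn hr σ)⟩,
    chenCharacter hR hN hn hW hr, fun k σ => chenCharacter_represents hR hN hn hW hr σ,
    isShuffleCharacter_chenCharacter hR hN hn hW hr, ?_⟩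
  have hΦ := isShuffleCharacter_chenCharacter hR hN hn hW hr
  obtain ⟨Φm, Φp, hB⟩ := exists_isBirkhoffDecomposition hW h0 hΦ
  obtain ⟨φ, hφ, hφc⟩ := hB.exists_value hW h0
  refine ⟨Φm, Φp, hB, fun _ _ h => hB.unique hW h0 hΦ h, φ, hφ, hφc, fun σ => ?_,
    fun hS k σ α hσ hα => ?_⟩
  · refine hB.isFinitePartAtZero hW h0 hΦ (v := σ) ?_ ?_
    · rw [← word_ofFn]
      exact hφ _
    · simp only [cutoffIntegral_eq_cutoffChen]
      convert chenCharacter_represents hR hN hn hW hr ![σ] using 2 with z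
      · rw [← word_ofFn]
        rfl
      · congr 1
        funext i
        rw [Matrix.cons_val_fin_one, Matrix.cons_val_fin_one]
  -- Both sides are multilinear in the symbols, which reduces the claim to symbols with nonzero
  -- expansions of the same orders.
  · refine MultilinearMap.eq_of_forall_exists_add (G := cutoffChenMultilinear hN hn hr k)
      (F := (φ ∘ₗ ofDeg k).compMultilinearMap (PiTensorProduct.tprod ℂ))
      (S := fun i => {f | HasNonzeroExpansion N (α i) (f : Space n → ℂ)})
      (T := fun i => {f | IsSymbolOfOrder N (α i) (f : Space n → ℂ)}) ?_ ?_ hσ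
    · intro i f hf
      obtain ⟨g, g', hgg', hg, hg'⟩ := IsSymbolOfOrder.exists_add hN hn hf
      have hmem : ∀ {g : Space n → ℂ}, HasNonzeroExpansion N (α i) g → g ∈ Symbols N :=
        fun hg => Submodule.subset_span ⟨α i, hg.1, hg.2.choose, hg.2.choose_spec.1⟩
      exact ⟨⟨g, hmem hg⟩, hg, ⟨g', hmem hg'⟩, hg', Subtype.ext hgg'⟩
    · intro τ hτ
      exact (hφ _).unique hW h0 (value_eq_of_hasNonzeroExpansion hN hn hW h0 hR hr hS hB hτ hα)
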